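/- Let $d\in\{1,2,3\}$, $\mathbb T^d=\mathbb R^d/2\pi\mathbb Z^d$, $0<\nu\le 1$, and let $h_0\in H^2(\mathbb T^d)$ be real-valued with mean zero. Let $h$ be a global solution, with initial datum $h_0$, of $$\partial_t h=\nabla\cdot\big((|\nabla h|^2-1)\nabla h\big)-\nu\Delta^2h ,$$ that is, a mild solution $$h(t)=e^{-\nu t\Delta^2}h_0+\int_0^t\nabla\cdot e^{-\nu(t-s)\Delta^2}\big((|\nabla h|^2-1)\nabla h\big)(s)\,ds,\qquad t\ge 0,$$ with $h\in C_t^0H_x^{d/2}$, $t^{1/4}h\in C_t^0H_x^{d/2+1}$ and $t^{1/4}\nabla h\in C_t^0C_x^0$ on $[0,\infty)\times\mathbb T^d$ (the weighted functions being $0$ at $t=0$). Put $$E_0=\int_{\mathbb T^d}\Big(\tfrac12\nu|\Delta h_0|^2+\tfrac14\big(|\nabla h_0|^2-1\big)^2\Big)dx .$$ 1. If $d=1$, there is an absolute constant $C_1>0$ such that $$\|\nabla h(t)\|_\infty\le C_1\,\nu^{-1/6}E_0^{1/6}\big(E_0^{1/6}+1\big)\qquad\text{for all }t\ge 0 .$$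 2. If $d=2$, for every $\tau>0$ there is a constant $C_2>0$ depending only on $\tau$ such that $$\|\nabla h(t)\|_\infty\le C_2\Big(\frac{E_0}{\nu}\Big)^{1/2}\Big|\log\frac{E_0+1}{\nu}\Big|\qquad\text{for all }t\ge\tau .$$ 3. If $d=3$, for every $\tau>0$ there is a constant $C_3>0$ depending only on $\tau$ such that $$\|\nabla h(t)\|_\infty\le C_3\,\nu^{-3/2}(E_0+1)^{3/2}\qquad\text{for all }t\ge\tau .$$ 4. If $d=2$, for every $T>0$ there is a constant $C_2'>0$ depending only on $T$ such that $$\|\nabla h(t)-\nabla e^{-\nu t\Delta^2}h_0\|_\infty\le C_2'\Big(\frac{E_0}{\nu}\Big)^{1/2}\Big|\log\frac{E_0+1}{\nu}\Big|\qquad\text{for all }0\le t\le T .$$ 5. If $d=3$, for every $T>0$ there is a constant $C_3'>0$ depending only on $T$ such that $$\|\nabla h(t)-\nabla e^{-\nu t\Delta^2}h_0\|_\infty\le C_3'\,\nu^{-3/2}(E_0+1)^{3/2}\qquad\text{for all }0\le t\le T .$$ None of the constants depends on $\nu$, $h_0$ or $h$. -/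

import Mathlib

open MeasureTheory Filter Topology
open scoped ENNReal

namespace ThinFilm

instance twoPiPos : Fact (0 < 2 * Real.pi) := ⟨Real.two_pi_pos⟩

/-- The `2π`-periodic torus `ℝ^d / 2πℤ^d`. Its `volume` is the product Lebesgue measure, of total
mass `(2π)^d`. -/
abbrev Torus (d : ℕ) : Type := Fin d → AddCircle (2 * Real.pi)

/-- The Euclidean space in which gradients take their values. -/
abbrev Vec (d : ℕ) : Type := EuclideanSpace ℝ (Fin d)

/-- The Euclidean length `|k|` of a frequency `k ∈ ℤ^d`. -/
noncomputable def freqNorm {d : ℕ} (k : Fin d → ℤ) : ℝ := Real.sqrt (∑ j, (k j : ℝ) ^ 2)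

/-- The Fourier coefficient `∫ f(x) e^{-i k·x} dx`. On the circle of length `2π` the monomial
`fourier n` of Mathlib is `x ↦ e^{i n x}`. -/
noncomputable def coeff {d : ℕ} (f : Torus d → ℝ) (k : Fin d → ℤ) : ℂ :=
  ∫ x, (f x : ℂ) * ∏ j, fourier (-(k j)) (x j)

/-- The norm `‖f‖_{H^s} = (∑_k (1 + |k|^{2s}) |f̂(k)|²)^{1/2}`, with values in `[0, ∞]`. -/
noncomputable def sobolevNorm {d : ℕ} (s : ℝ) (f : Torus d → ℝ) : ℝ≥0∞ :=
  (∑' k : Fin d → ℤ, ENNReal.ofReal ((1 + freqNorm k ^ (2 * s)) * ‖coeff f k‖ ^ 2)) ^ (1 / 2 : ℝ)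

/-- `f ∈ H^s`, for `s ≥ 0`. -/
def MemSobolev {d : ℕ} (s : ℝ) (f : Torus d → ℝ) : Prop :=
  MemLp f 2 volume ∧ sobolevNorm s f < ⊤

/-- `u ∈ C_t^0 H^s_x` on the time interval `[0, ∞)`. -/
def ContInSobolev {d : ℕ} (s : ℝ) (u : ℝ → Torus d → ℝ) : Prop :=
  ∀ t, 0 ≤ t → MemSobolev s (u t) ∧
    Tendsto (fun r => sobolevNorm s (u r - u t)) (𝓝[Set.Ici 0] t) (𝓝 0)

open Classical in
/-- The Fourier multiplier with symbol `m` applied to `f`: the real integrable function, unique up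
to a null set, whose Fourier coefficients are `m(k) f̂(k)`. (If there is none, the value is `0`.) -/
noncomputable def fourierMul {d : ℕ} (m : (Fin d → ℤ) → ℂ) (f : Torus d → ℝ) : Torus d → ℝ :=
  if h : ∃ g : Torus d → ℝ, Integrable g volume ∧ ∀ k, coeff g k = m k * coeff f k
  then h.choose else 0

/-- The (weak) gradient; `∂_j` has symbol `i k_j`. -/
noncomputable def grad {d : ℕ} (f : Torus d → ℝ) (x : Torus d) : Vec d :=
  WithLp.toLp 2 fun j => fourierMul (fun k => Complex.I * (k j : ℂ)) f x

/-- The (weak) Laplacian, with symbol `-|k|²`. -/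
noncomputable def lap {d : ℕ} (f : Torus d → ℝ) : Torus d → ℝ :=
  fourierMul (fun k => -((freqNorm k ^ 2 : ℝ) : ℂ)) f

/-- The biharmonic propagator `e^{-ν t Δ²}`, with symbol `e^{-ν t |k|⁴}`. -/
noncomputable def propagator {d : ℕ} (ν t : ℝ) (f : Torus d → ℝ) : Torus d → ℝ :=
  fourierMul (fun k => ((Real.exp (-(ν * t * freqNorm k ^ 4)) : ℝ) : ℂ)) f

/-- The energy `∫ (ν/2 |Δf|² + 1/4 (|∇f|² - 1)²) dx`. -/
noncomputable def energy {d : ℕ} (ν : ℝ) (f : Torus d → ℝ) : ℝ :=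
  ∫ x, (1 / 2 * ν * (lap f x) ^ 2 + 1 / 4 * (‖grad f x‖ ^ 2 - 1) ^ 2)

/-- The flux `(|∇f|² - 1) ∇f`. -/
noncomputable def flux {d : ℕ} (f : Torus d → ℝ) (x : Torus d) : Vec d :=
  (‖grad f x‖ ^ 2 - 1) • grad f x

/-- `h` is a global solution, with initial datum `h₀`, of
`∂ₜh = ∇·((|∇h|² - 1)∇h) - νΔ²h` on the torus: a mild solution in the class
`h ∈ C_t^0 H^{d/2}`, `t^{1/4} h ∈ C_t^0 H^{d/2+1}`, `t^{1/4} ∇h ∈ C_t^0 C_x^0` on `[0, ∞)`. -/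
structure IsGlobalSolution {d : ℕ} (ν : ℝ) (h₀ : Torus d → ℝ) (h : ℝ → Torus d → ℝ) : Prop where
  initial : h 0 =ᵐ[volume] h₀
  cont : ContInSobolev ((d : ℝ) / 2) h
  cont_weighted : ContInSobolev ((d : ℝ) / 2 + 1) (fun t x => t ^ (1 / 4 : ℝ) * h t x)
  cont_grad : ∃ G : ℝ → C(Torus d, Vec d), ContinuousOn G (Set.Ici 0) ∧
    ∀ t, 0 ≤ t → (fun x => t ^ (1 / 4 : ℝ) • grad (h t) x) =ᵐ[volume] G t
  /-- `h(t) = e^{-νtΔ²} h₀ + ∫₀ᵗ ∇·e^{-ν(t-s)Δ²} ((|∇h|² - 1)∇h)(s) ds`, written for each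
  Fourier coefficient. -/
  mild : ∀ t, 0 ≤ t → ∀ k : Fin d → ℤ,
    coeff (h t) k = ((Real.exp (-(ν * t * freqNorm k ^ 4)) : ℝ) : ℂ) * coeff h₀ k +
      ∫ s in (0 : ℝ)..t, ((Real.exp (-(ν * (t - s) * freqNorm k ^ 4)) : ℝ) : ℂ) *
        ∑ j, Complex.I * (k j : ℂ) * coeff (fun x => flux (h s) x j) k

/-- The `L^∞` norm, in `[0, ∞]`, of the Euclidean length of a vector field. -/
noncomputable def supNorm {d : ℕ} (v : Torus d → Vec d) : ℝ≥0∞ := eLpNorm v ⊤ volume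

end ThinFilm

open ThinFilm

namespace ThinFilm

open scoped ComplexConjugate

/-! ### Fourier series on the torus -/

/-! A solution is replaced by its Fourier coefficients `c t k` together with its continuous gradient
`g t` (`MildFlow`). Everything is then measured by the Sobolev norms `hnorm n`, that is `‖|k|^n
c_k‖` in ℓ², and by `anorm`, the sum of `|k| ‖c_k‖`, which dominates the sup norm of the gradient.

The equation is the L² gradient flow of the energy, so the energy never exceeds `E₀`. Hence at every
time `‖Δh‖₂ ≲ (E₀/ν)^{1/2}` and `‖|∇h|² - 1‖₂ ≲ E₀^{1/2}`. In dimension one this is enough: for `u =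
h'` one has `‖u‖_∞³ ≤ 3 ‖u²‖₂ ‖u'‖₂` (`norm_gradTrig_pow_three_le`), and a cube root gives the
bound.

In dimensions two and three H² does not control `∇h` uniformly, and the smoothing of the biharmonic
semigroup is used. Duhamel's formula is restarted at a time `a`. By Cauchy–Schwarz the linear part
costs `‖Δh(a)‖₂` times the square root of the lattice sum of `|k|^{-2} e^{-ν(t-a)|k|⁴}`. The flux
`(|∇h|² - 1)∇h` has L² norm at most a multiple of `E₀^{1/2} ‖∇h‖_∞`, which is linear in the unknown
(`hnorm_zero_fluxC_le_energy`), and the kernel carrying it to the gradient is of size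
`(ν(t-s))^{-7/8}`, which is integrable. On a window of length `δ` with `E₀^{1/2} ν^{-7/8} δ^{1/8}`
small the Duhamel part is therefore absorbed (`norm_le_of_energy`). The absorption is an iteration,
`le_of_halving`: the solution class supplies a rough bound `M (s-a)^{-1/4}`, and each pass through
Duhamel halves `M`.

Restarting at `t - δ` covers all `t ≥ δ`. Before `δ` only the Duhamel part is bounded, which is why
the last two statements subtract the linear evolution. Finally `δ` is a power of `ν` and `1/(E₀+1)`:
the lattice sum is bounded by a power of `1/(νδ)` for `d ≤ 3` and by a squared logarithm for `d =
2`, whence the two shapes of the result.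

The energy inequality itself needs care. At positive times parabolic bootstrapping gives H³ bounds,
and the energy of a Fourier truncation has derivative at most `O(N^{-2})`
(`exists_deriv_truncEnergy_le`). At time zero one needs `h(t) → h₀` in H². This comes from `t^{1/4}
∇h → 0` uniformly, again by halving (`sob_le_of_rough_bound`), and the embedding of H¹ in L⁴ then
controls the quartic part of the energy. -/

/-- The monomial `x ↦ e^{i k·x}` on the torus. -/
noncomputable def mexp {d : ℕ} (k : Fin d → ℤ) : C(Torus d, ℂ) where
  toFun x := ∏ j, fourier (k j) (x j)
  continuous_toFun := by fun_prop

section Monomials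

variable {d : ℕ}

lemma mexp_apply (k : Fin d → ℤ) (x : Torus d) : mexp k x = ∏ j, fourier (k j) (x j) := rfl

lemma mexp_neg (k : Fin d → ℤ) (x : Torus d) : mexp (-k) x = conj (mexp k x) := by
  simp only [mexp_apply, Pi.neg_apply, fourier_neg, map_prod]

lemma mexp_add (k l : Fin d → ℤ) (x : Torus d) : mexp (k + l) x = mexp k x * mexp l x := by
  simp only [mexp_apply, Pi.add_apply, fourier_add, ← Finset.prod_mul_distrib]

lemma mexp_zero : mexp (0 : Fin d → ℤ) = 1 := by
  ext x
  simp [mexp_apply]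

lemma norm_mexp_apply (k : Fin d → ℤ) (x : Torus d) : ‖mexp k x‖ = 1 := by
  simp [mexp_apply, fourier_apply, norm_prod, Circle.norm_coe]

lemma norm_mexp (k : Fin d → ℤ) : ‖mexp k‖ = 1 := by
  apply le_antisymm
  · exact (ContinuousMap.norm_le _ zero_le_one).mpr fun x => (norm_mexp_apply k x).le
  · exact (norm_mexp_apply k 0).symm.le.trans ((mexp k).norm_coe_le_norm 0)

lemma mexp_add_arg (k : Fin d → ℤ) (x y : Torus d) :
    mexp k (x + y) = mexp k x * mexp k y := by
  simp only [mexp_apply, ← Finset.prod_mul_distrib]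
  refine Finset.prod_congr rfl fun j _ => ?_
  simp [fourier_apply, AddCircle.toCircle_add, smul_add]

lemma mexp_single (z : Torus d) (i : Fin d) :
    mexp (Pi.single i 1) z = fourier 1 (z i) := by
  rw [mexp_apply, Finset.prod_eq_single i]
  · simp
  · intro j _ hj
    simp [Pi.single_eq_of_ne hj]
  · simp

open Submodule Algebra in
/-- The linear span of the monomials is dense in the continuous functions. -/
theorem span_mexp_closure_eq_top :
    (span ℂ (Set.range (mexp (d := d)))).topologicalClosure = ⊤ := by
  -- Stone–Weierstrass: the span of the monomials is closed under products, is stable under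
  -- conjugation through `k ↦ -k`, and separates points by the monomials of a single coordinate.
  let A : StarSubalgebra ℂ C(Torus d, ℂ) :=
    { toSubalgebra := Algebra.adjoin ℂ (Set.range mexp)
      star_mem' := by
        change Algebra.adjoin ℂ (Set.range mexp) ≤ star (Algebra.adjoin ℂ (Set.range mexp))
        refine adjoin_le ?_
        rintro _ ⟨n, rfl⟩
        refine subset_adjoin ⟨-n, ?_⟩
        ext1 x
        simp only [mexp_neg, starRingEnd_apply, ContinuousMap.star_apply] }
  have hA : A.toSubalgebra.toSubmodule = span ℂ (Set.range (mexp (d := d))) := by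
    apply adjoin_eq_span_of_subset
    refine .trans (fun x ↦ Submonoid.closure_induction (fun _ ↦ id) ⟨0, mexp_zero⟩ ?_) subset_span
    rintro _ _ _ _ ⟨m, rfl⟩ ⟨n, rfl⟩
    exact ⟨m + n, by ext z; simp [mexp_add]⟩
  have hsep : A.SeparatesPoints := by
    intro x y hxy
    rw [Ne, funext_iff, not_forall] at hxy
    obtain ⟨i, hi⟩ := hxy
    refine ⟨_, ⟨mexp (Pi.single i 1), subset_adjoin ⟨Pi.single i 1, rfl⟩, rfl⟩, ?_⟩
    dsimp only
    rw [mexp_single, mexp_single, fourier_one, fourier_one]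
    exact fun h => hi (AddCircle.injective_toCircle Real.two_pi_pos.ne' (Circle.coe_injective h))
  have := ContinuousMap.starSubalgebra_topologicalClosure_eq_top_of_separatesPoints A hsep
  rw [← hA]
  exact congr_arg (Subalgebra.toSubmodule <| StarSubalgebra.toSubalgebra ·) this

/-- The volume of the torus. -/
noncomputable def vol (d : ℕ) : ℝ := (2 * Real.pi) ^ d

lemma vol_pos (d : ℕ) : 0 < vol d := pow_pos Real.two_pi_pos d

lemma volume_real_univ : (volume : Measure (Torus d)).real Set.univ = vol d := by
  rw [Measure.real, volume_pi, Measure.pi_univ]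
  simp [vol, AddCircle.measure_univ, Real.pi_pos.le]

lemma integral_fourier (n : ℤ) :
    ∫ x : AddCircle (2 * Real.pi), fourier n x = if n = 0 then ((2 * Real.pi : ℝ) : ℂ) else 0 := by
  rw [AddCircle.volume_eq_smul_haarAddCircle, integral_smul_measure]
  have h := orthonormal_iff_ite.mp (orthonormal_fourier (T := 2 * Real.pi)) 0 n
  rw [ContinuousMap.inner_toLp] at h
  simp only [fourier_zero, map_one, mul_one] at h
  rw [h, ENNReal.toReal_ofReal Real.two_pi_pos.le]
  by_cases hn : n = 0
  · simp [hn]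
  · simp [hn, Ne.symm hn]

lemma integral_mexp (k : Fin d → ℤ) : ∫ x, mexp k x = if k = 0 then (vol d : ℂ) else 0 := by
  simp only [mexp_apply]
  rw [MeasureTheory.integral_fintype_prod_volume_eq_prod]
  simp only [integral_fourier]
  by_cases hk : k = 0
  · simp [hk, vol]
  · obtain ⟨i, hi⟩ := Function.ne_iff.mp hk
    rw [if_neg hk]
    exact Finset.prod_eq_zero (Finset.mem_univ i) (if_neg hi)

lemma integral_conj_mexp_mul (k l : Fin d → ℤ) :
    ∫ x, conj (mexp k x) * mexp l x = if k = l then (vol d : ℂ) else 0 := by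
  have : ∀ x : Torus d, conj (mexp k x) * mexp l x = mexp (l - k) x := by
    intro x
    rw [← mexp_neg, ← mexp_add]
    congr 2
    abel
  simp only [this, integral_mexp, sub_eq_zero, eq_comm]

lemma ContinuousMap.integrable_torus {E : Type*} [NormedAddCommGroup E] [SecondCountableTopologyEither (Torus d) E] (f : C(Torus d, E)) :
    Integrable f volume := by
  refine (integrable_const ‖f‖).mono' f.continuous.aestronglyMeasurable (ae_of_all _ fun x => ?_)
  exact f.norm_coe_le_norm x

lemma coeff_eq_integral_conj (f : Torus d → ℝ) (k : Fin d → ℤ) :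
    coeff f k = ∫ x, (f x : ℂ) * conj (mexp k x) := by
  simp only [← mexp_neg]
  rfl

lemma coeff_congr_ae {f g : Torus d → ℝ} (h : f =ᵐ[volume] g) (k : Fin d → ℤ) :
    coeff f k = coeff g k := by
  refine integral_congr_ae ?_
  filter_upwards [h] with x hx
  rw [hx]

lemma integrable_mul_mexp {f : Torus d → ℝ} (hf : Integrable f volume) (k : Fin d → ℤ) :
    Integrable (fun x => (f x : ℂ) * mexp k x) volume := by
  refine hf.ofReal.mul_bdd (c := 1) (mexp k).continuous.aestronglyMeasurable (ae_of_all _ fun x => ?_)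
  exact (norm_mexp_apply k x).le

lemma coeff_neg (f : Torus d → ℝ) (k : Fin d → ℤ) : coeff f (-k) = conj (coeff f k) := by
  rw [coeff_eq_integral_conj, coeff_eq_integral_conj, ← integral_conj]
  simp [mexp_neg]

lemma integral_mul_mexp (f : Torus d → ℝ) (k : Fin d → ℤ) :
    ∫ x, (f x : ℂ) * mexp k x = conj (coeff f k) := by
  rw [← coeff_neg, coeff_eq_integral_conj]
  simp [mexp_neg]

lemma coeff_sub {f g : Torus d → ℝ} (hf : Integrable f volume) (hg : Integrable g volume)
    (k : Fin d → ℤ) : coeff (fun x => f x - g x) k = coeff f k - coeff g k := by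
  have h := integral_sub (integrable_mul_mexp hf (-k)) (integrable_mul_mexp hg (-k))
  simp only [← sub_mul] at h
  simp only [coeff_eq_integral_conj, ← mexp_neg]
  rw [← h]
  congr with x
  push_cast
  rfl

lemma coeff_const_mul (a : ℝ) (f : Torus d → ℝ) (k : Fin d → ℤ) :
    coeff (fun x => a * f x) k = a * coeff f k := by
  rw [coeff_eq_integral_conj, coeff_eq_integral_conj, ← integral_const_mul]
  simp [mul_assoc]

lemma norm_coeff_le_of_bound {f : Torus d → ℝ} {C : ℝ} (hf : ∀ᵐ x, |f x| ≤ C) (k : Fin d → ℤ) :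
    ‖coeff f k‖ ≤ vol d * C := by
  rw [coeff_eq_integral_conj]
  refine (norm_integral_le_of_norm_le_const (C := C) ?_).trans (le_of_eq ?_)
  · filter_upwards [hf] with x hx
    simpa [norm_mexp_apply] using hx
  · rw [volume_real_univ, mul_comm]

/-- Translation acts on Fourier coefficients by a phase. -/
lemma coeff_translate (f : Torus d → ℝ) (y : Torus d) (k : Fin d → ℤ) :
    coeff (fun x => f (x + y)) k = mexp k y * coeff f k := by
  rw [coeff_eq_integral_conj, coeff_eq_integral_conj, ← integral_const_mul]
  rw [← integral_add_right_eq_self (fun x => mexp k y * ((f x : ℂ) * conj (mexp k x))) y]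
  congr with x
  rw [mexp_add_arg, map_mul]
  have : mexp k y * conj (mexp k y) = 1 := by
    rw [Complex.mul_conj, Complex.normSq_eq_norm_sq, norm_mexp_apply]; simp
  linear_combination (-(f (x+y) : ℂ) * conj (mexp k x)) * this

/-- An integrable function is determined by its Fourier coefficients. -/
theorem ae_eq_zero_of_coeff_eq_zero {f : Torus d → ℝ} (hf : Integrable f volume)
    (h : ∀ k, coeff f k = 0) : f =ᵐ[volume] 0 := by
  -- An integrable `f` need not be square integrable, so no Hilbert basis is available. It acts
  -- instead as a bounded functional on continuous functions, which vanishes on the dense span of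
  -- the monomials.
  have hcont : ∀ φ : C(Torus d, ℂ), ∫ x, (f x : ℂ) * φ x = 0 := by
    have hint : ∀ φ : C(Torus d, ℂ), Integrable (fun x => (f x : ℂ) * φ x) volume := fun φ =>
      hf.ofReal.mul_bdd (c := ‖φ‖) φ.continuous.aestronglyMeasurable
        (ae_of_all _ fun x => φ.norm_coe_le_norm x)
    let Λ : C(Torus d, ℂ) →L[ℂ] ℂ := LinearMap.mkContinuous
      { toFun := fun φ => ∫ x, (f x : ℂ) * φ x
        map_add' := fun φ ψ => by
          rw [← integral_add (hint φ) (hint ψ)]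
          simp [mul_add]
        map_smul' := fun a φ => by
          simp only [RingHom.id_apply, smul_eq_mul, ← integral_const_mul]
          congr with x
          simp
          ring } (∫ x, |f x|) (fun φ => by
          refine (norm_integral_le_integral_norm _).trans ?_
          rw [← integral_mul_const]
          refine integral_mono (hint φ).norm (hf.abs.mul_const _) fun x => ?_
          simp only [norm_mul, Complex.norm_real, Real.norm_eq_abs]
          gcongr
          exact φ.norm_coe_le_norm x)
    have hker : (Submodule.span ℂ (Set.range (mexp (d := d)))).topologicalClosure ≤
        LinearMap.ker (Λ : C(Torus d, ℂ) →ₗ[ℂ] ℂ) := by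
      refine Submodule.topologicalClosure_minimal _ ?_ Λ.isClosed_ker
      rw [Submodule.span_le]
      rintro _ ⟨k, rfl⟩
      change ∫ x, (f x : ℂ) * mexp k x = 0
      rw [integral_mul_mexp, h, map_zero]
    intro φ
    rw [span_mexp_closure_eq_top] at hker
    exact hker (Submodule.mem_top (x := φ))
  have hreal : ∀ φ : C(Torus d, ℝ), ∫ x, f x * φ x = 0 := by
    intro φ
    have := hcont ⟨fun x => (φ x : ℂ), by fun_prop⟩
    simp only [ContinuousMap.coe_mk, ← Complex.ofReal_mul] at this
    exact Complex.ofReal_eq_zero.mp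
      ((integral_ofReal (𝕜 := ℂ) (f := fun x => f x * φ x)).symm.trans this)
  -- The indicator of a closed set is a pointwise limit of continuous functions with values in `[0,
  -- 1]`, so dominated convergence by `|f|` carries the vanishing over to integrals on closed sets.
  refine ae_eq_zero_of_forall_setIntegral_isClosed_eq_zero hf fun s hs => ?_
  have hlim := tendsto_integral_of_dominated_convergence (μ := volume)
    (F := fun n x => f x * ((thickenedIndicator (δ := 1 / ((n : ℝ) + 1)) (by positivity) s x : NNReal) : ℝ))
    (f := s.indicator f) (fun x => |f x|) ?_ hf.abs ?_ ?_
  · have hz : ∀ n : ℕ, ∫ x, f x * ((thickenedIndicator (δ := 1 / ((n : ℝ) + 1)) (by positivity) s x : NNReal) : ℝ) = 0 := by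
      intro n
      refine hreal ⟨fun x => ((thickenedIndicator (δ := 1 / ((n : ℝ) + 1)) (by positivity) s x : NNReal) : ℝ), ?_⟩
      fun_prop
    simp only [hz] at hlim
    rw [← integral_indicator hs.measurableSet]
    exact (tendsto_nhds_unique hlim tendsto_const_nhds)
  · intro n
    refine hf.aestronglyMeasurable.mul (Continuous.aestronglyMeasurable ?_)
    fun_prop
  · intro n
    refine ae_of_all _ fun x => ?_
    rw [norm_mul, Real.norm_eq_abs]
    refine mul_le_of_le_one_right (abs_nonneg _) ?_
    rw [Real.norm_eq_abs, abs_of_nonneg (NNReal.coe_nonneg _)]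
    exact_mod_cast thickenedIndicator_le_one (by positivity) s x
  · refine ae_of_all _ fun x => ?_
    have h1 := thickenedIndicator_tendsto_indicator_closure
      (δseq := fun n : ℕ => 1 / ((n : ℝ) + 1)) (fun n => by positivity)
      tendsto_one_div_add_atTop_nhds_zero_nat s
    rw [tendsto_pi_nhds] at h1
    have h2 := ((NNReal.continuous_coe.tendsto _).comp (h1 x)).const_mul (f x)
    rw [hs.closure_eq] at h2
    have h3 : s.indicator f x = f x * ((s.indicator (fun _ => (1 : NNReal)) x : NNReal) : ℝ) := by
      by_cases hx : x ∈ s <;> simp [hx]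
    rw [h3]
    exact h2

theorem ae_eq_of_coeff_eq {f g : Torus d → ℝ} (hf : Integrable f volume)
    (hg : Integrable g volume) (h : ∀ k, coeff f k = coeff g k) : f =ᵐ[volume] g := by
  have := ae_eq_zero_of_coeff_eq_zero (hf.sub hg) fun k => by
    have h2 := coeff_sub hf hg k
    rw [h k, sub_self] at h2
    exact h2
  filter_upwards [this] with x hx
  exact sub_eq_zero.mp hx

end Monomials

end ThinFilm

namespace ThinFilm

open scoped ComplexConjugate

/-! ### Parseval, Riesz–Fischer and Fourier multipliers. -/

section Parseval

variable {d : ℕ}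

/-- The normalised monomials as elements of `L²`. -/
noncomputable def mexpLp (k : Fin d → ℤ) : Lp ℂ 2 (volume : Measure (Torus d)) :=
  ContinuousMap.toLp (E := ℂ) 2 volume ℂ ((((Real.sqrt (vol d))⁻¹ : ℝ) : ℂ) • mexp k)

lemma coeFn_mexpLp (k : Fin d → ℤ) :
    mexpLp k =ᵐ[volume] fun x => (((Real.sqrt (vol d))⁻¹ : ℝ) : ℂ) * mexp k x :=
  ContinuousMap.coeFn_toLp volume _

lemma orthonormal_mexpLp : Orthonormal ℂ (mexpLp (d := d)) := by
  rw [orthonormal_iff_ite]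
  intro m n
  rw [mexpLp, mexpLp, ContinuousMap.inner_toLp]
  have h : ∀ x : Torus d, ((((Real.sqrt (vol d))⁻¹ : ℝ) : ℂ) • mexp n) x *
      conj (((((Real.sqrt (vol d))⁻¹ : ℝ) : ℂ) • mexp m) x) =
      (((vol d)⁻¹ : ℝ) : ℂ) * (conj (mexp m x) * mexp n x) := by
    intro x
    simp only [ContinuousMap.coe_smul, Pi.smul_apply, smul_eq_mul, map_mul, Complex.conj_ofReal]
    have : (vol d)⁻¹ = (Real.sqrt (vol d))⁻¹ * (Real.sqrt (vol d))⁻¹ := by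
      rw [← mul_inv, Real.mul_self_sqrt (vol_pos d).le]
    rw [this]
    push_cast
    ring
  simp only [h]
  rw [integral_const_mul, integral_conj_mexp_mul]
  have := (vol_pos d).ne'
  split_ifs
  · rw [← Complex.ofReal_mul, inv_mul_cancel₀ this, Complex.ofReal_one]
  · simp

open Submodule in
lemma span_mexpLp : ⊤ ≤ (span ℂ (Set.range (mexpLp (d := d)))).topologicalClosure := by
  have h := (ContinuousMap.toLp_denseRange (p := 2) ℂ (volume : Measure (Torus d)) ℂ
    (by norm_num)).topologicalClosure_map_submodule (span_mexp_closure_eq_top (d := d))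
  rw [← h]
  refine Submodule.topologicalClosure_mono ?_
  rw [Submodule.map_span, span_le]
  rintro _ ⟨_, ⟨k, rfl⟩, rfl⟩
  have : ((ContinuousMap.toLp (E := ℂ) 2 (volume : Measure (Torus d)) ℂ) (mexp k)) =
      ((Real.sqrt (vol d) : ℝ) : ℂ) • mexpLp k := by
    rw [mexpLp, map_smul, smul_smul, ← Complex.ofReal_mul,
      mul_inv_cancel₀ (Real.sqrt_pos.mpr (vol_pos d)).ne']
    simp
  simp only [ContinuousLinearMap.coe_coe, SetLike.mem_coe, this]
  exact smul_mem _ _ (subset_span ⟨k, rfl⟩)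

/-- The Hilbert basis of `L²` of the torus given by the normalised monomials. -/
noncomputable def mexpBasis : HilbertBasis (Fin d → ℤ) ℂ (Lp ℂ 2 (volume : Measure (Torus d))) :=
  HilbertBasis.mk orthonormal_mexpLp span_mexpLp

lemma mexpBasis_repr (F : Lp ℂ 2 (volume : Measure (Torus d))) (k : Fin d → ℤ) :
    mexpBasis.repr F k = (((Real.sqrt (vol d))⁻¹ : ℝ) : ℂ) * ∫ x, F x * conj (mexp k x) := by
  rw [mexpBasis.repr_apply_apply F k, mexpBasis, HilbertBasis.coe_mk, L2.inner_def,
    ← integral_const_mul]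
  refine integral_congr_ae ?_
  filter_upwards [coeFn_mexpLp k] with x hx
  rw [hx, RCLike.inner_apply, map_mul, Complex.conj_ofReal]
  ring

/-- Parseval's identity for complex functions. -/
theorem hasSum_sq_norm_integral {F : Torus d → ℂ} (hF : MemLp F 2 volume) :
    HasSum (fun k => ‖∫ x, F x * conj (mexp k x)‖ ^ 2) (vol d * ∫ x, ‖F x‖ ^ 2) := by
  have h := lp.hasSum_norm (p := 2) (by norm_num) (mexpBasis.repr (hF.toLp F))
  simp only [ENNReal.toReal_ofNat, LinearIsometryEquiv.norm_map] at h
  have h2 := h.mul_left (vol d)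
  have hint : ∀ k, ∫ x, (hF.toLp F) x * conj (mexp k x) = ∫ x, F x * conj (mexp k x) := by
    intro k
    refine integral_congr_ae ?_
    filter_upwards [hF.coeFn_toLp] with x hx
    rw [hx]
  have hleft : ∀ k, vol d * ‖mexpBasis.repr (hF.toLp F) k‖ ^ (2 : ℝ) =
      ‖∫ x, F x * conj (mexp k x)‖ ^ 2 := by
    intro k
    rw [mexpBasis_repr, hint, norm_mul, Complex.norm_real, norm_inv, Real.norm_eq_abs,
      abs_of_nonneg (Real.sqrt_nonneg _), Real.rpow_two, mul_pow, inv_pow,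
      Real.sq_sqrt (vol_pos d).le, mul_inv_cancel_left₀ (vol_pos d).ne']
  have hright : ‖hF.toLp F‖ ^ (2 : ℝ) = ∫ x, ‖F x‖ ^ 2 := by
    rw [Real.rpow_two, ← @inner_self_eq_norm_sq ℂ, L2.inner_def]
    have : ∀ x, inner ℂ ((hF.toLp F) x) ((hF.toLp F) x) = ((‖(hF.toLp F) x‖ ^ 2 : ℝ) : ℂ) := by
      intro x
      rw [inner_self_eq_norm_sq_to_K]
      norm_cast
    simp only [this]
    rw [show (∫ x, (((‖(hF.toLp F) x‖ ^ 2 : ℝ)) : ℂ)) = ((∫ x, ‖(hF.toLp F) x‖ ^ 2 : ℝ) : ℂ) from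
      integral_ofReal]
    rw [RCLike.re_eq_complex_re, Complex.ofReal_re]
    refine integral_congr_ae ?_
    filter_upwards [hF.coeFn_toLp] with x hx
    rw [hx]
  simp only [hright] at h2
  exact h2.congr_fun fun k => (hleft k).symm

/-- Parseval's identity. -/
theorem hasSum_sq_norm_coeff {f : Torus d → ℝ} (hf : MemLp f 2 volume) :
    HasSum (fun k => ‖coeff f k‖ ^ 2) (vol d * ∫ x, f x ^ 2) := by
  have h := hasSum_sq_norm_integral (F := fun x => (f x : ℂ)) hf.ofReal
  simpa only [← coeff_eq_integral_conj, Complex.norm_real, Real.norm_eq_abs, sq_abs] using h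

theorem exists_integral_eq {c : (Fin d → ℤ) → ℂ} (hc : Summable fun k => ‖c k‖ ^ 2) :
    ∃ F : Torus d → ℂ, MemLp F 2 volume ∧ ∀ k, ∫ x, F x * conj (mexp k x) = c k := by
  have hmem : Memℓp (fun k => (((Real.sqrt (vol d))⁻¹ : ℝ) : ℂ) * c k) 2 := by
    refine memℓp_gen ?_
    simp only [ENNReal.toReal_ofNat, norm_mul]
    norm_cast
    simp only [mul_pow]
    exact hc.mul_left _
  let a : lp (fun _ : Fin d → ℤ => ℂ) 2 := ⟨_, hmem⟩
  refine ⟨mexpBasis.repr.symm a, Lp.memLp _, fun k => ?_⟩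
  have h := mexpBasis_repr (mexpBasis.repr.symm a) k
  rw [LinearIsometryEquiv.apply_symm_apply] at h
  change (((Real.sqrt (vol d))⁻¹ : ℝ) : ℂ) * c k = _ at h
  refine (mul_left_cancel₀ ?_ h).symm
  simpa using (Real.sqrt_pos.mpr (vol_pos d)).ne'

/-- The Riesz-Fischer theorem for real functions. -/
theorem exists_coeff_eq {c : (Fin d → ℤ) → ℂ} (hc : Summable fun k => ‖c k‖ ^ 2)
    (hsymm : ∀ k, c (-k) = conj (c k)) :
    ∃ f : Torus d → ℝ, MemLp f 2 volume ∧ ∀ k, coeff f k = c k := by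
  obtain ⟨F, hF, hFc⟩ := exists_integral_eq hc
  refine ⟨fun x => (F x).re, hF.re, fun k => ?_⟩
  have hint : ∀ k, Integrable (fun x => F x * conj (mexp k x)) volume := by
    intro k
    refine (hF.integrable (by norm_num)).mul_bdd (c := 1) ?_ (ae_of_all _ fun x => ?_)
    · simp only [← mexp_neg]
      exact (mexp (-k)).continuous.aestronglyMeasurable
    · simp [norm_mexp_apply]
  have hconj : ∫ x, conj (F x) * conj (mexp k x) = c k := by
    have := congrArg conj (hFc (-k))
    rw [hsymm, Complex.conj_conj, ← integral_conj] at this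
    simpa [mexp_neg] using this
  have hint' : Integrable (fun x => conj (F x) * conj (mexp k x)) volume := by
    have := (Complex.conjCLE : ℂ →L[ℝ] ℂ).integrable_comp (hint (-k))
    simpa [mexp_neg] using this
  rw [coeff_eq_integral_conj]
  have : ∀ x, (((F x).re : ℝ) : ℂ) * conj (mexp k x) =
      (2 : ℂ)⁻¹ * (F x * conj (mexp k x) + conj (F x) * conj (mexp k x)) := by
    intro x
    rw [Complex.re_eq_add_conj]
    ring
  simp only [this]
  rw [integral_const_mul, integral_add (hint k) hint', hFc, hconj]
  ring

/-- The defining property of a Fourier multiplier. -/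
theorem fourierMul_spec {m : (Fin d → ℤ) → ℂ} {f g : Torus d → ℝ} (hg : Integrable g volume)
    (h : ∀ k, coeff g k = m k * coeff f k) : fourierMul m f =ᵐ[volume] g := by
  have hex : ∃ g : Torus d → ℝ, Integrable g volume ∧ ∀ k, coeff g k = m k * coeff f k := ⟨g, hg, h⟩
  rw [fourierMul, dif_pos hex]
  exact ae_eq_of_coeff_eq hex.choose_spec.1 hg fun k => by rw [hex.choose_spec.2, h]

/-- Shows that the default value in `fourierMul` is not taken: the symmetry of the symbol makes the
new coefficients those of a real function, Riesz–Fischer produces that function, and uniqueness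
identifies it with the chosen one. -/
theorem fourierMul_memLp {m : (Fin d → ℤ) → ℂ} {f : Torus d → ℝ}
    (hm : ∀ k, m (-k) = conj (m k)) (h : Summable fun k => ‖m k * coeff f k‖ ^ 2) :
    MemLp (fourierMul m f) 2 volume ∧ ∀ k, coeff (fourierMul m f) k = m k * coeff f k := by
  obtain ⟨g, hg, hgc⟩ := exists_coeff_eq h fun k => by rw [hm, coeff_neg, map_mul]
  have hae := fourierMul_spec (hg.integrable (by norm_num)) hgc
  exact ⟨(memLp_congr_ae hae).mpr hg, fun k => by rw [coeff_congr_ae hae, hgc]⟩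

/-! ### Absolutely convergent Fourier series -/

/-- The real part of the Fourier series with coefficients `c`. -/
noncomputable def trig (c : (Fin d → ℤ) → ℂ) : C(Torus d, ℝ) where
  toFun x := (vol d)⁻¹ * ((∑' k, c k • mexp k : C(Torus d, ℂ)) x).re
  continuous_toFun := by fun_prop

lemma summable_smul_mexp {c : (Fin d → ℤ) → ℂ} (hc : Summable fun k => ‖c k‖) :
    Summable fun k => c k • mexp k := by
  refine Summable.of_norm ?_
  simpa only [norm_smul, norm_mexp, mul_one] using hc

lemma trig_apply {c : (Fin d → ℤ) → ℂ} (hc : Summable fun k => ‖c k‖) (x : Torus d) :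
    trig c x = (vol d)⁻¹ * (∑' k, c k * mexp k x).re := by
  have := (ContinuousMap.evalCLM ℂ x).map_tsum (summable_smul_mexp hc)
  simp only [trig, ContinuousMap.coe_mk]
  congr 2

lemma abs_trig_le {c : (Fin d → ℤ) → ℂ} (hc : Summable fun k => ‖c k‖) (x : Torus d) :
    |trig c x| ≤ (vol d)⁻¹ * ∑' k, ‖c k‖ := by
  rw [trig_apply hc, abs_mul, abs_of_pos (inv_pos.mpr (vol_pos d))]
  refine mul_le_mul_of_nonneg_left ?_ (inv_pos.mpr (vol_pos d)).le
  refine (Complex.abs_re_le_norm _).trans ?_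
  refine (norm_tsum_le_tsum_norm ?_).trans (le_of_eq ?_) <;> simp only [norm_mul, norm_mexp_apply, mul_one]
  exact hc

lemma trig_sub {c c' : (Fin d → ℤ) → ℂ} (hc : Summable fun k => ‖c k‖)
    (hc' : Summable fun k => ‖c' k‖) : trig (fun k => c k - c' k) = trig c - trig c' := by
  ext x
  have := (summable_smul_mexp hc).tsum_sub (summable_smul_mexp hc')
  simp only [trig, sub_smul, this, ContinuousMap.coe_mk, ContinuousMap.sub_apply, Complex.sub_re]
  ring

/-- By the symmetry of `c` the series equals its own conjugate, so nothing is lost in taking the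
real part. Absolute summability then permits termwise integration. -/
lemma coeff_trig {c : (Fin d → ℤ) → ℂ} (hc : Summable fun k => ‖c k‖)
    (hsymm : ∀ k, c (-k) = conj (c k)) (k : Fin d → ℤ) : coeff (trig c) k = c k := by
  have hval : ∀ x, ((trig c x : ℝ) : ℂ) = (vol d : ℂ)⁻¹ * ∑' k, c k * mexp k x := by
    intro x
    have hconj : conj (∑' k, c k * mexp k x) = ∑' k, c k * mexp k x := by
      rw [Complex.conj_tsum]
      rw [← (Equiv.neg (Fin d → ℤ)).tsum_eq]
      refine tsum_congr fun k => ?_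
      simp [hsymm, mexp_neg]
    rw [trig_apply hc, Complex.ofReal_mul, Complex.conj_eq_iff_re.mp hconj]
    push_cast
    rfl
  rw [coeff_eq_integral_conj]
  simp only [hval, mul_assoc]
  rw [integral_const_mul]
  have : ∀ x : Torus d, (∑' l, c l * mexp l x) * conj (mexp k x) =
      ∑' l, c l * (conj (mexp k x) * mexp l x) := by
    intro x
    rw [← tsum_mul_right]
    exact tsum_congr fun l => by ring
  simp only [this]
  rw [← integral_tsum_of_summable_integral_norm]
  · simp only [integral_const_mul, integral_conj_mexp_mul, mul_ite, mul_zero]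
    rw [tsum_ite_eq']
    field_simp [Complex.ofReal_ne_zero.mpr (vol_pos d).ne']
  · intro l
    refine (ContinuousMap.integrable_torus (⟨fun x => c l * (conj (mexp k x) * mexp l x), by fun_prop⟩ : C(Torus d, ℂ)))
  · simp only [norm_mul, RCLike.norm_conj, norm_mexp_apply, mul_one, integral_const, volume_real_univ, smul_eq_mul]
    exact hc.mul_left _

end Parseval

end ThinFilm

namespace ThinFilm

section Lattice

variable {d : ℕ}

/-! ### Lattice sums -/

lemma freqNorm_nonneg (k : Fin d → ℤ) : 0 ≤ freqNorm k := Real.sqrt_nonneg _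

lemma freqNorm_sq (k : Fin d → ℤ) : freqNorm k ^ 2 = ∑ j, (k j : ℝ) ^ 2 :=
  Real.sq_sqrt (Finset.sum_nonneg fun _ _ => sq_nonneg _)

@[simp] lemma freqNorm_zero : freqNorm (0 : Fin d → ℤ) = 0 := by simp [freqNorm]

@[simp] lemma freqNorm_neg (k : Fin d → ℤ) : freqNorm (-k) = freqNorm k := by simp [freqNorm]

lemma abs_le_freqNorm (k : Fin d → ℤ) (j : Fin d) : |(k j : ℝ)| ≤ freqNorm k := by
  refine Real.abs_le_sqrt ?_
  exact Finset.single_le_sum (f := fun j => (k j : ℝ) ^ 2) (fun _ _ => sq_nonneg _)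
    (Finset.mem_univ j)

lemma one_le_freqNorm {k : Fin d → ℤ} (hk : k ≠ 0) : 1 ≤ freqNorm k := by
  obtain ⟨j, hj⟩ := Function.ne_iff.mp hk
  refine le_trans ?_ (abs_le_freqNorm k j)
  exact_mod_cast Int.one_le_abs hj

lemma sum_pow_four_le (k : Fin d → ℤ) : ∑ j, (k j : ℝ) ^ 4 ≤ freqNorm k ^ 4 := by
  have h : freqNorm k ^ 4 = (∑ j, (k j : ℝ) ^ 2) * ∑ j, (k j : ℝ) ^ 2 := by
    rw [← freqNorm_sq]; ring
  rw [h, Finset.sum_mul]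
  refine Finset.sum_le_sum fun j _ => ?_
  have := Finset.single_le_sum (f := fun j => (k j : ℝ) ^ 2) (fun _ _ => sq_nonneg _)
    (Finset.mem_univ j)
  calc (k j : ℝ) ^ 4 = (k j : ℝ) ^ 2 * (k j : ℝ) ^ 2 := by ring
    _ ≤ _ := mul_le_mul_of_nonneg_left this (sq_nonneg _)

/-- The bracket `max 1 |n|`. -/
noncomputable def brk (n : ℤ) : ℝ := max 1 |(n : ℝ)|

lemma one_le_brk (n : ℤ) : 1 ≤ brk n := le_max_left _ _

lemma brk_pos (n : ℤ) : 0 < brk n := one_pos.trans_le (one_le_brk n)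

lemma brk_le_freqNorm {k : Fin d → ℤ} (hk : k ≠ 0) (j : Fin d) : brk (k j) ≤ freqNorm k :=
  max_le (one_le_freqNorm hk) (abs_le_freqNorm k j)

/-- Splits a negative power of `|k|` evenly among the coordinates, since each bracket is at most
`|k|`. It reduces `d`-dimensional lattice sums to one-dimensional ones. -/
lemma freqNorm_rpow_le_prod {k : Fin d → ℤ} (hk : k ≠ 0) {p q : ℝ} (hq : q ≤ 0)
    (hpq : p ≤ d * q) : freqNorm k ^ p ≤ ∏ j, brk (k j) ^ q := by
  calc freqNorm k ^ p ≤ freqNorm k ^ (d * q) :=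
        Real.rpow_le_rpow_of_exponent_le (one_le_freqNorm hk) hpq
    _ = ∏ _j : Fin d, freqNorm k ^ q := by
        rw [Finset.prod_const, Finset.card_univ, Fintype.card_fin, ← Real.rpow_natCast,
          ← Real.rpow_mul (freqNorm_nonneg k), mul_comm]
    _ ≤ _ := Finset.prod_le_prod (fun _ _ => Real.rpow_nonneg (freqNorm_nonneg k) _) fun j _ =>
        Real.rpow_le_rpow_of_nonpos (brk_pos _) (brk_le_freqNorm hk j) hq

lemma tsum_prod_le (f : ℤ → ℝ≥0∞) : ∑' k : Fin d → ℤ, ∏ j, f (k j) ≤ (∑' n, f n) ^ d := by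
  rw [ENNReal.tsum_eq_iSup_sum]
  refine iSup_le fun s => ?_
  classical
  let t : Fin d → Finset ℤ := fun j => s.image fun k => k j
  calc ∑ k ∈ s, ∏ j, f (k j) ≤ ∑ k ∈ Fintype.piFinset t, ∏ j, f (k j) := by
        refine Finset.sum_le_sum_of_subset fun k hk => ?_
        rw [Fintype.mem_piFinset]
        exact fun j => Finset.mem_image_of_mem _ hk
    _ = ∏ j, ∑ n ∈ t j, f n := (Finset.prod_univ_sum t fun _ n => f n).symm
    _ ≤ ∏ _j : Fin d, ∑' n, f n := Finset.prod_le_prod' fun j _ => ENNReal.sum_le_tsum _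
    _ = _ := by simp

/-- Convexity of `Γ` and `Γ(1) = Γ(2) = 1` give `s Γ(s) = Γ(s + 1) ≤ 1`. -/
lemma Gamma_le_inv {s : ℝ} (h0 : 0 < s) (h1 : s ≤ 1) : Real.Gamma s ≤ s⁻¹ := by
  have h := Real.convexOn_Gamma.2 (Set.mem_Ioi.mpr one_pos) (Set.mem_Ioi.mpr two_pos)
    (sub_nonneg.mpr h1) h0.le (by ring)
  rw [Real.Gamma_one, Real.Gamma_two] at h
  have h2 : (1 - s) • (1 : ℝ) + s • (2 : ℝ) = s + 1 := by simp only [smul_eq_mul]; ring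
  rw [h2, Real.Gamma_add_one h0.ne'] at h
  simp only [smul_eq_mul, mul_one, sub_add_cancel] at h
  rw [inv_eq_one_div, le_div_iff₀ h0]
  linarith

/-- The summand is decreasing, so the sum is at most the integral, which is a Gamma value. The
explicit factor `1 / (q + 1)` matters because `q` is later taken close to `-1` depending on `b`. -/
lemma tsum_nat_rpow_mul_exp_le {q b : ℝ} (hq : -1 < q) (hq0 : q ≤ 0) (hb : 0 < b) :
    ∑' n : ℕ, ENNReal.ofReal (((n : ℝ) + 1) ^ q * Real.exp (-(b * ((n : ℝ) + 1) ^ 4))) ≤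
      ENNReal.ofReal (b ^ (-(q + 1) / 4) / (q + 1)) := by
  set f : ℝ → ℝ := fun x => x ^ q * Real.exp (-b * x ^ (4 : ℝ)) with hf
  have hint := integrableOn_rpow_mul_exp_neg_mul_rpow (s := q) (p := 4) hq (by norm_num) hb
  have hval := integral_rpow_mul_exp_neg_mul_rpow (p := 4) (q := q) (by norm_num) hq hb
  have hf0 : ∀ x ∈ Set.Ioi (0 : ℝ), 0 ≤ f x := fun x hx =>
    mul_nonneg (Real.rpow_nonneg (le_of_lt hx) _) (Real.exp_nonneg _)
  have hterm : ∀ n : ℕ, ENNReal.ofReal (((n : ℝ) + 1) ^ q * Real.exp (-(b * ((n : ℝ) + 1) ^ 4))) ≤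
      ∫⁻ x in Set.Ioc (n : ℝ) ((n : ℝ) + 1), ENNReal.ofReal (f x) := by
    intro n
    have hn : (0 : ℝ) ≤ n := Nat.cast_nonneg n
    calc _ = ∫⁻ x in Set.Ioc (n : ℝ) ((n : ℝ) + 1),
          ENNReal.ofReal (((n : ℝ) + 1) ^ q * Real.exp (-(b * ((n : ℝ) + 1) ^ 4))) := by simp
      _ ≤ _ := by
        refine setLIntegral_mono' measurableSet_Ioc fun x hx => ENNReal.ofReal_le_ofReal ?_
        have hx0 : 0 < x := hn.trans_lt hx.1
        simp only [hf]
        have e4 : x ^ (4 : ℝ) = x ^ (4 : ℕ) := by exact_mod_cast Real.rpow_natCast x 4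
        refine mul_le_mul (Real.rpow_le_rpow_of_nonpos hx0 hx.2 hq0) ?_ (Real.exp_nonneg _)
          (Real.rpow_nonneg hx0.le _)
        rw [Real.exp_le_exp, e4, neg_mul, neg_le_neg_iff]
        have := hx.2
        gcongr
  calc _ ≤ ∑' n : ℕ, ∫⁻ x in Set.Ioc (n : ℝ) ((n : ℝ) + 1), ENNReal.ofReal (f x) :=
        ENNReal.tsum_le_tsum hterm
    _ = ∫⁻ x in ⋃ n : ℕ, Set.Ioc (n : ℝ) ((n : ℝ) + 1), ENNReal.ofReal (f x) := by
        rw [lintegral_iUnion (fun _ => measurableSet_Ioc)]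
        intro m n hmn
        refine Set.disjoint_left.mpr fun x hx hx' => hmn ?_
        have h1 : (m : ℝ) < n + 1 := hx.1.trans_le hx'.2
        have h2 : (n : ℝ) < m + 1 := hx'.1.trans_le hx.2
        norm_cast at h1 h2
        omega
    _ ≤ ∫⁻ x in Set.Ioi (0 : ℝ), ENNReal.ofReal (f x) := by
        refine lintegral_mono_set ?_
        refine Set.iUnion_subset fun n x hx => ?_
        exact (Nat.cast_nonneg n).trans_lt hx.1
    _ = ENNReal.ofReal (∫ x in Set.Ioi (0 : ℝ), f x) := by
        rw [ofReal_integral_eq_lintegral_ofReal hint]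
        exact (ae_restrict_iff' measurableSet_Ioi).mpr (ae_of_all _ hf0)
    _ ≤ _ := by
        refine ENNReal.ofReal_le_ofReal ?_
        rw [hval]
        have hG := Gamma_le_inv (s := (q + 1) / 4) (by linarith) (by linarith)
        calc b ^ (-(q + 1) / 4) * (1 / 4) * Real.Gamma ((q + 1) / 4)
            ≤ b ^ (-(q + 1) / 4) * (1 / 4) * ((q + 1) / 4)⁻¹ := by gcongr
          _ = _ := by
            have : q + 1 ≠ 0 := by linarith
            field_simp

lemma brk_natCast_add_one (n : ℕ) : brk ((n : ℤ) + 1) = n + 1 := by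
  have : (0 : ℝ) ≤ n := Nat.cast_nonneg n
  simp only [brk]
  push_cast
  rw [abs_of_nonneg (by linarith), max_eq_right (by linarith)]

lemma brk_neg (n : ℤ) : brk (-n) = brk n := by simp [brk]

lemma tsum_int_eq_of_even {f : ℤ → ℝ≥0∞} (hf : ∀ n, f (-n) = f n) :
    ∑' n, f n = f 0 + 2 * ∑' n : ℕ, f (n + 1) := by
  rw [tsum_of_nat_of_neg_add_one ENNReal.summable ENNReal.summable,
    tsum_eq_zero_add' ENNReal.summable]
  simp only [hf, Nat.cast_zero, Nat.cast_add, Nat.cast_one]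
  ring

lemma tsum_brk_rpow_mul_exp_le {q b : ℝ} (hq : -1 < q) (hq0 : q ≤ 0) (hb : 0 < b) :
    ∑' n : ℤ, ENNReal.ofReal (brk n ^ q * Real.exp (-(b * (n : ℝ) ^ 4))) ≤
      ENNReal.ofReal (1 + 2 * (b ^ (-(q + 1) / 4) / (q + 1))) := by
  rw [tsum_int_eq_of_even (fun n => by rw [brk_neg]; push_cast; rw [Even.neg_pow (by decide)])]
  have h := tsum_nat_rpow_mul_exp_le hq hq0 hb
  simp only [brk_natCast_add_one]
  push_cast
  have hpos : 0 ≤ b ^ (-(q + 1) / 4) / (q + 1) :=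
    div_nonneg (Real.rpow_nonneg hb.le _) (by linarith)
  rw [ENNReal.ofReal_add zero_le_one (by linarith), ENNReal.ofReal_mul zero_le_two]
  refine add_le_add ?_ ?_
  · simp [brk]
  · rw [ENNReal.ofReal_ofNat]
    gcongr

/-- A weighted lattice sum is bounded by a power of a one-dimensional sum. -/
lemma tsum_lattice_le {q b : ℝ} (hq : -1 < q) (hq0 : q ≤ 0) (hdq : -2 ≤ d * q) (hb : 0 < b) :
    ∑' k : Fin d → ℤ, ENNReal.ofReal ((freqNorm k ^ 2)⁻¹ * Real.exp (-(b * freqNorm k ^ 4))) ≤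
      ENNReal.ofReal (1 + 2 * (b ^ (-(q + 1) / 4) / (q + 1))) ^ d := by
  refine le_trans ?_ ((tsum_prod_le _).trans
    (pow_le_pow_left' (tsum_brk_rpow_mul_exp_le hq hq0 hb) d))
  refine ENNReal.tsum_le_tsum fun k => ?_
  rw [← ENNReal.ofReal_prod_of_nonneg fun j _ =>
    mul_nonneg (Real.rpow_nonneg (brk_pos _).le _) (Real.exp_nonneg _)]
  refine ENNReal.ofReal_le_ofReal ?_
  rw [Finset.prod_mul_distrib, ← Real.exp_sum]
  -- At `k = 0` the inverse takes its default value `0`, so the zero frequency contributes nothing.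
  by_cases hk : k = 0
  · subst hk
    simp only [freqNorm_zero]
    refine le_trans (by simp) (mul_nonneg (Finset.prod_nonneg fun _ _ =>
      Real.rpow_nonneg (brk_pos _).le _) (Real.exp_nonneg _))
  · refine mul_le_mul ?_ ?_ (Real.exp_nonneg _)
      (Finset.prod_nonneg fun _ _ => Real.rpow_nonneg (brk_pos _).le _)
    · have := freqNorm_rpow_le_prod hk hq0 hdq
      rwa [Real.rpow_neg (freqNorm_nonneg k), Real.rpow_two] at this
    · rw [Real.exp_le_exp, Finset.sum_neg_distrib, neg_le_neg_iff, ← Finset.mul_sum]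
      exact mul_le_mul_of_nonneg_left (sum_pow_four_le k) hb.le

/-- The exponent `q = -2/3` serves every `d ≤ 3`. Each coordinate contributes at most `7 b^{-1/12}`,
and the cube of this is the bound. -/
lemma tsum_inv_sq_mul_exp_le (hd : d ≤ 3) {b : ℝ} (hb : 0 < b) (hb1 : b ≤ 1) :
    ∑' k : Fin d → ℤ, ENNReal.ofReal ((freqNorm k ^ 2)⁻¹ * Real.exp (-(b * freqNorm k ^ 4))) ≤
      ENNReal.ofReal (343 * b ^ (-(1 / 4) : ℝ)) := by
  have hd' : (d : ℝ) ≤ 3 := by exact_mod_cast hd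
  refine (tsum_lattice_le (q := -(2 / 3)) (by norm_num) (by norm_num) (by linarith) hb).trans ?_
  have h1 : 1 ≤ b ^ (-(1 / 12) : ℝ) :=
    Real.one_le_rpow_of_pos_of_le_one_of_nonpos hb hb1 (by norm_num)
  have h2 : 1 + 2 * (b ^ (-(-(2 / 3) + 1) / 4 : ℝ) / (-(2 / 3) + 1)) ≤ 7 * b ^ (-(1 / 12) : ℝ) := by
    have : (-(-(2 / 3) + 1) / 4 : ℝ) = -(1 / 12) := by norm_num
    rw [this, show (-(2 / 3) + 1 : ℝ) = 3⁻¹ by norm_num, div_inv_eq_mul]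
    linarith
  calc _ ≤ ENNReal.ofReal (7 * b ^ (-(1 / 12) : ℝ)) ^ d :=
        pow_le_pow_left' (ENNReal.ofReal_le_ofReal h2) d
    _ ≤ ENNReal.ofReal (7 * b ^ (-(1 / 12) : ℝ)) ^ 3 := by
        refine pow_le_pow_right₀ ?_ hd
        rw [ENNReal.one_le_ofReal]
        linarith
    _ = _ := by
        rw [← ENNReal.ofReal_pow (by positivity), mul_pow, ← Real.rpow_natCast,
          ← Real.rpow_natCast, ← Real.rpow_mul hb.le]
        norm_num

/-- In the plane `q = -1` is critical. Taking `q = -1 + θ` with `1/θ = 1 + log(1/b)` keeps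
`b^{-θ/4}` below `e^{1/4} < 3/2`, while `1/θ` is logarithmic. The square of the logarithm is not
sharp, but only its square root enters later. -/
lemma tsum_inv_sq_mul_exp_le_log {b : ℝ} (hb : 0 < b) (hb1 : b ≤ 1) :
    ∑' k : Fin 2 → ℤ, ENNReal.ofReal ((freqNorm k ^ 2)⁻¹ * Real.exp (-(b * freqNorm k ^ 4))) ≤
      ENNReal.ofReal ((4 * (1 + Real.log b⁻¹)) ^ 2) := by
  have hL : 0 ≤ Real.log b⁻¹ := Real.log_nonneg ((one_le_inv₀ hb).mpr hb1)
  set L := Real.log b⁻¹ with hLdef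
  have hθ : 0 < (1 + L)⁻¹ := by positivity
  have hθ1 : (1 + L)⁻¹ ≤ 1 := inv_le_one_of_one_le₀ (by linarith)
  refine (tsum_lattice_le (q := -1 + (1 + L)⁻¹) (by linarith) (by linarith)
    (by push_cast; linarith) hb).trans ?_
  rw [← ENNReal.ofReal_pow (by
    have : 0 ≤ b ^ (-(-1 + (1 + L)⁻¹ + 1) / 4) := Real.rpow_nonneg hb.le _
    have : 0 ≤ b ^ (-(-1 + (1 + L)⁻¹ + 1) / 4) / (-1 + (1 + L)⁻¹ + 1) :=
      div_nonneg this (by linarith)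
    linarith)]
  refine ENNReal.ofReal_le_ofReal (pow_le_pow_left₀ ?_ ?_ 2)
  · have : 0 ≤ b ^ (-(-1 + (1 + L)⁻¹ + 1) / 4) := Real.rpow_nonneg hb.le _
    have : 0 ≤ b ^ (-(-1 + (1 + L)⁻¹ + 1) / 4) / (-1 + (1 + L)⁻¹ + 1) :=
      div_nonneg this (by linarith)
    linarith
  · have e1 : (-1 + (1 + L)⁻¹ + 1) = (1 + L)⁻¹ := by ring
    have e2 : b ^ (-(1 + L)⁻¹ / 4) ≤ 3 / 2 := by
      rw [Real.rpow_def_of_pos hb]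
      have e3 : Real.log b * (-(1 + L)⁻¹ / 4) = (L * (1 + L)⁻¹) / 4 := by
        rw [hLdef, Real.log_inv]; ring
      have e4 : L * (1 + L)⁻¹ ≤ 1 := by
        rw [← div_eq_mul_inv, div_le_one (by linarith)]; linarith
      rw [e3]
      have h4 : Real.exp (L * (1 + L)⁻¹ / 4) ≤ Real.exp (1 / 4) :=
        Real.exp_le_exp.mpr (by linarith)
      refine h4.trans ?_
      have h5 : Real.exp (1 / 4) ^ 4 ≤ (3 / 2) ^ 4 := by
        rw [← Real.exp_nat_mul]
        have := Real.exp_one_lt_d9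
        norm_num at this ⊢
        linarith
      exact le_of_pow_le_pow_left₀ (by norm_num) (by norm_num) h5
    rw [e1, div_inv_eq_mul]
    nlinarith

/-- Both `1` and `y²` are at most `e^y`; the second follows from the tangent line of the
exponential, which gives `y ≤ e^{y/2}` because `e ≥ 2`. -/
lemma rpow_mul_exp_neg_le_one {y r : ℝ} (hy : 0 ≤ y) (hr : 0 ≤ r) (hr2 : r ≤ 2) :
    y ^ r * Real.exp (-y) ≤ 1 := by
  have hexp : max 1 (y ^ 2) ≤ Real.exp y := by
    refine max_le (Real.one_le_exp hy) ?_
    have h1 : y ≤ Real.exp (y / 2) := by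
      have h2 := Real.add_one_le_exp (y / 2 - 1)
      have h3 : Real.exp (y / 2) = Real.exp 1 * Real.exp (y / 2 - 1) := by
        rw [← Real.exp_add]; congr 1; ring
      have h4 := Real.exp_one_gt_d9
      rw [h3]
      nlinarith
    calc y ^ 2 ≤ Real.exp (y / 2) ^ 2 := pow_le_pow_left₀ hy h1 2
      _ = Real.exp y := by rw [← Real.exp_nat_mul]; congr 1; push_cast; ring
  have hpow : y ^ r ≤ max 1 (y ^ 2) := by
    rcases le_total y 1 with h | h
    · exact (Real.rpow_le_one hy h hr).trans (le_max_left _ _)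
    · refine (Real.rpow_le_rpow_of_exponent_le h hr2).trans ?_
      rw [Real.rpow_two]
      exact le_max_right _ _
  rw [Real.exp_neg, ← div_eq_mul_inv, div_le_one (Real.exp_pos _)]
  exact hpow.trans hexp

lemma pow_mul_exp_neg_le {x b : ℝ} (hx : 0 ≤ x) (hb : 0 < b) {n : ℕ} (hn : n ≤ 8) :
    x ^ n * Real.exp (-(b * x ^ 4)) ≤ b ^ (-(n / 4) : ℝ) := by
  have hn' : (n : ℝ) ≤ 8 := by exact_mod_cast hn
  have h := rpow_mul_exp_neg_le_one (y := b * x ^ 4) (r := n / 4) (by positivity) (by positivity)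
    (by linarith)
  have e : (b * x ^ 4) ^ (n / 4 : ℝ) = b ^ (n / 4 : ℝ) * x ^ n := by
    rw [Real.mul_rpow hb.le (by positivity), ← Real.rpow_natCast x 4, ← Real.rpow_mul hx,
      ← Real.rpow_natCast x n]
    congr 2
    push_cast
    ring
  rw [e] at h
  rw [Real.rpow_neg hb.le, inv_eq_one_div, le_div_iff₀ (Real.rpow_pos_of_pos hb _)]
  linarith

/-- One half of the exponential absorbs `|k|⁶` at the price `b^{-3/2}`; the other half leaves the
previous lattice sum, of size `b^{-1/4}`. -/
lemma tsum_pow_four_mul_exp_le (hd : d ≤ 3) {b : ℝ} (hb : 0 < b) (hb1 : b ≤ 1) :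
    ∑' k : Fin d → ℤ, ENNReal.ofReal (freqNorm k ^ 4 * Real.exp (-(2 * b * freqNorm k ^ 4))) ≤
      ENNReal.ofReal (343 * b ^ (-(7 / 4) : ℝ)) := by
  have hs := tsum_inv_sq_mul_exp_le hd hb hb1
  have e : (343 : ℝ) * b ^ (-(7 / 4) : ℝ) = b ^ (-((6 : ℕ) / 4) : ℝ) * (343 * b ^ (-(1 / 4) : ℝ)) := by
    rw [mul_left_comm, ← Real.rpow_add hb]
    norm_num
  rw [e, ENNReal.ofReal_mul (Real.rpow_nonneg hb.le _)]
  refine le_trans ?_ (mul_le_mul_right hs _)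
  rw [← ENNReal.tsum_mul_left]
  refine ENNReal.tsum_le_tsum fun k => ?_
  rw [← ENNReal.ofReal_mul (Real.rpow_nonneg hb.le _)]
  refine ENNReal.ofReal_le_ofReal ?_
  by_cases hk : k = 0
  · simp [hk]
  have hk1 := one_le_freqNorm hk
  have h := pow_mul_exp_neg_le (freqNorm_nonneg k) hb (n := 6) (by norm_num)
  have e2 : Real.exp (-(2 * b * freqNorm k ^ 4)) =
      Real.exp (-(b * freqNorm k ^ 4)) * Real.exp (-(b * freqNorm k ^ 4)) := by
    rw [← Real.exp_add]; congr 1; ring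
  calc freqNorm k ^ 4 * Real.exp (-(2 * b * freqNorm k ^ 4))
      = (freqNorm k ^ 6 * Real.exp (-(b * freqNorm k ^ 4))) *
        ((freqNorm k ^ 2)⁻¹ * Real.exp (-(b * freqNorm k ^ 4))) := by
        rw [e2]
        field_simp
    _ ≤ _ := by gcongr

/-- This is where `d ≤ 3` enters: the power `-4` splits into at least `4/3 > 1` per coordinate. -/
lemma tsum_inv_pow_four_lt_top (hd : d ≤ 3) :
    ∑' k : Fin d → ℤ, ENNReal.ofReal ((freqNorm k ^ 4)⁻¹) < ⊤ := by
  have h1 : ∑' n : ℤ, ENNReal.ofReal (brk n ^ (-(4 / 3) : ℝ)) < ⊤ := by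
    rw [tsum_int_eq_of_even (fun n => by rw [brk_neg])]
    simp only [brk_natCast_add_one]
    refine ENNReal.add_lt_top.mpr ⟨ENNReal.ofReal_lt_top, ENNReal.mul_lt_top (by simp) ?_⟩
    have hs : Summable fun n : ℕ => ((n : ℝ) + 1) ^ (-(4 / 3) : ℝ) := by
      have := (summable_nat_add_iff 1).mpr (Real.summable_nat_rpow.mpr (show (-(4 / 3) : ℝ) < -1 by norm_num))
      simpa using this
    exact hs.tsum_ofReal_lt_top
  refine lt_of_le_of_lt ?_ (ENNReal.pow_lt_top h1 (n := d))
  refine le_trans ?_ (tsum_prod_le _)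
  refine ENNReal.tsum_le_tsum fun k => ?_
  rw [← ENNReal.ofReal_prod_of_nonneg fun j _ => Real.rpow_nonneg (brk_pos _).le _]
  refine ENNReal.ofReal_le_ofReal ?_
  by_cases hk : k = 0
  · subst hk
    simp only [freqNorm_zero]
    refine le_trans (by simp) (Finset.prod_nonneg fun _ _ => Real.rpow_nonneg (brk_pos _).le _)
  · have hd' : (d : ℝ) ≤ 3 := by exact_mod_cast hd
    have := freqNorm_rpow_le_prod hk (p := -4) (q := -(4 / 3)) (by norm_num) (by linarith)
    have e : freqNorm k ^ (-4 : ℝ) = (freqNorm k ^ 4)⁻¹ := by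
      rw [Real.rpow_neg (freqNorm_nonneg k)]
      norm_cast
    rwa [e] at this

lemma summable_inv_pow_four (hd : d ≤ 3) :
    Summable fun k : Fin d → ℤ => (freqNorm k ^ 4)⁻¹ := by
  have h := ENNReal.summable_toReal (tsum_inv_pow_four_lt_top hd).ne
  refine h.congr fun k => ?_
  rw [ENNReal.toReal_ofReal]
  have := freqNorm_nonneg k
  positivity

end Lattice

end ThinFilm

namespace ThinFilm

open scoped ComplexConjugate

section Embedding

variable {d : ℕ}

/-! ### The embedding of `H¹` in `L⁴` -/

/-- The frequencies with all components at most `N` in absolute value. -/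
noncomputable def cube (d N : ℕ) : Finset (Fin d → ℤ) :=
  Fintype.piFinset fun _ => Finset.Icc (-(N : ℤ)) N

lemma mem_cube {N : ℕ} {k : Fin d → ℤ} : k ∈ cube d N ↔ ∀ j, |k j| ≤ N := by
  simp [cube, Fintype.mem_piFinset, abs_le]

lemma neg_mem_cube {N : ℕ} {k : Fin d → ℤ} : -k ∈ cube d N ↔ k ∈ cube d N := by
  simp [mem_cube]

lemma tendsto_cube : Tendsto (cube d) atTop atTop := by
  refine tendsto_atTop_finset_of_monotone ?_ fun k => ?_
  · intro M N h k hk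
    rw [mem_cube] at hk ⊢
    exact fun j => (hk j).trans (by exact_mod_cast h)
  · refine ⟨∑ j, (k j).natAbs, mem_cube.mpr fun j => ?_⟩
    have := Finset.single_le_sum (f := fun j => (k j).natAbs) (fun _ _ => Nat.zero_le _)
      (Finset.mem_univ j)
    have h2 : |k j| = ((k j).natAbs : ℤ) := Int.abs_eq_natAbs _
    rw [h2]
    exact_mod_cast this

lemma freqNorm_sq_le_of_mem_cube {N : ℕ} {k : Fin d → ℤ} (hk : k ∈ cube d N) :
    freqNorm k ^ 2 ≤ d * (N : ℝ) ^ 2 := by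
  rw [freqNorm_sq]
  calc ∑ j, (k j : ℝ) ^ 2 ≤ ∑ _j : Fin d, (N : ℝ) ^ 2 := by
        refine Finset.sum_le_sum fun j _ => sq_le_sq' ?_ ?_
        · have := (abs_le.mp (mem_cube.mp hk j)).1
          exact_mod_cast this
        · have := (abs_le.mp (mem_cube.mp hk j)).2
          exact_mod_cast this
    _ = _ := by simp

lemma lt_freqNorm_of_notMem_cube {N : ℕ} {k : Fin d → ℤ} (hk : k ∉ cube d N) :
    (N : ℝ) < freqNorm k := by
  rw [mem_cube] at hk
  push Not at hk
  obtain ⟨j, hj⟩ := hk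
  refine lt_of_lt_of_le ?_ (abs_le_freqNorm k j)
  exact_mod_cast hj

/-- The complex trigonometric polynomial with frequencies in `S`. -/
noncomputable def cpoly (S : Finset (Fin d → ℤ)) (c : (Fin d → ℤ) → ℂ) : C(Torus d, ℂ) :=
  ∑ k ∈ S, c k • mexp k

lemma cpoly_apply (S : Finset (Fin d → ℤ)) (c : (Fin d → ℤ) → ℂ) (x : Torus d) :
    cpoly S c x = ∑ k ∈ S, c k * mexp k x := by
  simp [cpoly, ContinuousMap.sum_apply]

lemma integral_cpoly_sq_mul (S : Finset (Fin d → ℤ)) (c : (Fin d → ℤ) → ℂ) (m : Fin d → ℤ) :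
    ∫ x, cpoly S c x ^ 2 * conj (mexp m x) =
      vol d * ∑ k ∈ S, if m - k ∈ S then c k * c (m - k) else 0 := by
  have h : ∀ x : Torus d, cpoly S c x ^ 2 * conj (mexp m x) =
      ∑ k ∈ S, ∑ l ∈ S, (c k * c l) * (conj (mexp m x) * mexp (k + l) x) := by
    intro x
    rw [cpoly_apply, sq, Finset.sum_mul_sum, Finset.sum_mul]
    refine Finset.sum_congr rfl fun k _ => ?_
    rw [Finset.sum_mul]
    refine Finset.sum_congr rfl fun l _ => ?_
    rw [mexp_add]
    ring
  have hint : ∀ k l : Fin d → ℤ, Integrable (fun x : Torus d =>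
      (c k * c l) * (conj (mexp m x) * mexp (k + l) x)) volume := fun k l =>
    ContinuousMap.integrable_torus (⟨fun x => (c k * c l) * (conj (mexp m x) * mexp (k + l) x),
      by fun_prop⟩ : C(Torus d, ℂ))
  simp only [h]
  rw [integral_finsetSum _ fun k _ => integrable_finsetSum _ fun l _ => hint k l, Finset.mul_sum]
  refine Finset.sum_congr rfl fun k _ => ?_
  rw [integral_finsetSum _ fun l _ => hint k l]
  simp only [integral_const_mul, integral_conj_mexp_mul]
  have : ∀ l, (m = k + l) ↔ (l = m - k) := fun l =>
    ⟨fun h => by rw [h]; abel, fun h => by rw [h]; abel⟩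
  simp only [this, mul_ite, mul_zero, Finset.sum_ite_eq']
  split_ifs <;> ring

/-- The fourth power is the squared L² norm of the square of the polynomial, whose coefficients are
a self-convolution. Cauchy–Schwarz with the weights `|k|^{-1} |m-k|^{-1}` bounds each of them by `K`
times the convolution of `w` with itself, where `w = |k|² |c_k|²`, and a convolution sums over `m`
to a product. -/
lemma integral_norm_cpoly_pow_four_le (hd : d ≤ 3) (S : Finset (Fin d → ℤ))
    {c : (Fin d → ℤ) → ℂ} (h0 : c 0 = 0) :
    ∫ x, ‖cpoly S c x‖ ^ 4 ≤ vol d * (∑' k : Fin d → ℤ, (freqNorm k ^ 4)⁻¹) *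
      (∑ k ∈ S, freqNorm k ^ 2 * ‖c k‖ ^ 2) ^ 2 := by
  set K := ∑' k : Fin d → ℤ, (freqNorm k ^ 4)⁻¹ with hK
  have hKs := summable_inv_pow_four hd
  have hpos : ∀ k : Fin d → ℤ, 0 ≤ (freqNorm k ^ 4)⁻¹ := fun k => by
    have := freqNorm_nonneg k; positivity
  have hcont : MemLp (fun x => cpoly S c x ^ 2) 2 (volume : Measure (Torus d)) := by
    refine MemLp.of_bound (C := ‖cpoly S c ^ 2‖) ?_ (ae_of_all _ fun x => ?_)
    · exact (cpoly S c ^ 2).continuous.aestronglyMeasurable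
    · exact (cpoly S c ^ 2).norm_coe_le_norm x
  have hpars := hasSum_sq_norm_integral hcont
  simp only [norm_pow, ← pow_mul] at hpars
  norm_num at hpars
  set w : (Fin d → ℤ) → ℝ := fun k => if k ∈ S then freqNorm k ^ 2 * ‖c k‖ ^ 2 else 0 with hw
  have hw0 : ∀ k, 0 ≤ w k := fun k => by simp only [hw]; split_ifs <;> positivity
  have hwS : ∑ k ∈ S, w k = ∑ k ∈ S, freqNorm k ^ 2 * ‖c k‖ ^ 2 :=
    Finset.sum_congr rfl fun k hk => if_pos hk
  have hwsum : HasSum w (∑ k ∈ S, w k) := hasSum_sum_of_ne_finset_zero fun k hk => if_neg hk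
  have hterm : ∀ m, ‖∫ x, cpoly S c x ^ 2 * conj (mexp m x)‖ ^ 2 ≤
      vol d ^ 2 * K * ∑ k ∈ S, w k * w (m - k) := by
    intro m
    rw [integral_cpoly_sq_mul, norm_mul, mul_pow, Complex.norm_real, Real.norm_eq_abs, sq_abs,
      mul_assoc]
    refine mul_le_mul_of_nonneg_left ?_ (sq_nonneg _)
    have h1 : ‖∑ k ∈ S, if m - k ∈ S then c k * c (m - k) else 0‖ ≤
        ∑ k ∈ S, ((freqNorm k)⁻¹ * (freqNorm (m - k))⁻¹) *
          (Real.sqrt (w k) * Real.sqrt (w (m - k))) := by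
      refine (norm_sum_le _ _).trans (Finset.sum_le_sum fun k hk => ?_)
      split_ifs with hmk
      · simp only [hw, if_pos hk, if_pos hmk]
        have hs : ∀ l : Fin d → ℤ, Real.sqrt (freqNorm l ^ 2 * ‖c l‖ ^ 2) = freqNorm l * ‖c l‖ := by
          intro l
          rw [← mul_pow, Real.sqrt_sq (mul_nonneg (freqNorm_nonneg l) (norm_nonneg _))]
        have hc : ∀ l : Fin d → ℤ, ‖c l‖ = (freqNorm l)⁻¹ * (freqNorm l * ‖c l‖) := by
          intro l
          by_cases hl : l = 0
          · simp [hl, h0]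
          · have := one_le_freqNorm hl
            rw [inv_mul_cancel_left₀ (by linarith)]
        rw [hs, hs, norm_mul]
        conv_lhs => rw [hc k, hc (m - k)]
        exact le_of_eq (by ring)
      · rw [norm_zero]
        have := freqNorm_nonneg k
        have := freqNorm_nonneg (m - k)
        positivity
    have hle : ∀ l : Fin d → ℤ, ∑ k ∈ S, (freqNorm (l - k) ^ 4)⁻¹ ≤ K := by
      intro l
      have := ((Equiv.subLeft l).summable_iff.mpr hKs).sum_le_tsum S (fun k _ => hpos _)
      exact this.trans (le_of_eq ((Equiv.subLeft l).tsum_eq fun k => (freqNorm k ^ 4)⁻¹))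
    -- The inequality `2xy ≤ x² + y²` separates the two factors, so the same lattice sum `K` bounds
    -- both.
    have hA : ∑ k ∈ S, ((freqNorm k)⁻¹ * (freqNorm (m - k))⁻¹) ^ 2 ≤ K := by
      have h2 := hle m
      have h3 : ∑ k ∈ S, (freqNorm k ^ 4)⁻¹ ≤ K := hKs.sum_le_tsum S fun k _ => hpos k
      have h4 : ∑ k ∈ S, ((freqNorm k)⁻¹ * (freqNorm (m - k))⁻¹) ^ 2 ≤
          ∑ k ∈ S, ((freqNorm k ^ 4)⁻¹ + (freqNorm (m - k) ^ 4)⁻¹) / 2 := by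
        refine Finset.sum_le_sum fun k _ => ?_
        have e : ∀ x : ℝ, (x ^ 4)⁻¹ = (x⁻¹ ^ 2) ^ 2 := fun x => by rw [← pow_mul, inv_pow]
        rw [e, e]
        nlinarith [sq_nonneg ((freqNorm k)⁻¹ ^ 2 - (freqNorm (m - k))⁻¹ ^ 2)]
      rw [← Finset.sum_div, Finset.sum_add_distrib] at h4
      linarith
    have hB : ∑ k ∈ S, (Real.sqrt (w k) * Real.sqrt (w (m - k))) ^ 2 =
        ∑ k ∈ S, w k * w (m - k) := by
      refine Finset.sum_congr rfl fun k _ => ?_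
      rw [mul_pow, Real.sq_sqrt (hw0 _), Real.sq_sqrt (hw0 _)]
    have hCS := Finset.sum_mul_sq_le_sq_mul_sq S
      (fun k => (freqNorm k)⁻¹ * (freqNorm (m - k))⁻¹)
      (fun k => Real.sqrt (w k) * Real.sqrt (w (m - k)))
    rw [hB] at hCS
    refine (pow_le_pow_left₀ (norm_nonneg _) h1 2).trans (hCS.trans ?_)
    exact mul_le_mul_of_nonneg_right hA
      (Finset.sum_nonneg fun k _ => mul_nonneg (hw0 _) (hw0 _))
  have hconv : HasSum (fun m => ∑ k ∈ S, w k * w (m - k)) (∑ k ∈ S, w k * ∑ l ∈ S, w l) := by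
    have h2 : ∀ k ∈ S, HasSum (fun m => w k * w (m - k)) (w k * ∑ l ∈ S, w l) := by
      intro k _
      have h3 : HasSum (fun m => w (m - k)) (∑ l ∈ S, w l) :=
        (Equiv.subRight k).hasSum_iff (f := w) |>.mpr hwsum
      exact h3.mul_left (w k)
    exact hasSum_sum h2
  have hfin := hasSum_le hterm hpars (hconv.mul_left (vol d ^ 2 * K))
  rw [← Finset.sum_mul, hwS] at hfin
  have hv := vol_pos d
  refine le_of_mul_le_mul_left (hfin.trans (le_of_eq ?_)) hv
  ring

/-- The Sobolev embedding of `H¹` in `L⁴` for mean-zero functions in dimension at most three. -/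
theorem memLp_four_of_summable (hd : d ≤ 3) {f : Torus d → ℝ} (hf : MemLp f 2 volume)
    (h0 : coeff f 0 = 0) (hs : Summable fun k => freqNorm k ^ 2 * ‖coeff f k‖ ^ 2) :
    MemLp f 4 volume ∧ ∫ x, f x ^ 4 ≤ ((vol d)⁻¹ ^ 3 * ∑' k : Fin d → ℤ, (freqNorm k ^ 4)⁻¹) *
      (∑' k, freqNorm k ^ 2 * ‖coeff f k‖ ^ 2) ^ 2 := by
  set K := ∑' k : Fin d → ℤ, (freqNorm k ^ 4)⁻¹ with hK
  set A := ∑' k, freqNorm k ^ 2 * ‖coeff f k‖ ^ 2 with hA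
  have hv := vol_pos d
  have hK0 : 0 ≤ K := tsum_nonneg fun k => by have := freqNorm_nonneg k; positivity
  let P : ℕ → Torus d → ℂ := fun N x => (vol d : ℂ)⁻¹ * cpoly (cube d N) (coeff f) x
  have hPc : ∀ N, Continuous (P N) := fun N => by fun_prop
  have hP4 : ∀ N, ∫ x, ‖P N x‖ ^ 4 ≤ ((vol d)⁻¹ ^ 3 * K) * A ^ 2 := by
    intro N
    have h1 : ∀ x, ‖P N x‖ ^ 4 = (vol d)⁻¹ ^ 4 * ‖cpoly (cube d N) (coeff f) x‖ ^ 4 := by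
      intro x
      rw [norm_mul, norm_inv, Complex.norm_real, Real.norm_eq_abs, abs_of_pos hv, mul_pow]
    simp only [h1]
    rw [integral_const_mul]
    have h2 := integral_norm_cpoly_pow_four_le hd (cube d N) h0
    have h3 : ∑ k ∈ cube d N, freqNorm k ^ 2 * ‖coeff f k‖ ^ 2 ≤ A :=
      hs.sum_le_tsum _ fun k _ => by positivity
    calc (vol d)⁻¹ ^ 4 * ∫ x, ‖cpoly (cube d N) (coeff f) x‖ ^ 4
        ≤ (vol d)⁻¹ ^ 4 * (vol d * K * A ^ 2) := by
          refine mul_le_mul_of_nonneg_left (h2.trans ?_) (by positivity)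
          refine mul_le_mul_of_nonneg_left (pow_le_pow_left₀ ?_ h3 2) (by positivity)
          exact Finset.sum_nonneg fun k _ => by positivity
      _ = _ := by field_simp
  have hfint : ∀ k, Integrable (fun x => (f x : ℂ) * conj (mexp k x)) volume := fun k => by
    have := integrable_mul_mexp (hf.integrable (by norm_num)) (-k)
    simpa only [mexp_neg] using this
  have hPint : ∀ N k, ∫ x, P N x * conj (mexp k x) = if k ∈ cube d N then coeff f k else 0 := by
    intro N k
    have h1 : ∀ x, P N x * conj (mexp k x) = (vol d : ℂ)⁻¹ *
        ∑ l ∈ cube d N, coeff f l * (conj (mexp k x) * mexp l x) := by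
      intro x
      simp only [P, cpoly_apply]
      rw [mul_assoc, Finset.sum_mul]
      congr 1
      exact Finset.sum_congr rfl fun l _ => by ring
    simp only [h1]
    rw [integral_const_mul, integral_finsetSum _ fun l _ =>
      ContinuousMap.integrable_torus (⟨fun x => coeff f l * (conj (mexp k x) * mexp l x),
        by fun_prop⟩ : C(Torus d, ℂ))]
    simp only [integral_const_mul, integral_conj_mexp_mul, mul_ite, mul_zero, Finset.sum_ite_eq]
    split_ifs
    · field_simp [Complex.ofReal_ne_zero.mpr hv.ne']
    · simp
  have hPmem : ∀ N, MemLp (P N) 2 volume := fun N =>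
    MemLp.of_bound (hPc N).aestronglyMeasurable
      (‖(⟨P N, hPc N⟩ : C(Torus d, ℂ))‖)
      (ae_of_all _ fun x => (⟨P N, hPc N⟩ : C(Torus d, ℂ)).norm_coe_le_norm x)
  have hL2 : Tendsto (fun N => eLpNorm (P N - fun x => (f x : ℂ)) 2 volume) atTop (𝓝 0) := by
    have hsum := (hasSum_sq_norm_coeff hf).summable
    have hval : ∀ N, ∫ x, ‖P N x - (f x : ℂ)‖ ^ 2 =
        (vol d)⁻¹ * (∑' k, ‖coeff f k‖ ^ 2 - ∑ k ∈ cube d N, ‖coeff f k‖ ^ 2) := by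
      intro N
      have h1 : ∑' k, ‖∫ x, (P N - fun x => (f x : ℂ)) x * conj (mexp k x)‖ ^ 2 =
          vol d * ∫ x, ‖(P N - fun x => (f x : ℂ)) x‖ ^ 2 :=
        (hasSum_sq_norm_integral ((hPmem N).sub hf.ofReal)).tsum_eq
      have h2 : ∀ k, ∫ x, (P N - fun x => (f x : ℂ)) x * conj (mexp k x) =
          if k ∈ cube d N then 0 else -coeff f k := by
        intro k
        simp only [Pi.sub_apply, sub_mul]
        rw [integral_sub _ (hfint k), hPint, ← coeff_eq_integral_conj]
        · split_ifs <;> simp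
        · exact ContinuousMap.integrable_torus (⟨fun x => P N x * conj (mexp k x),
            by fun_prop⟩ : C(Torus d, ℂ))
      have h3 : ∑' k, ‖∫ x, (P N - fun x => (f x : ℂ)) x * conj (mexp k x)‖ ^ 2 =
          ∑' k, ‖coeff f k‖ ^ 2 - ∑ k ∈ cube d N, ‖coeff f k‖ ^ 2 := by
        have h4 : HasSum (fun k => if k ∈ cube d N then ‖coeff f k‖ ^ 2 else 0)
            (∑ k ∈ cube d N, ‖coeff f k‖ ^ 2) := by
          have h5 : ∑ k ∈ cube d N, (if k ∈ cube d N then ‖coeff f k‖ ^ 2 else 0) =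
              ∑ k ∈ cube d N, ‖coeff f k‖ ^ 2 := Finset.sum_congr rfl fun k hk => if_pos hk
          rw [← h5]
          exact hasSum_sum_of_ne_finset_zero fun k hk => if_neg hk
        refine Eq.trans (tsum_congr fun k => ?_) (hsum.hasSum.sub h4).tsum_eq
        rw [h2]
        split_ifs <;> simp
      rw [h3] at h1
      rw [h1]
      simp only [Pi.sub_apply]
      field_simp
    have htend : Tendsto (fun N => ∫ x, ‖P N x - (f x : ℂ)‖ ^ 2) atTop (𝓝 0) := by
      simp only [hval]
      have h5 : Tendsto (fun N => ∑ k ∈ cube d N, ‖coeff f k‖ ^ 2) atTop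
        (𝓝 (∑' k, ‖coeff f k‖ ^ 2)) := hsum.hasSum.comp tendsto_cube
      have h8 := (h5.const_sub (∑' k, ‖coeff f k‖ ^ 2)).const_mul (vol d)⁻¹
      rwa [sub_self, mul_zero] at h8
    have hnorm : ∀ N, eLpNorm (P N - fun x => (f x : ℂ)) 2 volume =
        ENNReal.ofReal ((∫ x, ‖P N x - (f x : ℂ)‖ ^ 2) ^ (2⁻¹ : ℝ)) := by
      intro N
      have := ((hPmem N).sub hf.ofReal).eLpNorm_eq_integral_rpow_norm (by norm_num) (by norm_num)
      simpa using this
    simp only [hnorm]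
    have h6 := (htend.rpow_const (p := (2⁻¹ : ℝ)) (Or.inr (by norm_num)))
    rw [Real.zero_rpow (by norm_num)] at h6
    simpa using ENNReal.tendsto_ofReal h6
  -- The partial sums converge in L², hence almost everywhere along a subsequence, and Fatou's lemma
  -- transfers their uniform L⁴ bound to `f`.
  have hmeas := tendstoInMeasure_of_tendsto_eLpNorm (by norm_num)
    (fun N => (hPc N).aestronglyMeasurable) (hf.ofReal (K := ℂ)).aestronglyMeasurable hL2
  obtain ⟨ns, hns, hae⟩ := hmeas.exists_seq_tendsto_ae
  have hlim := Lp.eLpNorm_lim_le_liminf_eLpNorm (p := 4)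
    (fun n => (hPc (ns n)).aestronglyMeasurable) (fun x => (f x : ℂ)) hae
  have hB0 : 0 ≤ ((vol d)⁻¹ ^ 3 * K) * A ^ 2 := by positivity
  have hP4n : ∀ N, eLpNorm (P N) 4 volume ≤
      ENNReal.ofReal ((((vol d)⁻¹ ^ 3 * K) * A ^ 2) ^ (4⁻¹ : ℝ)) := by
    intro N
    have hmem : MemLp (P N) 4 volume := MemLp.of_bound (hPc N).aestronglyMeasurable
      (‖(⟨P N, hPc N⟩ : C(Torus d, ℂ))‖)
      (ae_of_all _ fun x => (⟨P N, hPc N⟩ : C(Torus d, ℂ)).norm_coe_le_norm x)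
    have := hmem.eLpNorm_eq_integral_rpow_norm (by norm_num) (by norm_num)
    rw [this]
    refine ENNReal.ofReal_le_ofReal ?_
    have h7 := hP4 N
    have e : ∀ x, ‖P N x‖ ^ (4 : ℝ) = ‖P N x‖ ^ 4 := fun x => by
      exact_mod_cast Real.rpow_natCast _ 4
    simp only [ENNReal.toReal_ofNat, e]
    refine Real.rpow_le_rpow (integral_nonneg fun x => by positivity) h7 (by norm_num)
  have hle : eLpNorm (fun x => (f x : ℂ)) 4 volume ≤
      ENNReal.ofReal ((((vol d)⁻¹ ^ 3 * K) * A ^ 2) ^ (4⁻¹ : ℝ)) := by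
    refine hlim.trans ?_
    refine (liminf_le_liminf (Eventually.of_forall fun n => hP4n (ns n))).trans ?_
    simp
  have hfe : eLpNorm (fun x => (f x : ℂ)) 4 volume = eLpNorm f 4 volume :=
    eLpNorm_congr_norm_ae (ae_of_all _ fun x => by simp)
  rw [hfe] at hle
  have hmem : MemLp f 4 volume := ⟨hf.aestronglyMeasurable, hle.trans_lt ENNReal.ofReal_lt_top⟩
  refine ⟨hmem, ?_⟩
  rw [hmem.eLpNorm_eq_integral_rpow_norm (by norm_num) (by norm_num),
    ENNReal.ofReal_le_ofReal_iff (Real.rpow_nonneg hB0 _)] at hle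
  have e : ∀ x, ‖f x‖ ^ (4 : ℝ) = f x ^ 4 := fun x => by
    rw [Real.norm_eq_abs]
    have : |f x| ^ (4 : ℝ) = |f x| ^ 4 := by exact_mod_cast Real.rpow_natCast _ 4
    rw [this, Even.pow_abs (by decide)]
  simp only [ENNReal.toReal_ofNat, e] at hle
  exact (Real.rpow_le_rpow_iff (integral_nonneg fun x => by positivity) hB0
    (by norm_num : (0 : ℝ) < 4⁻¹)).mp hle

end Embedding

end ThinFilm

namespace ThinFilm

open scoped ComplexConjugate

section Gradient

variable {d : ℕ}

/-! ### Vector fields and gradients -/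

/-- The Euclidean length of the vector of Fourier coefficients of a vector field. -/
noncomputable def vhat (v : Torus d → Vec d) (k : Fin d → ℤ) : ℝ :=
  Real.sqrt (∑ j, ‖coeff (fun x => v x j) k‖ ^ 2)

lemma vhat_nonneg (v : Torus d → Vec d) (k : Fin d → ℤ) : 0 ≤ vhat v k := Real.sqrt_nonneg _

lemma vhat_sq (v : Torus d → Vec d) (k : Fin d → ℤ) :
    vhat v k ^ 2 = ∑ j, ‖coeff (fun x => v x j) k‖ ^ 2 :=
  Real.sq_sqrt (Finset.sum_nonneg fun _ _ => sq_nonneg _)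

lemma hasSum_vhat_sq {v : Torus d → Vec d} (hv : ∀ j, MemLp (fun x => v x j) 2 volume) :
    HasSum (fun k => vhat v k ^ 2) (vol d * ∫ x, ‖v x‖ ^ 2) := by
  have h : HasSum (fun k => ∑ j, ‖coeff (fun x => v x j) k‖ ^ 2)
      (∑ j, vol d * ∫ x, v x j ^ 2) := hasSum_sum fun j _ => hasSum_sq_norm_coeff (hv j)
  simp only [vhat_sq]
  convert h using 1
  rw [← Finset.mul_sum, ← integral_finsetSum _ fun j _ => (hv j).integrable_sq]
  congr 2
  ext x
  rw [EuclideanSpace.norm_sq_eq]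
  simp

/-- Divergence of a vector field, on the Fourier side. -/
lemma norm_sum_mul_coeff_le (v : Torus d → Vec d) (k : Fin d → ℤ) :
    ‖∑ j, Complex.I * (k j : ℂ) * coeff (fun x => v x j) k‖ ≤ freqNorm k * vhat v k := by
  have h1 : ‖∑ j, Complex.I * (k j : ℂ) * coeff (fun x => v x j) k‖ ≤
      ∑ j, |(k j : ℝ)| * ‖coeff (fun x => v x j) k‖ := by
    refine (norm_sum_le _ _).trans (le_of_eq (Finset.sum_congr rfl fun j _ => ?_))
    rw [norm_mul, norm_mul, Complex.norm_I, one_mul, Complex.norm_intCast]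
  have h2 := Finset.sum_mul_sq_le_sq_mul_sq Finset.univ (fun j => |(k j : ℝ)|)
    (fun j => ‖coeff (fun x => v x j) k‖)
  simp only [sq_abs] at h2
  rw [← freqNorm_sq, ← vhat_sq, ← mul_pow] at h2
  exact h1.trans (abs_le_of_sq_le_sq' h2 (mul_nonneg (freqNorm_nonneg k) (vhat_nonneg v k))).2

lemma summable_grad_component {f : Torus d → ℝ}
    (hs : Summable fun k => freqNorm k ^ 2 * ‖coeff f k‖ ^ 2) (j : Fin d) :
    Summable fun k : Fin d → ℤ => ‖Complex.I * (k j : ℂ) * coeff f k‖ ^ 2 := by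
  refine Summable.of_nonneg_of_le (fun _ => sq_nonneg _) (fun k => ?_) hs
  rw [norm_mul, norm_mul, Complex.norm_I, one_mul, Complex.norm_intCast, mul_pow]
  gcongr
  exact abs_le_freqNorm k j

lemma memLp_grad_component {f : Torus d → ℝ}
    (hs : Summable fun k => freqNorm k ^ 2 * ‖coeff f k‖ ^ 2) (j : Fin d) :
    MemLp (fun x => grad f x j) 2 volume ∧
      ∀ k, coeff (fun x => grad f x j) k = Complex.I * (k j : ℂ) * coeff f k :=
  fourierMul_memLp (m := fun k => Complex.I * (k j : ℂ)) (fun k => by simp)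
    (summable_grad_component hs j)

lemma grad_eq_of_coeff {f : Torus d → ℝ} {u : Torus d → Vec d}
    (hu : ∀ j, Integrable (fun x => u x j) volume)
    (h : ∀ j k, coeff (fun x => u x j) k = Complex.I * (k j : ℂ) * coeff f k) :
    grad f =ᵐ[volume] u := by
  have : ∀ᵐ x, ∀ j, grad f x j = u x j := by
    rw [ae_all_iff]
    exact fun j => fourierMul_spec (hu j) (h j)
  filter_upwards [this] with x hx
  ext j
  exact hx j

lemma vhat_eq_of_coeff {c : (Fin d → ℤ) → ℂ} {u : Torus d → Vec d} {k : Fin d → ℤ}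
    (h : ∀ j, coeff (fun x => u x j) k = Complex.I * (k j : ℂ) * c k) :
    vhat u k = freqNorm k * ‖c k‖ := by
  rw [vhat]
  simp only [h, norm_mul, Complex.norm_I, one_mul, Complex.norm_intCast, mul_pow, sq_abs]
  rw [← Finset.sum_mul, ← freqNorm_sq, ← mul_pow,
    Real.sqrt_sq (mul_nonneg (freqNorm_nonneg k) (norm_nonneg _))]

lemma vhat_grad {f : Torus d → ℝ}
    (hs : Summable fun k => freqNorm k ^ 2 * ‖coeff f k‖ ^ 2) (k : Fin d → ℤ) :
    vhat (grad f) k = freqNorm k * ‖coeff f k‖ :=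
  vhat_eq_of_coeff fun j => (memLp_grad_component hs j).2 k

lemma hasSum_grad {f : Torus d → ℝ}
    (hs : Summable fun k => freqNorm k ^ 2 * ‖coeff f k‖ ^ 2) :
    HasSum (fun k => freqNorm k ^ 2 * ‖coeff f k‖ ^ 2) (vol d * ∫ x, ‖grad f x‖ ^ 2) := by
  have := hasSum_vhat_sq (v := grad f) fun j => (memLp_grad_component hs j).1
  simpa only [vhat_grad hs, mul_pow] using this

lemma memLp_lap {f : Torus d → ℝ} (hs : Summable fun k => freqNorm k ^ 4 * ‖coeff f k‖ ^ 2) :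
    MemLp (lap f) 2 volume ∧
      ∀ k, coeff (lap f) k = -((freqNorm k ^ 2 : ℝ) : ℂ) * coeff f k := by
  refine fourierMul_memLp (m := fun k => -((freqNorm k ^ 2 : ℝ) : ℂ)) (fun k => ?_) ?_
  · rw [freqNorm_neg, map_neg, Complex.conj_ofReal]
  · refine hs.congr fun k => ?_
    rw [norm_mul, norm_neg, Complex.norm_real, Real.norm_eq_abs, abs_of_nonneg (sq_nonneg _)]
    ring

lemma hasSum_lap {f : Torus d → ℝ} (hs : Summable fun k => freqNorm k ^ 4 * ‖coeff f k‖ ^ 2) :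
    HasSum (fun k => freqNorm k ^ 4 * ‖coeff f k‖ ^ 2) (vol d * ∫ x, lap f x ^ 2) := by
  have := hasSum_sq_norm_coeff (memLp_lap hs).1
  refine this.congr_fun fun k => ?_
  rw [(memLp_lap hs).2, norm_mul, norm_neg, Complex.norm_real, Real.norm_eq_abs,
    abs_of_nonneg (sq_nonneg _)]
  ring

lemma freqNorm_pow_le_pow {m n : ℕ} (hm : m ≠ 0) (hmn : m ≤ n) (k : Fin d → ℤ) :
    freqNorm k ^ m ≤ freqNorm k ^ n := by
  by_cases hk : k = 0
  · simp [hk, hm, (Nat.pos_of_ne_zero hm).trans_le hmn |>.ne']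
  · exact pow_le_pow_right₀ (one_le_freqNorm hk) hmn

lemma summable_freqNorm_of_le {m n : ℕ} (hm : m ≠ 0) (hmn : m ≤ n) {c : (Fin d → ℤ) → ℂ}
    (hs : Summable fun k => freqNorm k ^ n * ‖c k‖ ^ 2) :
    Summable fun k => freqNorm k ^ m * ‖c k‖ ^ 2 := by
  refine Summable.of_nonneg_of_le (fun k => ?_) (fun k => ?_) hs
  · have := freqNorm_nonneg k
    positivity
  · exact mul_le_mul_of_nonneg_right (freqNorm_pow_le_pow hm hmn k) (sq_nonneg _)

/-! ### The gradient as an absolutely convergent series -/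

/-- The vector field whose `j`-th component has Fourier coefficients `i k_j c_k`. -/
noncomputable def gradTrig (c : (Fin d → ℤ) → ℂ) : C(Torus d, Vec d) where
  toFun x := WithLp.toLp 2 fun j => trig (fun k => Complex.I * (k j : ℂ) * c k) x
  continuous_toFun := by fun_prop

lemma gradTrig_apply (c : (Fin d → ℤ) → ℂ) (x : Torus d) (j : Fin d) :
    gradTrig c x j = trig (fun k => Complex.I * (k j : ℂ) * c k) x := rfl

lemma norm_component_le (c : (Fin d → ℤ) → ℂ) (j : Fin d) (k : Fin d → ℤ) :
    ‖Complex.I * (k j : ℂ) * c k‖ ≤ freqNorm k * ‖c k‖ := by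
  rw [norm_mul, norm_mul, Complex.norm_I, one_mul, Complex.norm_intCast]
  gcongr
  exact abs_le_freqNorm k j

lemma summable_component {c : (Fin d → ℤ) → ℂ} (hc : Summable fun k => freqNorm k * ‖c k‖)
    (j : Fin d) : Summable fun k : Fin d → ℤ => ‖Complex.I * (k j : ℂ) * c k‖ :=
  Summable.of_nonneg_of_le (fun _ => norm_nonneg _) (norm_component_le c j) hc

lemma norm_le_sum_abs (v : Vec d) : ‖v‖ ≤ ∑ j, |v j| := by
  refine abs_le_of_sq_le_sq' ?_ (Finset.sum_nonneg fun _ _ => abs_nonneg _) |>.2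
  rw [EuclideanSpace.norm_sq_eq]
  exact Finset.sum_sq_le_sq_sum_of_nonneg fun _ _ => norm_nonneg _

lemma norm_gradTrig_apply_le {c : (Fin d → ℤ) → ℂ} (hc : Summable fun k => freqNorm k * ‖c k‖)
    (x : Torus d) : ‖gradTrig c x‖ ≤ d * (vol d)⁻¹ * ∑' k, freqNorm k * ‖c k‖ := by
  refine (norm_le_sum_abs _).trans ?_
  calc ∑ j, |gradTrig c x j| ≤ ∑ _j : Fin d, (vol d)⁻¹ * ∑' k, freqNorm k * ‖c k‖ := by
        refine Finset.sum_le_sum fun j _ => (abs_trig_le (summable_component hc j) x).trans ?_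
        refine mul_le_mul_of_nonneg_left ?_ (inv_pos.mpr (vol_pos d)).le
        exact (summable_component hc j).tsum_le_tsum (norm_component_le c j) hc
    _ = _ := by simp [mul_assoc]

lemma norm_gradTrig_le {c : (Fin d → ℤ) → ℂ} (hc : Summable fun k => freqNorm k * ‖c k‖) :
    ‖gradTrig c‖ ≤ d * (vol d)⁻¹ * ∑' k, freqNorm k * ‖c k‖ :=
  (ContinuousMap.norm_le _ ((norm_nonneg _).trans (norm_gradTrig_apply_le hc 0))).mpr
    (norm_gradTrig_apply_le hc)

lemma gradTrig_sub {c c' : (Fin d → ℤ) → ℂ} (hc : Summable fun k => freqNorm k * ‖c k‖)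
    (hc' : Summable fun k => freqNorm k * ‖c' k‖) :
    gradTrig (fun k => c k - c' k) = gradTrig c - gradTrig c' := by
  ext x j
  have := trig_sub (summable_component hc j) (summable_component hc' j)
  rw [ContinuousMap.sub_apply, PiLp.sub_apply, gradTrig_apply, gradTrig_apply, gradTrig_apply,
    ← ContinuousMap.sub_apply, ← this]
  congr
  ext k
  ring

lemma coeff_gradTrig {c : (Fin d → ℤ) → ℂ} (hc : Summable fun k => freqNorm k * ‖c k‖)
    (hsymm : ∀ k, c (-k) = conj (c k)) (j : Fin d) (k : Fin d → ℤ) :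
    coeff (fun x => gradTrig c x j) k = Complex.I * (k j : ℂ) * c k :=
  coeff_trig (c := fun k => Complex.I * (k j : ℂ) * c k) (summable_component hc j)
    (fun k => by simp [hsymm]) k

lemma integrable_component (u : C(Torus d, Vec d)) (j : Fin d) :
    Integrable (fun x => u x j) volume :=
  ContinuousMap.integrable_torus (⟨fun x => u x j, by fun_prop⟩ : C(Torus d, ℝ))

lemma memLp_component (u : C(Torus d, Vec d)) (j : Fin d) (p : ℝ≥0∞) :
    MemLp (fun x => u x j) p volume := by
  refine MemLp.of_bound (C := ‖u‖) (Continuous.aestronglyMeasurable (by fun_prop))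
    (ae_of_all _ fun x => ?_)
  exact (PiLp.norm_apply_le (u x) j).trans (u.norm_coe_le_norm x)

lemma grad_ae_eq_gradTrig {f : Torus d → ℝ} (hc : Summable fun k => freqNorm k * ‖coeff f k‖) :
    grad f =ᵐ[volume] gradTrig (coeff f) :=
  grad_eq_of_coeff (integrable_component _) (coeff_gradTrig hc fun k => coeff_neg f k)

lemma supNorm_le_of_coeff {v : Torus d → Vec d} {c : (Fin d → ℤ) → ℂ} (hv : v =ᵐ[volume] gradTrig c)
    (hc : Summable fun k => freqNorm k * ‖c k‖) :
    supNorm v ≤ ENNReal.ofReal (d * (vol d)⁻¹ * ∑' k, freqNorm k * ‖c k‖) := by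
  rw [supNorm, eLpNorm_exponent_top]
  refine eLpNormEssSup_le_of_ae_bound ?_
  filter_upwards [hv] with x hx
  rw [hx]
  exact norm_gradTrig_apply_le hc x

/-! ### Lipschitz images of vector fields -/

lemma mexp_single_coe (k : Fin d → ℤ) (j : Fin d) (ε : ℝ) :
    mexp k (Pi.single j (ε : AddCircle (2 * Real.pi))) = Complex.exp (Complex.I * (k j * ε : ℝ)) := by
  rw [mexp_apply, Finset.prod_eq_single j]
  · rw [Pi.single_eq_same, fourier_coe_apply]
    congr 1
    push_cast
    have : (Real.pi : ℂ) ≠ 0 := Complex.ofReal_ne_zero.mpr Real.pi_ne_zero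
    field_simp
  · intro i _ hi
    simp [Pi.single_eq_of_ne hi]
  · simp

lemma hasSum_translate (v : C(Torus d, Vec d)) (y : Torus d) :
    HasSum (fun k => ‖mexp k y - 1‖ ^ 2 * vhat v k ^ 2) (vol d * ∫ x, ‖v (x + y) - v x‖ ^ 2) := by
  have h := hasSum_vhat_sq (v := fun x => v (x + y) - v x) fun j =>
    memLp_component (⟨fun x => v (x + y) - v x, by fun_prop⟩ : C(Torus d, Vec d)) j 2
  refine h.congr_fun fun k => ?_
  rw [vhat_sq, vhat_sq, Finset.mul_sum]
  refine Finset.sum_congr rfl fun j _ => ?_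
  have h2 : coeff (fun x => (v (x + y) - v x) j) k =
      (mexp k y - 1) * coeff (fun x => v x j) k := by
    simp only [PiLp.sub_apply]
    rw [coeff_sub, coeff_translate (fun x => v x j)]
    · ring
    · exact integrable_component (⟨fun x => v (x + y), by fun_prop⟩ : C(Torus d, Vec d)) j
    · exact integrable_component v j
  rw [h2, norm_mul, mul_pow]

/-- A Lipschitz image of a vector field has at most the corresponding multiple of its `H¹`
seminorm. -/
theorem tsum_sq_vhat_le_of_lipschitz {u v : C(Torus d, Vec d)} {L : ℝ}
    (h : ∀ x y, ‖v x - v y‖ ≤ L * ‖u x - u y‖)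
    (hs : Summable fun k => freqNorm k ^ 2 * vhat u k ^ 2) :
    Summable (fun k => freqNorm k ^ 2 * vhat v k ^ 2) ∧
      ∑' k, freqNorm k ^ 2 * vhat v k ^ 2 ≤ L ^ 2 * ∑' k, freqNorm k ^ 2 * vhat u k ^ 2 := by
  have hsj : ∀ j, Summable fun k : Fin d → ℤ => (k j : ℝ) ^ 2 * vhat u k ^ 2 := by
    intro j
    refine Summable.of_nonneg_of_le (fun k => by positivity) (fun k => ?_) hs
    refine mul_le_mul_of_nonneg_right ?_ (sq_nonneg _)
    rw [← sq_abs]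
    exact pow_le_pow_left₀ (abs_nonneg _) (abs_le_freqNorm k j) 2
  have key : ∀ (j : Fin d) (s : Finset (Fin d → ℤ)),
      ∑ k ∈ s, (k j : ℝ) ^ 2 * vhat v k ^ 2 ≤ L ^ 2 * ∑' k, (k j : ℝ) ^ 2 * vhat u k ^ 2 := by
    intro j s
    -- Difference quotients replace a chain rule: a translation by `ε` multiplies the coefficients
    -- by a phase, so Parseval turns the Lipschitz bound into one between weighted sums with weights
    -- `|e^{i k_j ε} - 1|²`. On the side of `u` this weight is at most `ε² k_j²`.
    have hε : ∀ ε : ℝ, ε ≠ 0 →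
        ∑ k ∈ s, (‖Complex.exp (Complex.I * (k j * ε : ℝ)) - 1‖ / |ε|) ^ 2 * vhat v k ^ 2 ≤
          L ^ 2 * ∑' k, (k j : ℝ) ^ 2 * vhat u k ^ 2 := by
      intro ε hε0
      set y : Torus d := Pi.single j (ε : AddCircle (2 * Real.pi)) with hy
      have hv := hasSum_translate v y
      have hu := hasSum_translate u y
      have h1 : vol d * ∫ x, ‖v (x + y) - v x‖ ^ 2 ≤
          L ^ 2 * (vol d * ∫ x, ‖u (x + y) - u x‖ ^ 2) := by
        rw [mul_left_comm]
        refine mul_le_mul_of_nonneg_left ?_ (vol_pos d).le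
        rw [← integral_const_mul]
        refine integral_mono ?_ ?_ fun x => ?_
        · exact ContinuousMap.integrable_torus
            (⟨fun x => ‖v (x + y) - v x‖ ^ 2, by fun_prop⟩ : C(Torus d, ℝ))
        · exact ContinuousMap.integrable_torus
            (⟨fun x => L ^ 2 * ‖u (x + y) - u x‖ ^ 2, by fun_prop⟩ : C(Torus d, ℝ))
        · simp only
          rw [← mul_pow]
          exact pow_le_pow_left₀ (norm_nonneg _) (h _ _) 2
      have h2 : vol d * ∫ x, ‖u (x + y) - u x‖ ^ 2 ≤
          ε ^ 2 * ∑' k, (k j : ℝ) ^ 2 * vhat u k ^ 2 := by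
        refine hasSum_le (fun k => ?_) hu ((hsj j).hasSum.mul_left (ε ^ 2))
        rw [hy, mexp_single_coe, ← mul_assoc]
        refine mul_le_mul_of_nonneg_right ?_ (sq_nonneg _)
        refine (pow_le_pow_left₀ (norm_nonneg _) (Real.norm_exp_I_mul_ofReal_sub_one_le) 2).trans ?_
        rw [Real.norm_eq_abs, sq_abs, mul_comm, mul_pow]
      have h3 : ∑ k ∈ s, ‖mexp k y - 1‖ ^ 2 * vhat v k ^ 2 ≤ vol d * ∫ x, ‖v (x + y) - v x‖ ^ 2 :=
        sum_le_hasSum s (fun k _ => by positivity) hv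
      have h4 : ∑ k ∈ s, (‖Complex.exp (Complex.I * (k j * ε : ℝ)) - 1‖ / |ε|) ^ 2 * vhat v k ^ 2 =
          (ε ^ 2)⁻¹ * ∑ k ∈ s, ‖mexp k y - 1‖ ^ 2 * vhat v k ^ 2 := by
        rw [Finset.mul_sum]
        refine Finset.sum_congr rfl fun k _ => ?_
        rw [hy, mexp_single_coe, div_pow, sq_abs]
        ring
      rw [h4, inv_mul_le_iff₀ (by positivity)]
      nlinarith [sq_nonneg L, mul_le_mul_of_nonneg_left h2 (sq_nonneg L)]
    -- As `ε → 0` the weight tends to `k_j²`; only finitely many frequencies are involved, so no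
    -- domination is needed.
    have hlim : Tendsto (fun ε : ℝ => ∑ k ∈ s,
        (‖Complex.exp (Complex.I * (k j * ε : ℝ)) - 1‖ / |ε|) ^ 2 * vhat v k ^ 2) (𝓝[≠] 0)
        (𝓝 (∑ k ∈ s, (k j : ℝ) ^ 2 * vhat v k ^ 2)) := by
      refine tendsto_finsetSum _ fun k _ => Tendsto.mul_const _ ?_
      have hder : HasDerivAt (fun ε : ℝ => Complex.exp (Complex.I * (k j * ε : ℝ)))
          (Complex.I * (k j : ℝ)) 0 := by
        have h1 : HasDerivAt (fun ε : ℝ => Complex.I * ((k j : ℝ) * ε : ℝ))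
            (Complex.I * ((k j : ℝ) : ℂ)) 0 := by
          have := ((hasDerivAt_id (0 : ℝ)).const_mul (k j : ℝ)).ofReal_comp.const_mul Complex.I
          simpa using this
        have h2 := h1.cexp
        simpa using h2
      have hslope := hder.tendsto_slope.norm
      have h5 := hslope.pow 2
      have h6 : ‖Complex.I * ((k j : ℝ) : ℂ)‖ ^ 2 = (k j : ℝ) ^ 2 := by
        rw [norm_mul, Complex.norm_I, one_mul, Complex.norm_real, Real.norm_eq_abs, sq_abs]
      rw [h6] at h5
      refine h5.congr fun ε => ?_
      rw [slope_def_module]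
      simp [div_eq_inv_mul]
    refine le_of_tendsto hlim ?_
    filter_upwards [self_mem_nhdsWithin] with ε hε0
    exact hε ε hε0
  have hbound : ∀ s : Finset (Fin d → ℤ), ∑ k ∈ s, freqNorm k ^ 2 * vhat v k ^ 2 ≤
      L ^ 2 * ∑' k, freqNorm k ^ 2 * vhat u k ^ 2 := by
    intro s
    have h1 : ∑ k ∈ s, freqNorm k ^ 2 * vhat v k ^ 2 =
        ∑ j, ∑ k ∈ s, (k j : ℝ) ^ 2 * vhat v k ^ 2 := by
      rw [Finset.sum_comm]
      refine Finset.sum_congr rfl fun k _ => ?_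
      rw [freqNorm_sq, Finset.sum_mul]
    have h2 : ∑' k, freqNorm k ^ 2 * vhat u k ^ 2 =
        ∑ j, ∑' k : Fin d → ℤ, (k j : ℝ) ^ 2 * vhat u k ^ 2 := by
      rw [← Summable.tsum_finsetSum fun j _ => hsj j]
      refine tsum_congr fun k => ?_
      rw [freqNorm_sq, Finset.sum_mul]
    rw [h1, h2, Finset.mul_sum]
    exact Finset.sum_le_sum fun j _ => key j s
  have hsum := summable_of_sum_le (fun k => by positivity) hbound
  exact ⟨hsum, hsum.tsum_le_of_sum_le hbound⟩

end Gradient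

end ThinFilm

namespace ThinFilm

/-! ### Square-summable families in `[0, ∞]` -/

section L2

variable {ι : Type*}

/-- The `ℓ²` norm of a family in `[0, ∞]`. -/
noncomputable def l2 (x : ι → ℝ≥0∞) : ℝ≥0∞ := (∑' k, x k ^ 2) ^ (1 / 2 : ℝ)

lemma l2_mono {x y : ι → ℝ≥0∞} (h : ∀ k, x k ≤ y k) : l2 x ≤ l2 y :=
  ENNReal.rpow_le_rpow (ENNReal.tsum_le_tsum fun k => pow_le_pow_left' (h k) 2) (by norm_num)

lemma sq_rpow_half (a : ℝ≥0∞) : (a ^ 2) ^ (1 / 2 : ℝ) = a := by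
  rw [← ENNReal.rpow_natCast, ← ENNReal.rpow_mul]; norm_num

lemma rpow_half_sq (a : ℝ≥0∞) : (a ^ (1 / 2 : ℝ)) ^ 2 = a := by
  rw [← ENNReal.rpow_natCast, ← ENNReal.rpow_mul]; norm_num

lemma l2_sq (x : ι → ℝ≥0∞) : l2 x ^ 2 = ∑' k, x k ^ 2 := rpow_half_sq _

lemma l2_le_iff {x : ι → ℝ≥0∞} {B : ℝ≥0∞} : l2 x ≤ B ↔ ∑' k, x k ^ 2 ≤ B ^ 2 := by
  rw [← l2_sq]
  refine ⟨fun h => pow_le_pow_left' h 2, fun h => ?_⟩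
  rw [← sq_rpow_half (l2 x), ← sq_rpow_half B]
  exact ENNReal.rpow_le_rpow h (by norm_num)

lemma le_l2 (x : ι → ℝ≥0∞) (k : ι) : x k ≤ l2 x := by
  rw [← sq_rpow_half (x k)]
  exact ENNReal.rpow_le_rpow (ENNReal.le_tsum (f := fun k => x k ^ 2) k) (by norm_num)

lemma l2_const_mul (a : ℝ≥0∞) (x : ι → ℝ≥0∞) : l2 (fun k => a * x k) = a * l2 x := by
  simp only [l2, mul_pow, ENNReal.tsum_mul_left]
  rw [ENNReal.mul_rpow_of_nonneg _ _ (by norm_num), sq_rpow_half]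

lemma l2_add_le (x y : ι → ℝ≥0∞) : l2 (fun k => x k + y k) ≤ l2 x + l2 y := by
  let m : MeasurableSpace ι := ⊤
  have h := ENNReal.lintegral_Lp_add_le (μ := Measure.count) (p := 2) (f := x) (g := y)
    measurable_from_top.aemeasurable measurable_from_top.aemeasurable (by norm_num)
  simp only [lintegral_count, Pi.add_apply, ENNReal.rpow_two] at h
  exact h

lemma tsum_mul_le_l2_mul_l2 (x y : ι → ℝ≥0∞) : ∑' k, x k * y k ≤ l2 x * l2 y := by
  let m : MeasurableSpace ι := ⊤
  have h := ENNReal.lintegral_mul_le_Lp_mul_Lq (μ := Measure.count) (p := 2) (q := 2)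
    Real.HolderConjugate.two_two (f := x) (g := y)
    measurable_from_top.aemeasurable measurable_from_top.aemeasurable
  simp only [lintegral_count, Pi.mul_apply, ENNReal.rpow_two] at h
  exact h

/-- Minkowski's integral inequality for `ℓ²`. -/
theorem l2_lintegral_le {α : Type*} [MeasurableSpace α] {μ : Measure α} {x : ι → α → ℝ≥0∞}
    (hx : ∀ k, AEMeasurable (x k) μ) :
    l2 (fun k => ∫⁻ s, x k s ∂μ) ≤ ∫⁻ s, l2 (fun k => x k s) ∂μ := by
  set M := ∫⁻ s, l2 (fun k => x k s) ∂μ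
  set I : ι → ℝ≥0∞ := fun k => ∫⁻ s, x k s ∂μ
  rw [l2_le_iff, ENNReal.tsum_eq_iSup_sum]
  refine iSup_le fun S => ?_
  have hIM : ∀ k, I k ≤ M := fun k => lintegral_mono fun s => le_l2 (fun k => x k s) k
  by_cases hM : M = ⊤
  · simp [hM]
  set N := (∑ k ∈ S, I k ^ 2) ^ (1 / 2 : ℝ) with hN
  have hN2 : N ^ 2 = ∑ k ∈ S, I k ^ 2 := rpow_half_sq _
  have hNtop : N ≠ ⊤ := by
    refine ENNReal.rpow_ne_top_of_nonneg (by norm_num) ?_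
    exact (ENNReal.sum_lt_top.mpr fun k _ =>
      ENNReal.pow_lt_top ((hIM k).trans_lt (lt_top_iff_ne_top.mpr hM))).ne
  -- Duality: the finite family of the `I k` is paired with itself. This leads to `N² ≤ N M`, and
  -- `N` may be cancelled because it is finite.
  have hCS : ∀ s, ∑ k ∈ S, I k * x k s ≤ N * l2 (fun k => x k s) := by
    intro s
    have h := ENNReal.inner_le_Lp_mul_Lq S I (fun k => x k s) Real.HolderConjugate.two_two
    simp only [ENNReal.rpow_two] at h
    refine h.trans (mul_le_mul_right ?_ _)
    exact ENNReal.rpow_le_rpow (ENNReal.sum_le_tsum _) (by norm_num)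
  have hmain : N ^ 2 ≤ N * M := by
    rw [hN2]
    calc ∑ k ∈ S, I k ^ 2 = ∑ k ∈ S, ∫⁻ s, I k * x k s ∂μ := by
          refine Finset.sum_congr rfl fun k _ => ?_
          rw [lintegral_const_mul'' _ (hx k), sq]
      _ = ∫⁻ s, ∑ k ∈ S, I k * x k s ∂μ :=
          (lintegral_finsetSum' _ fun k _ => (hx k).const_mul _).symm
      _ ≤ ∫⁻ s, N * l2 (fun k => x k s) ∂μ := lintegral_mono hCS
      _ = N * M := lintegral_const_mul' _ _ hNtop
  rw [← hN2]
  refine pow_le_pow_left' ?_ 2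
  rcases eq_or_ne N 0 with h0 | h0
  · rw [h0]; exact bot_le
  · rw [sq] at hmain
    exact (ENNReal.mul_le_mul_iff_right h0 hNtop).mp hmain

end L2

/-! ### Weighted sequence norms -/

section Weighted

variable {d : ℕ}

/-- The norm `‖|k|^n x_k‖_{ℓ²}`. -/
noncomputable def hnorm (n : ℕ) (x : (Fin d → ℤ) → ℝ) : ℝ≥0∞ :=
  l2 fun k => ENNReal.ofReal (freqNorm k ^ n * x k)

/-- The norm `∑ |k| x_k`. -/
noncomputable def anorm (x : (Fin d → ℤ) → ℝ) : ℝ≥0∞ :=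
  ∑' k, ENNReal.ofReal (freqNorm k * x k)

lemma hnorm_mono {n : ℕ} {x y : (Fin d → ℤ) → ℝ} (h : ∀ k, x k ≤ y k) : hnorm n x ≤ hnorm n y :=
  l2_mono fun k => ENNReal.ofReal_le_ofReal
    (mul_le_mul_of_nonneg_left (h k) (pow_nonneg (freqNorm_nonneg k) n))

lemma hnorm_add_le (n : ℕ) {x y : (Fin d → ℤ) → ℝ} (hx : ∀ k, 0 ≤ x k) (hy : ∀ k, 0 ≤ y k) :
    hnorm n (fun k => x k + y k) ≤ hnorm n x + hnorm n y := by
  refine le_trans (le_of_eq ?_) (l2_add_le _ _)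
  refine congrArg l2 (funext fun k => ?_)
  have := pow_nonneg (freqNorm_nonneg k) n
  rw [mul_add, ENNReal.ofReal_add (mul_nonneg this (hx k)) (mul_nonneg this (hy k))]

lemma hnorm_sq (n : ℕ) {x : (Fin d → ℤ) → ℝ} (hx : ∀ k, 0 ≤ x k) :
    hnorm n x ^ 2 = ∑' k, ENNReal.ofReal (freqNorm k ^ (2 * n) * x k ^ 2) := by
  rw [hnorm, l2_sq]
  refine tsum_congr fun k => ?_
  rw [← ENNReal.ofReal_pow (mul_nonneg (pow_nonneg (freqNorm_nonneg k) n) (hx k))]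
  congr 1
  ring

lemma summable_of_hnorm_ne_top {n : ℕ} {x : (Fin d → ℤ) → ℝ} (hx : ∀ k, 0 ≤ x k)
    (h : hnorm n x ≠ ⊤) : Summable fun k => freqNorm k ^ (2 * n) * x k ^ 2 := by
  have h2 : hnorm n x ^ 2 ≠ ⊤ := ENNReal.pow_ne_top h
  rw [hnorm_sq n hx] at h2
  refine (ENNReal.summable_toReal h2).congr fun k => ?_
  rw [ENNReal.toReal_ofReal]
  have := freqNorm_nonneg k
  positivity

lemma hnorm_eq_of_hasSum {n : ℕ} {x : (Fin d → ℤ) → ℝ} (hx : ∀ k, 0 ≤ x k) {B : ℝ}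
    (h : HasSum (fun k => freqNorm k ^ (2 * n) * x k ^ 2) B) :
    hnorm n x = ENNReal.ofReal (Real.sqrt B) := by
  have hpos : ∀ k, 0 ≤ freqNorm k ^ (2 * n) * x k ^ 2 := fun k => by
    have := freqNorm_nonneg k; positivity
  have h2 := hnorm_sq n hx
  rw [← ENNReal.ofReal_tsum_of_nonneg hpos h.summable, h.tsum_eq] at h2
  rw [← sq_rpow_half (hnorm n x), h2, ENNReal.ofReal_rpow_of_nonneg (h.nonneg hpos) (by norm_num),
    Real.sqrt_eq_rpow]

lemma tsum_le_of_hnorm_le {n : ℕ} {x : (Fin d → ℤ) → ℝ} (hx : ∀ k, 0 ≤ x k) {B : ℝ} (hB : 0 ≤ B)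
    (h : hnorm n x ≤ ENNReal.ofReal B) : ∑' k, freqNorm k ^ (2 * n) * x k ^ 2 ≤ B ^ 2 := by
  have hs := summable_of_hnorm_ne_top hx (h.trans_lt ENNReal.ofReal_lt_top).ne
  have hpos : ∀ k, 0 ≤ freqNorm k ^ (2 * n) * x k ^ 2 := fun k => by
    have := freqNorm_nonneg k; positivity
  rw [hnorm_eq_of_hasSum hx hs.hasSum, ENNReal.ofReal_le_ofReal_iff hB] at h
  calc _ = Real.sqrt (∑' k, freqNorm k ^ (2 * n) * x k ^ 2) ^ 2 :=
        (Real.sq_sqrt (tsum_nonneg hpos)).symm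
    _ ≤ _ := pow_le_pow_left₀ (Real.sqrt_nonneg _) h 2

lemma summable_of_anorm_ne_top {x : (Fin d → ℤ) → ℝ} (hx : ∀ k, 0 ≤ x k)
    (h : anorm x ≠ ⊤) : Summable fun k => freqNorm k * x k := by
  refine (ENNReal.summable_toReal h).congr fun k => ?_
  rw [ENNReal.toReal_ofReal (mul_nonneg (freqNorm_nonneg k) (hx k))]

lemma anorm_eq_of_summable {x : (Fin d → ℤ) → ℝ} (hx : ∀ k, 0 ≤ x k)
    (h : Summable fun k => freqNorm k * x k) :
    anorm x = ENNReal.ofReal (∑' k, freqNorm k * x k) :=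
  (ENNReal.ofReal_tsum_of_nonneg (fun k => mul_nonneg (freqNorm_nonneg k) (hx k)) h).symm

lemma anorm_add_le {x y : (Fin d → ℤ) → ℝ} (hx : ∀ k, 0 ≤ x k) (hy : ∀ k, 0 ≤ y k) :
    anorm (fun k => x k + y k) ≤ anorm x + anorm y := by
  rw [anorm, anorm, anorm, ← ENNReal.tsum_add]
  refine le_of_eq (tsum_congr fun k => ?_)
  have := freqNorm_nonneg k
  rw [mul_add, ENNReal.ofReal_add (mul_nonneg this (hx k)) (mul_nonneg this (hy k))]

lemma anorm_mono {x y : (Fin d → ℤ) → ℝ} (h : ∀ k, x k ≤ y k) : anorm x ≤ anorm y :=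
  ENNReal.tsum_le_tsum fun k => ENNReal.ofReal_le_ofReal
    (mul_le_mul_of_nonneg_left (h k) (freqNorm_nonneg k))

/-- In dimension at most three, `H³` controls the absolute sum. -/
lemma anorm_le_hnorm_three (hd : d ≤ 3) (x : (Fin d → ℤ) → ℝ) :
    anorm x ≤ ENNReal.ofReal (Real.sqrt (∑' k : Fin d → ℤ, (freqNorm k ^ 4)⁻¹)) * hnorm 3 x := by
  have h := tsum_mul_le_l2_mul_l2 (fun k : Fin d → ℤ => ENNReal.ofReal ((freqNorm k ^ 2)⁻¹))
    (fun k => ENNReal.ofReal (freqNorm k ^ 3 * x k))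
  have h1 : l2 (fun k : Fin d → ℤ => ENNReal.ofReal ((freqNorm k ^ 2)⁻¹)) =
      ENNReal.ofReal (Real.sqrt (∑' k : Fin d → ℤ, (freqNorm k ^ 4)⁻¹)) := by
    have hpos : ∀ k : Fin d → ℤ, 0 ≤ (freqNorm k ^ 4)⁻¹ := fun k => by
      have := freqNorm_nonneg k; positivity
    rw [l2, Real.sqrt_eq_rpow, ← ENNReal.ofReal_rpow_of_nonneg (tsum_nonneg hpos) (by norm_num),
      ENNReal.ofReal_tsum_of_nonneg hpos (summable_inv_pow_four hd)]
    congr 2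
    ext k
    rw [← ENNReal.ofReal_pow (by positivity)]
    congr 1
    rw [inv_pow, ← pow_mul]
  rw [h1] at h
  refine le_trans (ENNReal.tsum_le_tsum fun k => ?_) h
  rw [← ENNReal.ofReal_mul (by positivity)]
  refine ENNReal.ofReal_le_ofReal (le_of_eq ?_)
  by_cases hk : k = 0
  · simp [hk]
  · have := one_le_freqNorm hk
    have h0 : freqNorm k ≠ 0 := by linarith
    field_simp

end Weighted

/-! ### Singular integrals in time -/

section Time

lemma lintegral_rpow_sub_left {a t p : ℝ} (hat : a < t) (hp : p < 1) :
    ∫⁻ s in Set.Ioc a t, ENNReal.ofReal ((s - a) ^ (-p)) =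
      ENNReal.ofReal ((t - a) ^ (1 - p) / (1 - p)) := by
  have hint : IntervalIntegrable (fun s => (s - a) ^ (-p)) volume a t := by
    have := (intervalIntegral.intervalIntegrable_rpow' (a := 0) (b := t - a) (r := -p)
      (by linarith)).comp_sub_right a
    simpa using this
  have hval : ∫ s in a..t, (s - a) ^ (-p) = (t - a) ^ (1 - p) / (1 - p) := by
    rw [intervalIntegral.integral_comp_sub_right (fun x => x ^ (-p)), sub_self,
      integral_rpow (Or.inl (by linarith)), Real.zero_rpow (by linarith), sub_zero]
    rw [show -p + 1 = 1 - p by ring]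
  rw [← hval, intervalIntegral.integral_of_le hat.le, ofReal_integral_eq_lintegral_ofReal hint.1]
  refine (ae_restrict_iff' measurableSet_Ioc).mpr (ae_of_all _ fun s hs => ?_)
  exact Real.rpow_nonneg (sub_nonneg.mpr hs.1.le) _

lemma lintegral_rpow_sub_right {a t p : ℝ} (hat : a < t) (hp : p < 1) :
    ∫⁻ s in Set.Ioc a t, ENNReal.ofReal ((t - s) ^ (-p)) =
      ENNReal.ofReal ((t - a) ^ (1 - p) / (1 - p)) := by
  have hint : IntervalIntegrable (fun s => (t - s) ^ (-p)) volume a t := by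
    have := (intervalIntegral.intervalIntegrable_rpow' (a := t - a) (b := 0) (r := -p)
      (by linarith)).comp_sub_left t
    simpa using this
  have hval : ∫ s in a..t, (t - s) ^ (-p) = (t - a) ^ (1 - p) / (1 - p) := by
    rw [intervalIntegral.integral_comp_sub_left (fun x => x ^ (-p)), sub_self,
      integral_rpow (Or.inl (by linarith)), Real.zero_rpow (by linarith), sub_zero]
    rw [show -p + 1 = 1 - p by ring]
  rw [← hval, intervalIntegral.integral_of_le hat.le, ofReal_integral_eq_lintegral_ofReal hint.1]
  refine (ae_restrict_iff' measurableSet_Ioc).mpr (ae_of_all _ fun s hs => ?_)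
  exact Real.rpow_nonneg (sub_nonneg.mpr hs.2) _

/-- An explicit bound for the beta-type integral of two power singularities. -/
lemma lintegral_rpow_mul_rpow_le {a t p q : ℝ} (hat : a < t) (hp : 0 ≤ p) (hp1 : p < 1)
    (hq : 0 ≤ q) (hq1 : q < 1) :
    ∫⁻ s in Set.Ioc a t, ENNReal.ofReal ((t - s) ^ (-p)) * ENNReal.ofReal ((s - a) ^ (-q)) ≤
      ENNReal.ofReal ((2 / (1 - q) + 2 / (1 - p)) * (t - a) ^ (1 - p - q)) := by
  set τ := t - a with hτ
  have hτ0 : 0 < τ := sub_pos.mpr hat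
  have hhalf : ∀ r : ℝ, 0 ≤ r → r < 1 → (τ / 2) ^ (-r) ≤ 2 * τ ^ (-r) := by
    intro r hr hr1
    rw [Real.div_rpow hτ0.le zero_le_two, Real.rpow_neg zero_le_two, div_inv_eq_mul, mul_comm]
    refine mul_le_mul_of_nonneg_right ?_ (Real.rpow_nonneg hτ0.le _)
    calc (2 : ℝ) ^ r ≤ 2 ^ (1 : ℝ) := Real.rpow_le_rpow_of_exponent_le one_le_two hr1.le
      _ = 2 := Real.rpow_one 2
  have hpt : ∀ s ∈ Set.Ioc a t, ENNReal.ofReal ((t - s) ^ (-p)) * ENNReal.ofReal ((s - a) ^ (-q)) ≤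
      ENNReal.ofReal (2 * τ ^ (-p)) * ENNReal.ofReal ((s - a) ^ (-q)) +
        ENNReal.ofReal (2 * τ ^ (-q)) * ENNReal.ofReal ((t - s) ^ (-p)) := by
    intro s hs
    -- On each half of the interval only one factor is singular; the other is at most twice its
    -- value at distance `τ`.
    rcases le_total (s - a) (τ / 2) with h | h
    · refine le_trans ?_ le_self_add
      gcongr
      refine le_trans ?_ (hhalf p hp hp1)
      exact Real.rpow_le_rpow_of_nonpos (by linarith) (by linarith) (by linarith)
    · refine le_trans ?_ le_add_self
      rw [mul_comm]
      gcongr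
      refine le_trans ?_ (hhalf q hq hq1)
      exact Real.rpow_le_rpow_of_nonpos (by linarith) h (by linarith)
  refine (setLIntegral_mono' measurableSet_Ioc hpt).trans ?_
  have hm1 : Measurable fun s : ℝ => ENNReal.ofReal (2 * τ ^ (-p)) * ENNReal.ofReal ((s - a) ^ (-q)) := by
    fun_prop
  rw [lintegral_add_left hm1, lintegral_const_mul' _ _ ENNReal.ofReal_ne_top,
    lintegral_const_mul' _ _ ENNReal.ofReal_ne_top, lintegral_rpow_sub_left hat hq1,
    lintegral_rpow_sub_right hat hp1, ← hτ, ← ENNReal.ofReal_mul (by positivity),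
    ← ENNReal.ofReal_mul (by positivity), ← ENNReal.ofReal_add]
  · refine ENNReal.ofReal_le_ofReal (le_of_eq ?_)
    have e1 : τ ^ (-p) * τ ^ (1 - q) = τ ^ (1 - p - q) := by
      rw [← Real.rpow_add hτ0]; congr 1; ring
    have e2 : τ ^ (-q) * τ ^ (1 - p) = τ ^ (1 - p - q) := by
      rw [← Real.rpow_add hτ0]; congr 1; ring
    rw [add_mul, ← e1]
    nth_rewrite 2 [e1]
    rw [← e2]
    ring
  · have : 0 < 1 - q := by linarith
    positivity
  · have : 0 < 1 - p := by linarith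
    positivity

/-- A bound that improves to itself up to halving the most singular term self-improves. -/
lemma le_of_halving {Y : ℝ → ℝ≥0∞} {u v : ℝ → ℝ} {S : Set ℝ} {M : ℝ} (hM : 0 ≤ M)
    (h0 : ∀ s ∈ S, Y s ≤ ENNReal.ofReal (u s + M * v s))
    (hstep : ∀ c, 0 ≤ c → (∀ s ∈ S, Y s ≤ ENNReal.ofReal (u s + c * v s)) →
      ∀ s ∈ S, Y s ≤ ENNReal.ofReal (u s + c / 2 * v s)) :
    ∀ s ∈ S, Y s ≤ ENNReal.ofReal (u s) := by
  have hn : ∀ n : ℕ, ∀ s ∈ S, Y s ≤ ENNReal.ofReal (u s + M / 2 ^ n * v s) := by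
    intro n
    induction n with
    | zero => simpa using h0
    | succ n ih =>
      have := hstep _ (by positivity) ih
      intro s hs
      convert this s hs using 3
      rw [pow_succ]
      field_simp
  intro s hs
  have hlim : Tendsto (fun n : ℕ => u s + M / 2 ^ n * v s) atTop (𝓝 (u s)) := by
    have h1 : Tendsto (fun n : ℕ => M / 2 ^ n) atTop (𝓝 0) :=
      tendsto_const_nhds.div_atTop (tendsto_pow_atTop_atTop_of_one_lt one_lt_two)
    simpa using (h1.mul_const (v s)).const_add (u s)
  exact ge_of_tendsto' (ENNReal.tendsto_ofReal hlim) fun n => hn n s hs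

end Time

/-! ### The Duhamel formula -/

section Duhamel

variable {d : ℕ}

/-- The symbol `e^{-ντ|k|⁴}` of the biharmonic propagator. -/
noncomputable def decay (ν τ : ℝ) (k : Fin d → ℤ) : ℝ := Real.exp (-(ν * τ * freqNorm k ^ 4))

lemma decay_nonneg (ν τ : ℝ) (k : Fin d → ℤ) : 0 ≤ decay ν τ k := Real.exp_nonneg _

lemma decay_le_one {ν τ : ℝ} (hν : 0 ≤ ν) (hτ : 0 ≤ τ) (k : Fin d → ℤ) : decay ν τ k ≤ 1 := by
  refine Real.exp_le_one_iff.mpr ?_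
  have := freqNorm_nonneg k
  have : 0 ≤ ν * τ * freqNorm k ^ 4 := by positivity
  linarith

lemma pow_mul_decay_le {ν τ : ℝ} (hν : 0 < ν) (hτ : 0 < τ) {n : ℕ} (hn : n ≤ 8) (k : Fin d → ℤ) :
    freqNorm k ^ n * decay ν τ k ≤ (ν * τ) ^ (-(n / 4) : ℝ) :=
  pow_mul_exp_neg_le (freqNorm_nonneg k) (mul_pos hν hτ) hn

lemma hnorm_decay_le {ν τ : ℝ} (hν : 0 < ν) (hτ : 0 < τ) {m b : ℕ} (hb : b ≤ 8)
    (x : (Fin d → ℤ) → ℝ) (hx : ∀ k, 0 ≤ x k) :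
    hnorm (m + b) (fun k => decay ν τ k * x k) ≤
      ENNReal.ofReal ((ν * τ) ^ (-(b / 4) : ℝ)) * hnorm m x := by
  rw [hnorm, hnorm, ← l2_const_mul]
  refine l2_mono fun k => ?_
  have hpos : 0 ≤ (ν * τ) ^ (-(b / 4) : ℝ) := Real.rpow_nonneg (mul_pos hν hτ).le _
  rw [← ENNReal.ofReal_mul hpos]
  refine ENNReal.ofReal_le_ofReal ?_
  have h := pow_mul_decay_le hν hτ hb k
  have h2 := pow_nonneg (freqNorm_nonneg k) m
  calc freqNorm k ^ (m + b) * (decay ν τ k * x k)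
      = (freqNorm k ^ b * decay ν τ k) * (freqNorm k ^ m * x k) := by ring
    _ ≤ _ := mul_le_mul_of_nonneg_right h (mul_nonneg h2 (hx k))

/-- Cauchy–Schwarz after writing `|k| x_k = |k|^{-1} (|k|² x_k)`. The squared symbol is bounded by
the symbol itself, so the lattice sum needs only a single exponential. -/
lemma anorm_decay_le {ν τ B : ℝ} (hντ : 0 < ν * τ) (x : (Fin d → ℤ) → ℝ)
    (hB : 0 ≤ B)
    (h : ∑' k : Fin d → ℤ, ENNReal.ofReal ((freqNorm k ^ 2)⁻¹ *
      Real.exp (-(ν * τ * freqNorm k ^ 4))) ≤ ENNReal.ofReal (B ^ 2)) :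
    anorm (fun k => decay ν τ k * x k) ≤ ENNReal.ofReal B * hnorm 2 x := by
  have h1 : l2 (fun k : Fin d → ℤ => ENNReal.ofReal ((freqNorm k)⁻¹ * decay ν τ k)) ≤
      ENNReal.ofReal B := by
    rw [l2_le_iff, ← ENNReal.ofReal_pow hB]
    refine le_trans (ENNReal.tsum_le_tsum fun k => ?_) h
    have hk := freqNorm_nonneg k
    have h0 := decay_nonneg ν τ k
    rw [← ENNReal.ofReal_pow (by positivity)]
    refine ENNReal.ofReal_le_ofReal ?_
    rw [mul_pow, inv_pow]
    refine mul_le_mul_of_nonneg_left ?_ (by positivity)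
    have hle : decay ν τ k ≤ 1 := Real.exp_le_one_iff.mpr (by
      have : 0 ≤ ν * τ * freqNorm k ^ 4 := by positivity
      linarith)
    rw [sq]
    exact mul_le_of_le_one_left h0 hle
  refine le_trans ?_ ((tsum_mul_le_l2_mul_l2 _ _).trans (mul_le_mul_left h1 _))
  refine ENNReal.tsum_le_tsum fun k => ?_
  have hk := freqNorm_nonneg k
  have h0 := decay_nonneg ν τ k
  rw [← ENNReal.ofReal_mul (by positivity)]
  refine ENNReal.ofReal_le_ofReal (le_of_eq ?_)
  by_cases hk0 : k = 0
  · simp [hk0]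
  · have := one_le_freqNorm hk0
    have : freqNorm k ≠ 0 := by linarith
    field_simp

/-- The Duhamel estimate in `H^{m+b}`. -/
theorem hnorm_duhamel_le {ν a t : ℝ} (hν : 0 < ν) {m b : ℕ} (hb : b ≤ 7)
    {D : (Fin d → ℤ) → ℂ} {f : ℝ → (Fin d → ℤ) → ℂ} {φ : ℝ → (Fin d → ℤ) → ℝ}
    (hφ : ∀ s k, 0 ≤ φ s k)
    (hf : ∀ k, AEStronglyMeasurable (fun s => f s k) (volume.restrict (Set.Ioc a t)))
    (hfφ : ∀ s ∈ Set.Ioc a t, ∀ k, ‖f s k‖ ≤ freqNorm k * φ s k)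
    (hD : ∀ k, ‖D k‖ₑ ≤ ∫⁻ s in Set.Ioc a t, ENNReal.ofReal (decay ν (t - s) k) * ‖f s k‖ₑ) :
    hnorm (m + b) (fun k => ‖D k‖) ≤
      ∫⁻ s in Set.Ioc a t, ENNReal.ofReal ((ν * (t - s)) ^ (-((b + 1) / 4) : ℝ)) *
        hnorm m (φ s) := by
  have h1 : hnorm (m + b) (fun k => ‖D k‖) ≤ l2 fun k => ∫⁻ s in Set.Ioc a t,
      ENNReal.ofReal (freqNorm k ^ (m + b)) * (ENNReal.ofReal (decay ν (t - s) k) * ‖f s k‖ₑ) := by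
    refine l2_mono fun k => ?_
    rw [lintegral_const_mul' _ _ ENNReal.ofReal_ne_top,
      ENNReal.ofReal_mul (pow_nonneg (freqNorm_nonneg k) _), ofReal_norm]
    gcongr
    exact hD k
  refine h1.trans ((l2_lintegral_le fun k => ?_).trans ?_)
  · refine AEMeasurable.const_mul (AEMeasurable.mul ?_ (hf k).enorm) _
    refine Measurable.aemeasurable ?_
    unfold decay
    fun_prop
  · have hIoo : ∀ᵐ s ∂(volume.restrict (Set.Ioc a t)), s ≠ t :=
      ae_restrict_of_ae (Measure.ae_ne volume t)
    have hmem : ∀ᵐ s ∂(volume.restrict (Set.Ioc a t)), s ∈ Set.Ioc a t :=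
      ae_restrict_mem measurableSet_Ioc
    refine lintegral_mono_ae ?_
    filter_upwards [hIoo, hmem] with s hs hs2
    have hts : 0 < t - s := sub_pos.mpr (lt_of_le_of_ne hs2.2 hs)
    rw [hnorm, ← l2_const_mul]
    refine l2_mono fun k => ?_
    have hk := freqNorm_nonneg k
    have h0 := decay_nonneg ν (t - s) k
    rw [← ofReal_norm, ← ENNReal.ofReal_mul h0, ← ENNReal.ofReal_mul (by positivity),
      ← ENNReal.ofReal_mul (Real.rpow_nonneg (mul_pos hν hts).le _)]
    refine ENNReal.ofReal_le_ofReal ?_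
    -- The propagator pays for the `b` derivatives gained and for the one lost to the divergence.
    have h2 := pow_mul_decay_le hν hts (n := b + 1) (by omega) k
    push_cast at h2
    have h3 := hφ s k
    calc freqNorm k ^ (m + b) * (decay ν (t - s) k * ‖f s k‖)
        ≤ freqNorm k ^ (m + b) * (decay ν (t - s) k * (freqNorm k * φ s k)) := by
          gcongr
          exact hfφ s hs2 k
      _ = (freqNorm k ^ (b + 1) * decay ν (t - s) k) * (freqNorm k ^ m * φ s k) := by ring
      _ ≤ _ := by gcongr

/-- The Duhamel estimate for the absolute sum. -/
theorem anorm_duhamel_le (hd : d ≤ 3) {ν a t : ℝ} (hν : 0 < ν) (hνt : ν * (t - a) ≤ 1)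
    {D : (Fin d → ℤ) → ℂ} {f : ℝ → (Fin d → ℤ) → ℂ} {φ : ℝ → (Fin d → ℤ) → ℝ}
    (hf : ∀ k, AEStronglyMeasurable (fun s => f s k) (volume.restrict (Set.Ioc a t)))
    (hfφ : ∀ s ∈ Set.Ioc a t, ∀ k, ‖f s k‖ ≤ freqNorm k * φ s k)
    (hD : ∀ k, ‖D k‖ₑ ≤ ∫⁻ s in Set.Ioc a t, ENNReal.ofReal (decay ν (t - s) k) * ‖f s k‖ₑ) :
    anorm (fun k => ‖D k‖) ≤
      ∫⁻ s in Set.Ioc a t, ENNReal.ofReal (19 * (ν * (t - s)) ^ (-(7 / 8) : ℝ)) *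
        hnorm 0 (φ s) := by
  have h1 : anorm (fun k => ‖D k‖) ≤ ∑' k, ∫⁻ s in Set.Ioc a t,
      ENNReal.ofReal (freqNorm k) * (ENNReal.ofReal (decay ν (t - s) k) * ‖f s k‖ₑ) := by
    refine ENNReal.tsum_le_tsum fun k => ?_
    rw [lintegral_const_mul' _ _ ENNReal.ofReal_ne_top,
      ENNReal.ofReal_mul (freqNorm_nonneg k), ofReal_norm]
    gcongr
    exact hD k
  rw [← lintegral_tsum] at h1
  · refine h1.trans ?_
    have hIoo : ∀ᵐ s ∂(volume.restrict (Set.Ioc a t)), s ≠ t :=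
      ae_restrict_of_ae (Measure.ae_ne volume t)
    have hmem : ∀ᵐ s ∂(volume.restrict (Set.Ioc a t)), s ∈ Set.Ioc a t :=
      ae_restrict_mem measurableSet_Ioc
    refine lintegral_mono_ae ?_
    filter_upwards [hIoo, hmem] with s hs hs2
    have hts : 0 < t - s := sub_pos.mpr (lt_of_le_of_ne hs2.2 hs)
    have hx : 0 < ν * (t - s) := mul_pos hν hts
    have hx1 : ν * (t - s) ≤ 1 := by nlinarith [hs2.1]
    -- One power of `|k|` comes from the gradient and one from the divergence. The exponent `7/8` is
    -- half of `7/4`, and `19² = 361 ≥ 343`.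
    have hl : l2 (fun k : Fin d → ℤ => ENNReal.ofReal (freqNorm k ^ 2 * decay ν (t - s) k)) ≤
        ENNReal.ofReal (19 * (ν * (t - s)) ^ (-(7 / 8) : ℝ)) := by
      rw [l2_le_iff]
      have h2 := tsum_pow_four_mul_exp_le hd hx hx1
      refine le_trans (le_of_eq (tsum_congr fun k => ?_)) (h2.trans ?_)
      · rw [← ENNReal.ofReal_pow (mul_nonneg (sq_nonneg _) (decay_nonneg _ _ _)), mul_pow, ← pow_mul,
          decay, ← Real.exp_nat_mul]
        congr 3
        push_cast
        ring
      · rw [← ENNReal.ofReal_pow (by positivity), mul_pow, ← Real.rpow_natCast _ 2,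
          ← Real.rpow_natCast _ 2, ← Real.rpow_mul hx.le]
        refine ENNReal.ofReal_le_ofReal ?_
        have h3 : (0 : ℝ) ≤ (ν * (t - s)) ^ (-(7 / 4) : ℝ) := Real.rpow_nonneg hx.le _
        norm_num at h3 ⊢
        nlinarith
    refine le_trans ?_ ((tsum_mul_le_l2_mul_l2 _ _).trans (mul_le_mul_left hl _))
    refine ENNReal.tsum_le_tsum fun k => ?_
    have hk := freqNorm_nonneg k
    have h0 := decay_nonneg ν (t - s) k
    rw [← ofReal_norm, ← ENNReal.ofReal_mul h0, ← ENNReal.ofReal_mul (by positivity),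
      ← ENNReal.ofReal_mul (by positivity)]
    refine ENNReal.ofReal_le_ofReal ?_
    calc freqNorm k * (decay ν (t - s) k * ‖f s k‖)
        ≤ freqNorm k * (decay ν (t - s) k * (freqNorm k * φ s k)) := by
          gcongr
          exact hfφ s hs2 k
      _ = _ := by ring
  · intro k
    refine AEMeasurable.const_mul (AEMeasurable.mul ?_ (hf k).enorm) _
    refine Measurable.aemeasurable ?_
    unfold decay
    fun_prop

end Duhamel

end ThinFilm

namespace ThinFilm

open scoped ComplexConjugate

/-! ### The flux as a map on continuous vector fields -/

section Flux

variable {d : ℕ}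

/-- The nonlinearity `v ↦ (|v|² - 1) v`. -/
noncomputable def fluxMap (d : ℕ) : C(Vec d, Vec d) where
  toFun v := (‖v‖ ^ 2 - 1) • v
  continuous_toFun := by fun_prop

/-- The flux of a continuous vector field. -/
noncomputable def fluxC (u : C(Torus d, Vec d)) : C(Torus d, Vec d) := (fluxMap d).comp u

lemma fluxC_apply (u : C(Torus d, Vec d)) (x : Torus d) :
    fluxC u x = (‖u x‖ ^ 2 - 1) • u x := rfl

lemma continuous_fluxC : Continuous (fluxC (d := d)) := ContinuousMap.continuous_postcomp _

lemma abs_sq_sub_one_le (r : ℝ) : |r ^ 2 - 1| ≤ 1 + r ^ 2 := by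
  rw [abs_le]; constructor <;> nlinarith [sq_nonneg r]

lemma norm_fluxC_apply_le (u : C(Torus d, Vec d)) (x : Torus d) :
    ‖fluxC u x‖ ≤ (1 + ‖u‖ ^ 2) * ‖u x‖ := by
  rw [fluxC_apply, norm_smul, Real.norm_eq_abs]
  gcongr
  refine (abs_sq_sub_one_le _).trans ?_
  gcongr
  exact u.norm_coe_le_norm x

lemma norm_fluxC_le (u : C(Torus d, Vec d)) : ‖fluxC u‖ ≤ (1 + ‖u‖ ^ 2) * ‖u‖ := by
  refine (ContinuousMap.norm_le _ (by positivity)).mpr fun x => ?_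
  refine (norm_fluxC_apply_le u x).trans ?_
  gcongr
  exact u.norm_coe_le_norm x

lemma norm_fluxMap_sub_le {v w : Vec d} {R : ℝ} (hv : ‖v‖ ≤ R) (hw : ‖w‖ ≤ R) :
    ‖fluxMap d v - fluxMap d w‖ ≤ 3 * (1 + R ^ 2) * ‖v - w‖ := by
  have e : fluxMap d v - fluxMap d w = (‖v‖ ^ 2 - 1) • (v - w) +
      ((‖v‖ - ‖w‖) * (‖v‖ + ‖w‖)) • w := by
    change (‖v‖ ^ 2 - 1) • v - (‖w‖ ^ 2 - 1) • w = _
    module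
  have h1 : |‖v‖ - ‖w‖| ≤ ‖v - w‖ := abs_norm_sub_norm_le v w
  have hR : 0 ≤ R := (norm_nonneg v).trans hv
  rw [e]
  refine (norm_add_le _ _).trans ?_
  rw [norm_smul, norm_smul, Real.norm_eq_abs, Real.norm_eq_abs, abs_mul,
    abs_of_nonneg (add_nonneg (norm_nonneg v) (norm_nonneg w))]
  have h2 : |‖v‖ ^ 2 - 1| ≤ 1 + R ^ 2 :=
    (abs_sq_sub_one_le _).trans (by gcongr)
  calc |‖v‖ ^ 2 - 1| * ‖v - w‖ + |‖v‖ - ‖w‖| * (‖v‖ + ‖w‖) * ‖w‖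
      ≤ (1 + R ^ 2) * ‖v - w‖ + ‖v - w‖ * (R + R) * R := by gcongr
    _ ≤ _ := by nlinarith [norm_nonneg (v - w)]

lemma norm_fluxC_sub_apply_le {u v : C(Torus d, Vec d)} {R : ℝ} (hu : ‖u‖ ≤ R) (hv : ‖v‖ ≤ R)
    (x : Torus d) : ‖fluxC u x - fluxC v x‖ ≤ 3 * (1 + R ^ 2) * ‖u x - v x‖ :=
  norm_fluxMap_sub_le ((u.norm_coe_le_norm x).trans hu) ((v.norm_coe_le_norm x).trans hv)

lemma hnorm_zero_vhat (u : C(Torus d, Vec d)) :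
    hnorm 0 (vhat u) = ENNReal.ofReal (Real.sqrt (vol d * ∫ x, ‖u x‖ ^ 2)) := by
  refine hnorm_eq_of_hasSum (vhat_nonneg _) ?_
  simpa using hasSum_vhat_sq (v := u) fun j => memLp_component u j 2

lemma integrable_norm_sq (u : C(Torus d, Vec d)) : Integrable (fun x => ‖u x‖ ^ 2) volume :=
  ContinuousMap.integrable_torus (⟨fun x => ‖u x‖ ^ 2, by fun_prop⟩ : C(Torus d, ℝ))

lemma hnorm_zero_vhat_le (u : C(Torus d, Vec d)) :
    hnorm 0 (vhat u) ≤ ENNReal.ofReal (vol d * ‖u‖) := by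
  rw [hnorm_zero_vhat]
  refine ENNReal.ofReal_le_ofReal (Real.sqrt_le_iff.mpr ⟨by have := vol_pos d; positivity, ?_⟩)
  have h : ∫ x, ‖u x‖ ^ 2 ≤ ∫ _x : Torus d, ‖u‖ ^ 2 :=
    integral_mono (integrable_norm_sq u) (integrable_const _) fun x =>
      pow_le_pow_left₀ (norm_nonneg _) (u.norm_coe_le_norm x) 2
  rw [integral_const, volume_real_univ, smul_eq_mul] at h
  have := mul_le_mul_of_nonneg_left h (vol_pos d).le
  nlinarith

lemma hnorm_zero_le_mul {u v : C(Torus d, Vec d)} {L : ℝ} (hL : 0 ≤ L)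
    (h : ∀ x, ‖v x‖ ≤ L * ‖u x‖) :
    hnorm 0 (vhat v) ≤ ENNReal.ofReal L * hnorm 0 (vhat u) := by
  rw [hnorm_zero_vhat, hnorm_zero_vhat, ← ENNReal.ofReal_mul hL]
  refine ENNReal.ofReal_le_ofReal ?_
  rw [← Real.sqrt_sq hL, ← Real.sqrt_mul (sq_nonneg L)]
  refine Real.sqrt_le_sqrt ?_
  rw [mul_left_comm]
  refine mul_le_mul_of_nonneg_left ?_ (vol_pos d).le
  rw [← integral_const_mul]
  refine integral_mono (integrable_norm_sq v) ((integrable_norm_sq u).const_mul _) fun x => ?_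
  simp only
  rw [← mul_pow]
  exact pow_le_pow_left₀ (norm_nonneg _) (h x) 2

lemma hnorm_zero_fluxC_le (u : C(Torus d, Vec d)) :
    hnorm 0 (vhat (fluxC u)) ≤ ENNReal.ofReal (1 + ‖u‖ ^ 2) * hnorm 0 (vhat u) :=
  hnorm_zero_le_mul (by positivity) (norm_fluxC_apply_le u)

/-- The flux is Lipschitz on balls, so the H¹ seminorm is estimated through translations. -/
lemma hnorm_one_fluxC_le {u : C(Torus d, Vec d)} (hu : hnorm 1 (vhat u) ≠ ⊤) :
    hnorm 1 (vhat (fluxC u)) ≤ ENNReal.ofReal (3 * (1 + ‖u‖ ^ 2)) * hnorm 1 (vhat u) := by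
  have hs := summable_of_hnorm_ne_top (vhat_nonneg u) hu
  obtain ⟨h1, h2⟩ := tsum_sq_vhat_le_of_lipschitz (u := u) (v := fluxC u)
    (fun x y => norm_fluxMap_sub_le (u.norm_coe_le_norm x) (u.norm_coe_le_norm y)) hs
  have hL : 0 ≤ 3 * (1 + ‖u‖ ^ 2) := by positivity
  rw [hnorm_eq_of_hasSum (n := 1) (vhat_nonneg _) h1.hasSum,
    hnorm_eq_of_hasSum (n := 1) (vhat_nonneg _) hs.hasSum, ← ENNReal.ofReal_mul hL]
  refine ENNReal.ofReal_le_ofReal ?_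
  rw [← Real.sqrt_sq hL, ← Real.sqrt_mul (sq_nonneg _)]
  exact Real.sqrt_le_sqrt h2

/-- The factor `|u|² - 1` stays in L², where the energy controls it, and only the remaining factor
`u` is taken in sup norm. The cubic flux thus becomes linear in `‖u‖`, which makes the absorption in
the smoothing argument possible. -/
lemma hnorm_zero_fluxC_le_energy (u : C(Torus d, Vec d)) :
    hnorm 0 (vhat (fluxC u)) ≤
      ENNReal.ofReal (Real.sqrt (vol d * ∫ x, (‖u x‖ ^ 2 - 1) ^ 2) * ‖u‖) := by
  rw [hnorm_zero_vhat]
  refine ENNReal.ofReal_le_ofReal ?_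
  rw [← Real.sqrt_sq (norm_nonneg u), ← Real.sqrt_mul' _ (sq_nonneg _)]
  refine Real.sqrt_le_sqrt ?_
  rw [mul_assoc, ← integral_mul_const]
  refine mul_le_mul_of_nonneg_left ?_ (vol_pos d).le
  refine integral_mono (integrable_norm_sq _) ?_ fun x => ?_
  · exact ContinuousMap.integrable_torus
      (⟨fun x => (‖u x‖ ^ 2 - 1) ^ 2 * ‖u‖ ^ 2, by fun_prop⟩ : C(Torus d, ℝ))
  · simp only
    rw [fluxC_apply, norm_smul, mul_pow, Real.norm_eq_abs, sq_abs]
    gcongr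
    exact u.norm_coe_le_norm x

/-- The Fourier coefficients of the divergence of the flux. -/
noncomputable def divFlux (u : C(Torus d, Vec d)) (k : Fin d → ℤ) : ℂ :=
  ∑ j, Complex.I * (k j : ℂ) * coeff (fun x => fluxC u x j) k

lemma norm_divFlux_le (u : C(Torus d, Vec d)) (k : Fin d → ℤ) :
    ‖divFlux u k‖ ≤ freqNorm k * vhat (fluxC u) k := norm_sum_mul_coeff_le _ k

lemma norm_coeff_component_le (u : C(Torus d, Vec d)) (j : Fin d) (k : Fin d → ℤ) :
    ‖coeff (fun x => u x j) k‖ ≤ vol d * ‖u‖ := by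
  refine norm_coeff_le_of_bound (ae_of_all _ fun x => ?_) k
  exact (PiLp.norm_apply_le (u x) j).trans (u.norm_coe_le_norm x)

lemma continuous_coeff_component (j : Fin d) (k : Fin d → ℤ) :
    Continuous fun u : C(Torus d, Vec d) => coeff (fun x => u x j) k := by
  refine (LipschitzWith.of_dist_le_mul (K := ⟨vol d, (vol_pos d).le⟩) fun u v => ?_).continuous
  rw [dist_eq_norm, dist_eq_norm, ← coeff_sub (integrable_component u j) (integrable_component v j)]
  exact norm_coeff_component_le (u - v) j k

lemma continuous_divFlux (k : Fin d → ℤ) : Continuous fun u : C(Torus d, Vec d) => divFlux u k :=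
  continuous_finsetSum _ fun j _ =>
    ((continuous_coeff_component j k).comp continuous_fluxC).const_mul _

lemma norm_divFlux_le_norm (u : C(Torus d, Vec d)) (k : Fin d → ℤ) :
    ‖divFlux u k‖ ≤ (∑ j, |(k j : ℝ)| * vol d) * ((1 + ‖u‖ ^ 2) * ‖u‖) := by
  rw [Finset.sum_mul]
  refine (norm_sum_le _ _).trans (Finset.sum_le_sum fun j _ => ?_)
  rw [norm_mul, norm_mul, Complex.norm_I, one_mul, Complex.norm_intCast, mul_assoc]
  refine mul_le_mul_of_nonneg_left ?_ (abs_nonneg _)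
  refine (norm_coeff_component_le _ j k).trans ?_
  exact mul_le_mul_of_nonneg_left (norm_fluxC_le u) (vol_pos d).le

end Flux

/-! ### Mild flows on the Fourier side -/

/-- A mild solution described by its Fourier coefficients `c` and its continuous gradient `g`. -/
structure MildFlow (d : ℕ) (ν : ℝ) (c : ℝ → (Fin d → ℤ) → ℂ) (g : ℝ → C(Torus d, Vec d)) :
    Prop where
  cont : ContinuousOn g (Set.Ioi 0)
  coeff_grad : ∀ t, 0 < t → ∀ j k, coeff (fun x => g t x j) k = Complex.I * (k j : ℂ) * c t k
  symm : ∀ t k, c t (-k) = conj (c t k)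
  mild : ∀ t, 0 ≤ t → ∀ k, c t k = (decay ν t k : ℂ) * c 0 k +
    ∫ s in (0 : ℝ)..t, (decay ν (t - s) k : ℂ) * divFlux (g s) k
  small : ∀ ε, 0 < ε → ∃ T, 0 < T ∧ ∀ t ∈ Set.Ioc 0 T, ‖g t‖ ≤ ε * t ^ (-(1 / 4) : ℝ)
  data : hnorm 2 (fun k => ‖c 0 k‖) ≠ ⊤

/-! ### From global solutions to mild flows. -/

section Extraction

variable {d : ℕ}

lemma summable_of_memSobolev {f : Torus d → ℝ} {s : ℝ} {n : ℕ} (hn : n ≠ 0) (hns : n ≤ 2 * s)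
    (hf : MemSobolev s f) : Summable fun k => freqNorm k ^ n * ‖coeff f k‖ ^ 2 := by
  have h := hf.2
  rw [sobolevNorm, ENNReal.rpow_lt_top_iff_of_pos (by norm_num)] at h
  have hpos : ∀ k : Fin d → ℤ, 0 ≤ (1 + freqNorm k ^ (2 * s)) * ‖coeff f k‖ ^ 2 := fun k =>
    mul_nonneg (add_nonneg zero_le_one (Real.rpow_nonneg (freqNorm_nonneg k) _)) (sq_nonneg _)
  have hs : Summable fun k => (1 + freqNorm k ^ (2 * s)) * ‖coeff f k‖ ^ 2 :=
    (ENNReal.summable_toReal h.ne).congr fun k => ENNReal.toReal_ofReal (hpos k)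
  refine Summable.of_nonneg_of_le (fun k => ?_) (fun k => ?_) hs
  · have := freqNorm_nonneg k
    positivity
  · refine mul_le_mul_of_nonneg_right ?_ (sq_nonneg _)
    by_cases hk : k = 0
    · subst hk
      rw [freqNorm_zero, zero_pow hn]
      have := Real.rpow_nonneg (le_refl (0 : ℝ)) (2 * s)
      linarith
    · have := Real.rpow_le_rpow_of_exponent_le (one_le_freqNorm hk) hns
      rw [Real.rpow_natCast] at this
      linarith

lemma flux_ae_eq {f : Torus d → ℝ} {u : C(Torus d, Vec d)} (h : grad f =ᵐ[volume] u) :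
    flux f =ᵐ[volume] fluxC u := by
  filter_upwards [h] with x hx
  rw [flux, hx, fluxC_apply]

/-- A global solution in the sense of the paper is a mild flow. -/
theorem IsGlobalSolution.exists_mildFlow {ν : ℝ} {h₀ : Torus d → ℝ} {h : ℝ → Torus d → ℝ}
    (hh₀ : MemSobolev 2 h₀) (sol : IsGlobalSolution ν h₀ h) :
    ∃ g : ℝ → C(Torus d, Vec d), MildFlow d ν (fun t => coeff (h t)) g ∧
      ∀ t, 0 < t → grad (h t) =ᵐ[volume] g t := by
  obtain ⟨G, hG, hGg⟩ := sol.cont_grad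
  have hpow : ∀ t : ℝ, 0 < t → t ^ (-(1 / 4) : ℝ) * t ^ (1 / 4 : ℝ) = 1 := fun t ht => by
    rw [← Real.rpow_add ht]; norm_num
  have hgrad : ∀ t, 0 < t → grad (h t) =ᵐ[volume] (t ^ (-(1 / 4) : ℝ) • G t : C(Torus d, Vec d)) := by
    intro t ht
    filter_upwards [hGg t ht.le] with x hx
    rw [ContinuousMap.smul_apply, ← hx, smul_smul, hpow t ht, one_smul]
  have hcoeff0 : ∀ k, coeff (h 0) k = coeff h₀ k := coeff_congr_ae sol.initial
  refine ⟨fun t => t ^ (-(1 / 4) : ℝ) • G t, ⟨?_, ?_, fun t k => coeff_neg _ _, ?_, ?_, ?_⟩, hgrad⟩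
  · have h1 : ContinuousOn (fun t : ℝ => t ^ (-(1 / 4) : ℝ)) (Set.Ioi 0) := fun t ht =>
      (Real.continuousAt_rpow_const t _ (Or.inl (ne_of_gt ht))).continuousWithinAt
    exact h1.smul (hG.mono Set.Ioi_subset_Ici_self)
  · intro t ht j k
    -- The weighted solution lies in `H^{d/2+1}`, which contains at least one derivative; at
    -- positive times the weight can be divided out.
    have hs : Summable fun k => freqNorm k ^ 2 * ‖coeff (h t) k‖ ^ 2 := by
      have h1 := summable_of_memSobolev (n := 2) (by norm_num)
        (by push_cast; linarith [Nat.cast_nonneg (α := ℝ) d]) (sol.cont_weighted t ht.le).1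
      have h2 : 0 < t ^ (1 / 4 : ℝ) := Real.rpow_pos_of_pos ht _
      simp only [coeff_const_mul, norm_mul, Complex.norm_real, Real.norm_eq_abs, abs_of_pos h2,
        mul_pow] at h1
      have h3 := h1.mul_left ((t ^ (1 / 4 : ℝ)) ^ 2)⁻¹
      refine h3.congr fun k => ?_
      field_simp
    rw [← (memLp_grad_component hs j).2 k]
    refine coeff_congr_ae ?_ k
    filter_upwards [hgrad t ht] with x hx
    rw [hx]
  · intro t ht k
    rw [sol.mild t ht k, hcoeff0]
    congr 1
    rw [intervalIntegral.integral_of_le ht, intervalIntegral.integral_of_le ht]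
    refine setIntegral_congr_fun measurableSet_Ioc fun s hs => ?_
    simp only [decay, divFlux]
    congr 1
    refine Finset.sum_congr rfl fun j _ => ?_
    congr 1
    refine coeff_congr_ae ?_ k
    filter_upwards [flux_ae_eq (hgrad s hs.1)] with x hx
    rw [hx]
  · intro ε hε
    -- The weight `0^{1/4}` vanishes, so continuity of `G` at zero says that `t^{1/4} ‖g t‖` tends
    -- to zero and is not merely bounded.
    have hG0 : G 0 = 0 := by
      have h1 := hGg 0 le_rfl
      have h2 : (fun _ : Torus d => (0 : Vec d)) =ᵐ[volume] G 0 := by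
        filter_upwards [h1] with x hx
        rw [← hx, Real.zero_rpow (by norm_num), zero_smul]
      have h3 := Continuous.ae_eq_iff_eq volume continuous_const (G 0).continuous |>.mp h2
      ext x : 1
      exact (congrFun h3 x).symm
    have h1 := hG 0 (Set.mem_Ici.mpr le_rfl)
    have h2 := h1.norm
    rw [ContinuousWithinAt, hG0, norm_zero] at h2
    have h3 := h2.eventually (gt_mem_nhds hε)
    rw [eventually_nhdsWithin_iff, Metric.eventually_nhds_iff] at h3
    obtain ⟨r, hr, h4⟩ := h3
    refine ⟨r / 2, by linarith, fun t ht => ?_⟩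
    have h5 := h4 (y := t) (by rw [Real.dist_eq, sub_zero, abs_of_pos ht.1]; linarith [ht.2])
      ht.1.le
    have h6 := Real.rpow_nonneg ht.1.le (-(1 / 4) : ℝ)
    rw [norm_smul, Real.norm_eq_abs, abs_of_nonneg h6, mul_comm]
    exact mul_le_mul_of_nonneg_right h5.le h6
  · have hs := summable_of_memSobolev (n := 4) (by norm_num) (by norm_num) hh₀
    simp only [hcoeff0]
    rw [hnorm_eq_of_hasSum (n := 2) (fun k => norm_nonneg _) hs.hasSum]
    exact ENNReal.ofReal_ne_top

end Extraction

/-! ### Duhamel's formula for a mild flow, restarted at any time. -/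

namespace MildFlow

variable {d : ℕ} {ν : ℝ} {c : ℝ → (Fin d → ℤ) → ℂ} {g : ℝ → C(Torus d, Vec d)}

lemma vhat_grad (F : MildFlow d ν c g) {t : ℝ} (ht : 0 < t) (k : Fin d → ℤ) :
    vhat (g t) k = freqNorm k * ‖c t k‖ := vhat_eq_of_coeff fun j => F.coeff_grad t ht j k

lemma hnorm_vhat_grad (F : MildFlow d ν c g) {t : ℝ} (ht : 0 < t) (n : ℕ) :
    hnorm n (vhat (g t)) = hnorm (n + 1) fun k => ‖c t k‖ := by
  refine congrArg l2 (funext fun k => ?_)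
  rw [F.vhat_grad ht]
  congr 1
  ring

/-- A weighted bound on every bounded time interval. -/
lemma exists_bound (F : MildFlow d ν c g) (T : ℝ) :
    ∃ M, 0 ≤ M ∧ ∀ t ∈ Set.Ioc 0 T, ‖g t‖ ≤ M * t ^ (-(1 / 4) : ℝ) := by
  obtain ⟨T₀, hT₀, h0⟩ := F.small 1 one_pos
  obtain ⟨M, hM⟩ := isCompact_Icc.exists_bound_of_continuousOn
    (F.cont.mono fun t (ht : t ∈ Set.Icc T₀ T) => hT₀.trans_le ht.1)
  refine ⟨max 1 (max M 0 * (max T 0) ^ (1 / 4 : ℝ)), le_max_of_le_left zero_le_one, fun t ht => ?_⟩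
  have hp := Real.rpow_pos_of_pos ht.1 (-(1 / 4) : ℝ)
  rcases le_total t T₀ with h | h
  · exact (h0 t ⟨ht.1, h⟩).trans (mul_le_mul_of_nonneg_right (le_max_left _ _) hp.le)
  · refine le_trans ?_ (mul_le_mul_of_nonneg_right (le_max_right _ _) hp.le)
    have h1 : 1 ≤ (max T 0) ^ (1 / 4 : ℝ) * t ^ (-(1 / 4) : ℝ) := by
      calc (1 : ℝ) = t ^ (1 / 4 : ℝ) * t ^ (-(1 / 4) : ℝ) := by
            rw [← Real.rpow_add ht.1]; norm_num
        _ ≤ _ := by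
          gcongr
          · exact ht.1.le
          · exact ht.2.trans (le_max_left _ _)
    calc ‖g t‖ ≤ max M 0 := (hM t ⟨h, ht.2⟩).trans (le_max_left _ _)
      _ ≤ max M 0 * ((max T 0) ^ (1 / 4 : ℝ) * t ^ (-(1 / 4) : ℝ)) :=
          le_mul_of_one_le_right (le_max_right _ _) h1
      _ = _ := by ring

lemma continuousOn_divFlux (F : MildFlow d ν c g) (k : Fin d → ℤ) :
    ContinuousOn (fun s => divFlux (g s) k) (Set.Ioi 0) :=
  (continuous_divFlux k).comp_continuousOn F.cont

lemma continuous_decay (t : ℝ) (k : Fin d → ℤ) :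
    Continuous fun s => (decay ν (t - s) k : ℂ) := by
  unfold decay
  fun_prop

/-- With `‖g s‖ ≲ s^{-1/4}` the cubic flux is at most of order `s^{-3/4}`, which is integrable at
zero; the linear term is absorbed through `1 ≤ (t/s)^{1/2}`. -/
lemma intervalIntegrable_divFlux (F : MildFlow d ν c g) (k : Fin d → ℤ) {a t : ℝ} (ha : 0 ≤ a)
    (hat : a ≤ t) : IntervalIntegrable (fun s => divFlux (g s) k) volume a t := by
  obtain ⟨M, hM, hb⟩ := F.exists_bound t
  have h34 : IntervalIntegrable (fun s : ℝ => s ^ (-(3 / 4) : ℝ)) volume a t :=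
    intervalIntegral.intervalIntegrable_rpow' (by norm_num)
  have hsub : Set.Ioc a t ⊆ Set.Ioi 0 := fun s hs => ha.trans_lt hs.1
  rw [intervalIntegrable_iff_integrableOn_Ioc_of_le hat] at h34 ⊢
  set C := ∑ j, |(k j : ℝ)| * vol d with hC
  have hC0 : 0 ≤ C := Finset.sum_nonneg fun j _ => mul_nonneg (abs_nonneg _) (vol_pos d).le
  refine Integrable.mono' (h34.const_mul (C * ((t ^ (1 / 2 : ℝ) + M ^ 2) * M)))
    (((F.continuousOn_divFlux k).mono hsub).aestronglyMeasurable measurableSet_Ioc) ?_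
  refine (ae_restrict_iff' measurableSet_Ioc).mpr (ae_of_all _ fun s hs => ?_)
  have hs0 : 0 < s := hsub hs
  refine (norm_divFlux_le_norm _ k).trans ?_
  rw [mul_assoc]
  refine mul_le_mul_of_nonneg_left ?_ hC0
  have h1 := hb s ⟨hs0, hs.2⟩
  have hp := Real.rpow_pos_of_pos hs0 (-(1 / 4) : ℝ)
  have e2 : (s ^ (-(1 / 4) : ℝ)) ^ 2 = s ^ (-(1 / 2) : ℝ) := by
    rw [← Real.rpow_natCast, ← Real.rpow_mul hs0.le]; norm_num
  have e3 : s ^ (-(3 / 4) : ℝ) = s ^ (-(1 / 2) : ℝ) * s ^ (-(1 / 4) : ℝ) := by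
    rw [← Real.rpow_add hs0]; norm_num
  have h2 : 1 ≤ t ^ (1 / 2 : ℝ) * s ^ (-(1 / 2) : ℝ) := by
    calc (1 : ℝ) = s ^ (1 / 2 : ℝ) * s ^ (-(1 / 2) : ℝ) := by
          rw [← Real.rpow_add hs0]; norm_num
      _ ≤ _ := by
        gcongr
        exact hs.2
  calc (1 + ‖g s‖ ^ 2) * ‖g s‖
      ≤ (t ^ (1 / 2 : ℝ) * s ^ (-(1 / 2) : ℝ) + (M * s ^ (-(1 / 4) : ℝ)) ^ 2) *
        (M * s ^ (-(1 / 4) : ℝ)) := by gcongr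
    _ = (t ^ (1 / 2 : ℝ) + M ^ 2) * M * s ^ (-(3 / 4) : ℝ) := by
        rw [mul_pow, e2, e3]; ring

lemma intervalIntegrable_integrand (F : MildFlow d ν c g) (k : Fin d → ℤ) (r : ℝ) {a t : ℝ}
    (ha : 0 ≤ a) (hat : a ≤ t) :
    IntervalIntegrable (fun s => (decay ν (r - s) k : ℂ) * divFlux (g s) k) volume a t :=
  (F.intervalIntegrable_divFlux k ha hat).continuousOn_mul (continuous_decay r k).continuousOn

lemma decay_add (s t : ℝ) (k : Fin d → ℤ) : decay ν (s + t) k = decay ν s k * decay ν t k := by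
  rw [decay, decay, decay, ← Real.exp_add]
  congr 1
  ring

/-- The mild formulation restarted at a later time. -/
lemma restart (F : MildFlow d ν c g) {a t : ℝ} (ha : 0 ≤ a) (hat : a ≤ t) (k : Fin d → ℤ) :
    c t k = (decay ν (t - a) k : ℂ) * c a k +
      ∫ s in a..t, (decay ν (t - s) k : ℂ) * divFlux (g s) k := by
  have h1 := F.mild t (ha.trans hat) k
  rw [← intervalIntegral.integral_add_adjacent_intervals
    (F.intervalIntegrable_integrand k t le_rfl ha) (F.intervalIntegrable_integrand k t ha hat)] at h1
  have h2 : ∫ s in (0 : ℝ)..a, (decay ν (t - s) k : ℂ) * divFlux (g s) k =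
      (decay ν (t - a) k : ℂ) * ∫ s in (0 : ℝ)..a, (decay ν (a - s) k : ℂ) * divFlux (g s) k := by
    rw [← intervalIntegral.integral_const_mul]
    refine intervalIntegral.integral_congr fun s _ => ?_
    rw [show t - s = (t - a) + (a - s) by ring, decay_add]
    push_cast
    ring
  have h3 : decay ν t k = decay ν (t - a) k * decay ν a k := by
    rw [← decay_add]; congr 1; ring
  rw [h1, h2, F.mild a ha k, h3]
  push_cast
  ring

/-- The Duhamel part of the flow started at time `a`. -/
noncomputable def duh (ν : ℝ) (c : ℝ → (Fin d → ℤ) → ℂ) (a t : ℝ) (k : Fin d → ℤ) : ℂ :=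
  c t k - (decay ν (t - a) k : ℂ) * c a k

lemma enorm_duh_le (F : MildFlow d ν c g) {a t : ℝ} (ha : 0 ≤ a) (hat : a ≤ t) (k : Fin d → ℤ) :
    ‖duh ν c a t k‖ₑ ≤
      ∫⁻ s in Set.Ioc a t, ENNReal.ofReal (decay ν (t - s) k) * ‖divFlux (g s) k‖ₑ := by
  have h : duh ν c a t k = ∫ s in a..t, (decay ν (t - s) k : ℂ) * divFlux (g s) k := by
    rw [duh, F.restart ha hat k]
    ring
  rw [h, intervalIntegral.integral_of_le hat]
  refine (enorm_integral_le_lintegral_enorm _).trans (le_of_eq ?_)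
  refine lintegral_congr fun s => ?_
  rw [enorm_mul, ← ofReal_norm, Complex.norm_real, Real.norm_eq_abs, abs_of_nonneg (decay_nonneg _ _ _)]

lemma norm_le_decay_add_duh (a t : ℝ) (k : Fin d → ℤ) :
    ‖c t k‖ ≤ decay ν (t - a) k * ‖c a k‖ + ‖duh ν c a t k‖ := by
  have h : c t k = (decay ν (t - a) k : ℂ) * c a k + duh ν c a t k := by rw [duh]; ring
  calc ‖c t k‖ ≤ ‖(decay ν (t - a) k : ℂ) * c a k‖ + ‖duh ν c a t k‖ := by
        conv_lhs => rw [h]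
        exact norm_add_le _ _
    _ = _ := by
        rw [norm_mul, Complex.norm_real, Real.norm_eq_abs, abs_of_nonneg (decay_nonneg _ _ _)]

lemma aestronglyMeasurable_divFlux (F : MildFlow d ν c g) {a : ℝ} (ha : 0 ≤ a) (t : ℝ)
    (k : Fin d → ℤ) :
    AEStronglyMeasurable (fun s => divFlux (g s) k) (volume.restrict (Set.Ioc a t)) :=
  ((F.continuousOn_divFlux k).mono fun _ hs => ha.trans_lt hs.1).aestronglyMeasurable
    measurableSet_Ioc

lemma hnorm_duh_le (F : MildFlow d ν c g) (hν : 0 < ν) {a t : ℝ} (ha : 0 ≤ a) (hat : a ≤ t)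
    {b : ℕ} (hb : b ≤ 7) (m : ℕ) :
    hnorm (m + b) (fun k => ‖duh ν c a t k‖) ≤
      ∫⁻ s in Set.Ioc a t, ENNReal.ofReal ((ν * (t - s)) ^ (-((b + 1) / 4) : ℝ)) *
        hnorm m (vhat (fluxC (g s))) :=
  hnorm_duhamel_le hν hb (fun _ k => vhat_nonneg _ k) (F.aestronglyMeasurable_divFlux ha t)
    (fun s _ k => norm_divFlux_le (g s) k) (F.enorm_duh_le ha hat)

lemma anorm_duh_le (F : MildFlow d ν c g) (hd : d ≤ 3) (hν : 0 < ν) {a t : ℝ} (ha : 0 ≤ a)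
    (hat : a ≤ t) (hνt : ν * (t - a) ≤ 1) :
    anorm (fun k => ‖duh ν c a t k‖) ≤
      ∫⁻ s in Set.Ioc a t, ENNReal.ofReal (19 * (ν * (t - s)) ^ (-(7 / 8) : ℝ)) *
        hnorm 0 (vhat (fluxC (g s))) :=
  anorm_duhamel_le hd hν hνt (F.aestronglyMeasurable_divFlux ha t)
    (fun s _ k => norm_divFlux_le (g s) k) (F.enorm_duh_le ha hat)

end MildFlow

end ThinFilm

namespace ThinFilm

/-! ### Smoothing and persistence of regularity -/

lemma lintegral_kernel_le {ν a t p q B : ℝ} (hν : 0 < ν) (hat : a < t) (hp : 0 ≤ p) (hp1 : p < 1)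
    (hq : 0 ≤ q) (hq1 : q < 1) (hB : 0 ≤ B) :
    ∫⁻ s in Set.Ioc a t, ENNReal.ofReal ((ν * (t - s)) ^ (-p)) *
        ENNReal.ofReal (B * (s - a) ^ (-q)) ≤
      ENNReal.ofReal (ν ^ (-p) * B * (2 / (1 - q) + 2 / (1 - p)) * (t - a) ^ (1 - p - q)) := by
  have h := lintegral_rpow_mul_rpow_le hat hp hp1 hq hq1
  have hC : 0 ≤ ν ^ (-p) * B := mul_nonneg (Real.rpow_nonneg hν.le _) hB
  calc _ = ∫⁻ s in Set.Ioc a t, ENNReal.ofReal (ν ^ (-p) * B) *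
        (ENNReal.ofReal ((t - s) ^ (-p)) * ENNReal.ofReal ((s - a) ^ (-q))) := by
        refine setLIntegral_congr_fun measurableSet_Ioc fun s hs => ?_
        have h1 : 0 ≤ t - s := sub_nonneg.mpr hs.2
        rw [Real.mul_rpow hν.le h1, ENNReal.ofReal_mul (Real.rpow_nonneg hν.le _),
          ENNReal.ofReal_mul hB, ENNReal.ofReal_mul (Real.rpow_nonneg hν.le _)]
        ring
    _ ≤ _ := by
        rw [lintegral_const_mul' _ _ ENNReal.ofReal_ne_top]
        refine (mul_le_mul_right h _).trans ?_
        rw [← ENNReal.ofReal_mul hC]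
        exact ENNReal.ofReal_le_ofReal (le_of_eq (by ring))

section

variable {d : ℕ}

lemma hnorm_le_of_le {m n : ℕ} (hm : m ≠ 0) (hmn : m ≤ n) {x : (Fin d → ℤ) → ℝ}
    (hx : ∀ k, 0 ≤ x k) : hnorm m x ≤ hnorm n x :=
  l2_mono fun k => ENNReal.ofReal_le_ofReal
    (mul_le_mul_of_nonneg_right (freqNorm_pow_le_pow hm hmn k) (hx k))

lemma hnorm_decay_le_self {ν τ : ℝ} (hν : 0 ≤ ν) (hτ : 0 ≤ τ) (n : ℕ) {x : (Fin d → ℤ) → ℝ}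
    (hx : ∀ k, 0 ≤ x k) : hnorm n (fun k => decay ν τ k * x k) ≤ hnorm n x :=
  hnorm_mono fun k => mul_le_of_le_one_left (hx k) (decay_le_one hν hτ k)

end

namespace MildFlow

variable {d : ℕ} {ν : ℝ} {c : ℝ → (Fin d → ℤ) → ℂ} {g : ℝ → C(Torus d, Vec d)}

/-- The Sobolev seminorm of the flow at a given time. -/
noncomputable def sob (c : ℝ → (Fin d → ℤ) → ℂ) (n : ℕ) (t : ℝ) : ℝ≥0∞ := hnorm n fun k => ‖c t k‖

lemma sob_le_add (n : ℕ) (a t : ℝ) :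
    sob c n t ≤ hnorm n (fun k => decay ν (t - a) k * ‖c a k‖) +
      hnorm n (fun k => ‖duh ν c a t k‖) :=
  (hnorm_mono fun k => norm_le_decay_add_duh a t k).trans
    (hnorm_add_le n (fun _ => mul_nonneg (decay_nonneg _ _ _) (norm_nonneg _))
      fun _ => norm_nonneg _)

/-- The nonlinear coefficient `1 + ‖g‖²` is critical of order `t^{-1/2}`, but its constant can be
made as small as desired near time zero. This smallness closes the estimates without any bound on
the size of the datum. -/
lemma exists_one_add_sq_le (F : MildFlow d ν c g) {κ : ℝ} (hκ : 0 < κ) :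
    ∃ T, 0 < T ∧ T ≤ 1 ∧ ∀ t ∈ Set.Ioc 0 T, 1 + ‖g t‖ ^ 2 ≤ κ * t ^ (-(1 / 2) : ℝ) := by
  obtain ⟨T₀, hT₀, h⟩ := F.small (Real.sqrt (κ / 2)) (Real.sqrt_pos.mpr (by linarith))
  refine ⟨min T₀ (min 1 ((κ / 2) ^ 2)), by positivity, (min_le_right _ _).trans (min_le_left _ _),
    fun t ht => ?_⟩
  have ht0 := ht.1
  have h1 := h t ⟨ht.1, ht.2.trans (min_le_left _ _)⟩
  have h2 : t ≤ (κ / 2) ^ 2 := ht.2.trans ((min_le_right _ _).trans (min_le_right _ _))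
  have e2 : (t ^ (-(1 / 4) : ℝ)) ^ 2 = t ^ (-(1 / 2) : ℝ) := by
    rw [← Real.rpow_natCast, ← Real.rpow_mul ht0.le]; norm_num
  have h3 : ‖g t‖ ^ 2 ≤ κ / 2 * t ^ (-(1 / 2) : ℝ) := by
    calc ‖g t‖ ^ 2 ≤ (Real.sqrt (κ / 2) * t ^ (-(1 / 4) : ℝ)) ^ 2 :=
          pow_le_pow_left₀ (norm_nonneg _) h1 2
      _ = _ := by rw [mul_pow, Real.sq_sqrt (by linarith), e2]
  have h4 : 1 ≤ κ / 2 * t ^ (-(1 / 2) : ℝ) := by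
    calc (1 : ℝ) = t ^ (1 / 2 : ℝ) * t ^ (-(1 / 2) : ℝ) := by
          rw [← Real.rpow_add ht0]; norm_num
      _ ≤ κ / 2 * t ^ (-(1 / 2) : ℝ) := by
        refine mul_le_mul_of_nonneg_right ?_ (Real.rpow_nonneg ht0.le _)
        rw [← Real.sqrt_eq_rpow]
        exact Real.sqrt_le_iff.mpr ⟨by linarith, h2⟩
  linarith

/-- Persistence of `H^{m+1}` regularity near the initial time. -/
lemma sob_le_of_rough_bound (F : MildFlow d ν c g) (hν : 0 < ν) {m : ℕ} {T A M κ : ℝ}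
    (hA : 0 ≤ A) (hM : 0 ≤ M) (hκ : 0 ≤ κ) (hκν : ν ^ (-(1 / 2) : ℝ) * κ ≤ 1 / 32)
    (h0 : sob c (m + 1) 0 ≤ ENNReal.ofReal A)
    (hflux : ∀ s ∈ Set.Ioc 0 T, hnorm m (vhat (fluxC (g s))) ≤
      ENNReal.ofReal (κ * s ^ (-(1 / 2) : ℝ)) * sob c (m + 1) s)
    (hrough : ∀ s ∈ Set.Ioc 0 T, sob c (m + 1) s ≤ ENNReal.ofReal (M * s ^ (-(1 / 4) : ℝ))) :
    ∀ s ∈ Set.Ioc 0 T, sob c (m + 1) s ≤ ENNReal.ofReal (2 * A) := by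
  -- The kernel `(t-s)^{-1/2}` against the flux weight `s^{-1/2}` preserves both a constant bound
  -- and a bound of order `s^{-1/4}`, so the singular term can be iterated away.
  refine le_of_halving (u := fun _ => 2 * A) (v := fun s => s ^ (-(1 / 4) : ℝ)) hM ?_ ?_
  · intro s hs
    refine (hrough s hs).trans (ENNReal.ofReal_le_ofReal ?_)
    linarith
  · intro b hb ih t ht
    have hp : (-((((1 : ℕ) : ℝ) + 1) / 4)) = -(1 / 2 : ℝ) := by norm_num
    have hduh := F.hnorm_duh_le hν le_rfl ht.1.le (b := 1) (by norm_num) m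
    rw [hp] at hduh
    have hpt : ∀ s ∈ Set.Ioc 0 t, ENNReal.ofReal ((ν * (t - s)) ^ (-(1 / 2) : ℝ)) *
        hnorm m (vhat (fluxC (g s))) ≤
        ENNReal.ofReal ((ν * (t - s)) ^ (-(1 / 2) : ℝ)) *
          ENNReal.ofReal (κ * (2 * A) * (s - 0) ^ (-(1 / 2) : ℝ)) +
        ENNReal.ofReal ((ν * (t - s)) ^ (-(1 / 2) : ℝ)) *
          ENNReal.ofReal (κ * b * (s - 0) ^ (-(3 / 4) : ℝ)) := by
      intro s hs
      have hsT : s ∈ Set.Ioc 0 T := ⟨hs.1, hs.2.trans ht.2⟩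
      rw [← mul_add, sub_zero]
      refine mul_le_mul_right ((hflux s hsT).trans ((mul_le_mul_right (ih s hsT) _).trans ?_)) _
      have h1 := Real.rpow_pos_of_pos hs.1 (-(1 / 2) : ℝ)
      have h2 := Real.rpow_pos_of_pos hs.1 (-(3 / 4) : ℝ)
      rw [← ENNReal.ofReal_mul (by positivity), ← ENNReal.ofReal_add (by positivity) (by positivity)]
      refine ENNReal.ofReal_le_ofReal (le_of_eq ?_)
      have e : s ^ (-(3 / 4) : ℝ) = s ^ (-(1 / 2) : ℝ) * s ^ (-(1 / 4) : ℝ) := by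
        rw [← Real.rpow_add hs.1]; norm_num
      rw [e]
      ring
    have hint := setLIntegral_mono' (μ := volume) measurableSet_Ioc hpt
    rw [lintegral_add_left (by fun_prop)] at hint
    have i1 := lintegral_kernel_le hν ht.1 (p := 1 / 2) (q := 1 / 2) (by norm_num) (by norm_num)
      (by norm_num) (by norm_num) (B := κ * (2 * A)) (by positivity)
    have i2 := lintegral_kernel_le hν ht.1 (p := 1 / 2) (q := 3 / 4) (by norm_num) (by norm_num)
      (by norm_num) (by norm_num) (B := κ * b) (by positivity)
    have hlin : hnorm (m + 1) (fun k => decay ν (t - 0) k * ‖c 0 k‖) ≤ ENNReal.ofReal A :=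
      (hnorm_decay_le_self hν.le (by linarith [ht.1]) _ fun k => norm_nonneg _).trans h0
    refine (sob_le_add (ν := ν) (m + 1) 0 t).trans ((add_le_add hlin
      (hduh.trans (hint.trans (add_le_add i1 i2)))).trans ?_)
    have hνp := Real.rpow_pos_of_pos hν (-(1 / 2) : ℝ)
    rw [sub_zero]
    have e0 : t ^ (1 - 1 / 2 - 1 / 2 : ℝ) = 1 := by norm_num
    have e1 : t ^ (1 - 1 / 2 - 3 / 4 : ℝ) = t ^ (-(1 / 4) : ℝ) := by norm_num
    have htp := Real.rpow_pos_of_pos ht.1 (-(1 / 4) : ℝ)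
    rw [e0, e1, ← ENNReal.ofReal_add (by norm_num; positivity) (by norm_num; positivity),
      ← ENNReal.ofReal_add hA (by norm_num; positivity)]
    refine ENNReal.ofReal_le_ofReal ?_
    -- The two time integrals have constants `8` and `12`. With the factor `1/32` they give `A/2`
    -- and `3b/8`, below the permitted `A` and `b/2`.
    have h3 : ν ^ (-(1 / 2) : ℝ) * (κ * (2 * A)) * (2 / (1 - 1 / 2) + 2 / (1 - 1 / 2)) * 1 ≤ A := by
      have := mul_le_mul_of_nonneg_right hκν hA
      nlinarith
    have h4 : ν ^ (-(1 / 2) : ℝ) * (κ * b) * (2 / (1 - 3 / 4) + 2 / (1 - 1 / 2)) *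
        t ^ (-(1 / 4) : ℝ) ≤ b / 2 * t ^ (-(1 / 4) : ℝ) := by
      refine mul_le_mul_of_nonneg_right ?_ htp.le
      have := mul_le_mul_of_nonneg_right hκν hb
      nlinarith
    linarith

lemma hnorm_zero_flux_le (F : MildFlow d ν c g) {s : ℝ} (hs : 0 < s) :
    hnorm 0 (vhat (fluxC (g s))) ≤ ENNReal.ofReal (1 + ‖g s‖ ^ 2) * sob c 1 s := by
  have h := hnorm_zero_fluxC_le (g s)
  rwa [F.hnorm_vhat_grad hs] at h

lemma hnorm_one_flux_le (F : MildFlow d ν c g) {s : ℝ} (hs : 0 < s) (h2 : sob c 2 s ≠ ⊤) :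
    hnorm 1 (vhat (fluxC (g s))) ≤ ENNReal.ofReal (3 * (1 + ‖g s‖ ^ 2)) * sob c 2 s := by
  have h := hnorm_one_fluxC_le (u := g s) (by rw [F.hnorm_vhat_grad hs]; exact h2)
  rwa [F.hnorm_vhat_grad hs] at h

lemma sob_one_le (F : MildFlow d ν c g) {s : ℝ} (hs : 0 < s) :
    sob c 1 s ≤ ENNReal.ofReal (vol d * ‖g s‖) := by
  have h := hnorm_zero_vhat_le (g s)
  rwa [F.hnorm_vhat_grad hs] at h

/-- The `H²` seminorm stays bounded near the initial time. -/
lemma exists_sob_two_bound (F : MildFlow d ν c g) (hν : 0 < ν) :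
    ∃ T B, 0 < T ∧ T ≤ 1 ∧ 0 ≤ B ∧ ∀ t ∈ Set.Ioc 0 T, sob c 2 t ≤ ENNReal.ofReal B := by
  have hνp := Real.rpow_pos_of_pos hν (1 / 2 : ℝ)
  -- The denominator is `96 = 3 · 32`: the H¹ estimate of the flux carries an additional factor `3`.
  obtain ⟨T, hT, hT1, hκ⟩ := F.exists_one_add_sq_le (κ := ν ^ (1 / 2 : ℝ) / 96) (by positivity)
  set κ := ν ^ (1 / 2 : ℝ) / 96 with hκdef
  have hκ0 : 0 < κ := by positivity
  have hκν : ν ^ (-(1 / 2) : ℝ) * κ = 1 / 96 := by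
    rw [hκdef, mul_div_assoc', ← Real.rpow_add hν]; norm_num
  set A := (sob c 2 0).toReal with hA
  have hA0 : 0 ≤ A := ENNReal.toReal_nonneg
  have hA2 : sob c 2 0 ≤ ENNReal.ofReal A := (ENNReal.ofReal_toReal (show sob c 2 0 ≠ ⊤ from F.data)).ge
  have hA1 : sob c 1 0 ≤ ENNReal.ofReal A :=
    (hnorm_le_of_le (by norm_num) (by norm_num) fun k => norm_nonneg _).trans hA2
  obtain ⟨M, hM, hMb⟩ := F.exists_bound T
  have hvol := vol_pos d
  -- For H¹ the rough bound is the sup norm bound of the gradient.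
  have hY1 := F.sob_le_of_rough_bound hν (m := 0) (T := T) (A := A) (M := vol d * M) (κ := κ) hA0
    (by positivity) hκ0.le (by rw [hκν]; norm_num) hA1
    (fun s hs => (F.hnorm_zero_flux_le hs.1).trans
      (mul_le_mul_left (ENNReal.ofReal_le_ofReal (hκ s hs)) _))
    (fun s hs => (F.sob_one_le hs.1).trans (ENNReal.ofReal_le_ofReal (by
      rw [mul_assoc]
      exact mul_le_mul_of_nonneg_left (hMb s hs) hvol.le)))
  -- From the H¹ bound the flux is of order `s^{-1/2}` in L². Gaining two derivatives uses the
  -- kernel `(t-s)^{-3/4}` and yields exactly the rate `t^{-1/4}` required as rough bound for H².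
  have hrough : ∀ t ∈ Set.Ioc 0 T, sob c 2 t ≤ ENNReal.ofReal
      ((A + ν ^ (-(3 / 4) : ℝ) * (κ * (2 * A)) * 12) * t ^ (-(1 / 4) : ℝ)) := by
    intro t ht
    have hp : (-((((2 : ℕ) : ℝ) + 1) / 4)) = -(3 / 4 : ℝ) := by norm_num
    have hduh := F.hnorm_duh_le hν le_rfl ht.1.le (b := 2) (by norm_num) 0
    rw [hp] at hduh
    have hpt : ∀ s ∈ Set.Ioc 0 t, ENNReal.ofReal ((ν * (t - s)) ^ (-(3 / 4) : ℝ)) *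
        hnorm 0 (vhat (fluxC (g s))) ≤
        ENNReal.ofReal ((ν * (t - s)) ^ (-(3 / 4) : ℝ)) *
          ENNReal.ofReal (κ * (2 * A) * (s - 0) ^ (-(1 / 2) : ℝ)) := by
      intro s hs
      have hsT : s ∈ Set.Ioc 0 T := ⟨hs.1, hs.2.trans ht.2⟩
      rw [sub_zero]
      refine mul_le_mul_right ((F.hnorm_zero_flux_le hs.1).trans
        ((mul_le_mul' (ENNReal.ofReal_le_ofReal (hκ s hsT)) (hY1 s hsT)).trans ?_)) _
      have h1 := Real.rpow_pos_of_pos hs.1 (-(1 / 2) : ℝ)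
      rw [← ENNReal.ofReal_mul (by positivity)]
      exact ENNReal.ofReal_le_ofReal (le_of_eq (by ring))
    have i1 := lintegral_kernel_le hν ht.1 (p := 3 / 4) (q := 1 / 2) (by norm_num) (by norm_num)
      (by norm_num) (by norm_num) (B := κ * (2 * A)) (by positivity)
    have hlin : hnorm 2 (fun k => decay ν (t - 0) k * ‖c 0 k‖) ≤ ENNReal.ofReal A :=
      (hnorm_decay_le_self hν.le (by linarith [ht.1]) _ fun k => norm_nonneg _).trans hA2
    refine (sob_le_add (ν := ν) 2 0 t).trans ((add_le_add hlin
      (hduh.trans ((setLIntegral_mono' measurableSet_Ioc hpt).trans i1))).trans ?_)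
    have hνp := Real.rpow_pos_of_pos hν (-(3 / 4) : ℝ)
    have htp := Real.rpow_pos_of_pos ht.1 (-(1 / 4) : ℝ)
    have e1 : (t - 0) ^ (1 - 3 / 4 - 1 / 2 : ℝ) = t ^ (-(1 / 4) : ℝ) := by norm_num
    rw [e1, ← ENNReal.ofReal_add hA0 (by norm_num; positivity)]
    refine ENNReal.ofReal_le_ofReal ?_
    have h1 : 1 ≤ t ^ (-(1 / 4) : ℝ) :=
      Real.one_le_rpow_of_pos_of_le_one_of_nonpos ht.1 (ht.2.trans hT1) (by norm_num)
    have h2 : (2 / (1 - 1 / 2) + 2 / (1 - 3 / 4) : ℝ) = 12 := by norm_num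
    rw [h2, add_mul]
    have := le_mul_of_one_le_right hA0 h1
    linarith
  have hνp' := Real.rpow_pos_of_pos hν (-(3 / 4) : ℝ)
  have hY2 := F.sob_le_of_rough_bound hν (m := 1) (T := T) (A := A)
    (M := A + ν ^ (-(3 / 4) : ℝ) * (κ * (2 * A)) * 12) (κ := 3 * κ) hA0
    (by positivity) (by positivity) (by rw [mul_left_comm, hκν]; norm_num) hA2
    (fun s hs => (F.hnorm_one_flux_le hs.1
      ((hrough s hs).trans_lt ENNReal.ofReal_lt_top).ne).trans
      (mul_le_mul_left (ENNReal.ofReal_le_ofReal (by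
        rw [mul_assoc]
        exact mul_le_mul_of_nonneg_left (hκ s hs) (by norm_num))) _)) hrough
  exact ⟨T, 2 * A, hT, hT1, by positivity, hY2⟩

/-- The Duhamel part tends to zero in `H²` at the initial time. -/
lemma exists_hnorm_duh_le (F : MildFlow d ν c g) (hν : 0 < ν) {ε : ℝ} (hε : 0 < ε) :
    ∃ T, 0 < T ∧ ∀ t ∈ Set.Ioc 0 T, hnorm 2 (fun k => ‖duh ν c 0 t k‖) ≤ ENNReal.ofReal ε := by
  obtain ⟨T₁, B, hT₁, -, hB, hb⟩ := F.exists_sob_two_bound hν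
  have hνp := Real.rpow_pos_of_pos hν (-(1 / 2) : ℝ)
  -- Here `24 = 3 · 8`: the Lipschitz factor of the flux times the constant of the time integral.
  -- The time integral does not decay, so all the smallness comes from `κ`.
  obtain ⟨T₂, hT₂, -, hκ⟩ := F.exists_one_add_sq_le (κ := ε / (24 * ν ^ (-(1 / 2) : ℝ) * (B + 1)))
    (by positivity)
  set κ := ε / (24 * ν ^ (-(1 / 2) : ℝ) * (B + 1)) with hκdef
  have hκ0 : 0 < κ := by positivity
  refine ⟨min T₁ T₂, lt_min hT₁ hT₂, fun t ht => ?_⟩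
  have hp : (-((((1 : ℕ) : ℝ) + 1) / 4)) = -(1 / 2 : ℝ) := by norm_num
  have hduh := F.hnorm_duh_le hν le_rfl ht.1.le (b := 1) (by norm_num) 1
  rw [hp] at hduh
  have hpt : ∀ s ∈ Set.Ioc 0 t, ENNReal.ofReal ((ν * (t - s)) ^ (-(1 / 2) : ℝ)) *
      hnorm 1 (vhat (fluxC (g s))) ≤
      ENNReal.ofReal ((ν * (t - s)) ^ (-(1 / 2) : ℝ)) *
        ENNReal.ofReal (3 * κ * B * (s - 0) ^ (-(1 / 2) : ℝ)) := by
    intro s hs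
    have hs1 : s ∈ Set.Ioc 0 T₁ := ⟨hs.1, hs.2.trans (ht.2.trans (min_le_left _ _))⟩
    have hs2 : s ∈ Set.Ioc 0 T₂ := ⟨hs.1, hs.2.trans (ht.2.trans (min_le_right _ _))⟩
    rw [sub_zero]
    have h1 := Real.rpow_pos_of_pos hs.1 (-(1 / 2) : ℝ)
    have h3 : 3 * (1 + ‖g s‖ ^ 2) ≤ 3 * κ * s ^ (-(1 / 2) : ℝ) := by
      rw [mul_assoc]
      exact mul_le_mul_of_nonneg_left (hκ s hs2) (by norm_num)
    refine mul_le_mul_right ((F.hnorm_one_flux_le hs.1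
      ((hb s hs1).trans_lt ENNReal.ofReal_lt_top).ne).trans
      ((mul_le_mul' (ENNReal.ofReal_le_ofReal h3) (hb s hs1)).trans ?_)) _
    rw [← ENNReal.ofReal_mul (by positivity)]
    exact ENNReal.ofReal_le_ofReal (le_of_eq (by ring))
  have i1 := lintegral_kernel_le hν ht.1 (p := 1 / 2) (q := 1 / 2) (by norm_num) (by norm_num)
    (by norm_num) (by norm_num) (B := 3 * κ * B) (by positivity)
  refine hduh.trans ((setLIntegral_mono' measurableSet_Ioc hpt).trans (i1.trans ?_))
  refine ENNReal.ofReal_le_ofReal ?_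
  have e0 : (t - 0) ^ (1 - 1 / 2 - 1 / 2 : ℝ) = 1 := by norm_num
  rw [e0]
  have h5 : κ * (24 * ν ^ (-(1 / 2) : ℝ) * (B + 1)) = ε := by
    rw [hκdef]; field_simp
  have h6 : 0 ≤ κ * ν ^ (-(1 / 2) : ℝ) := by positivity
  norm_num at h5 h6 ⊢
  nlinarith

/-- Interior smoothing by two derivatives beyond the regularity of the flux. -/
lemma exists_sob_bound_of_flux (F : MildFlow d ν c g) (hν : 0 < ν) {m : ℕ} {a a' T B B' : ℝ}
    (ha : 0 ≤ a) (haa' : a < a') (hB : 0 ≤ B) (hB' : 0 ≤ B')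
    (h0 : sob c (m + 1) a ≤ ENNReal.ofReal B')
    (hflux : ∀ s ∈ Set.Ioc a T, hnorm m (vhat (fluxC (g s))) ≤ ENNReal.ofReal B) :
    ∃ K, 0 ≤ K ∧ ∀ t ∈ Set.Icc a' T, sob c (m + 2) t ≤ ENNReal.ofReal K := by
  have hνp := Real.rpow_pos_of_pos hν (-(3 / 4) : ℝ)
  have hda : 0 < ν * (a' - a) := mul_pos hν (sub_pos.mpr haa')
  have hdp := Real.rpow_pos_of_pos hda (-(1 / 4) : ℝ)
  refine ⟨(ν * (a' - a)) ^ (-(1 / 4) : ℝ) * B' +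
    ν ^ (-(3 / 4) : ℝ) * B * 10 * (max (T - a) 0) ^ (1 / 4 : ℝ), by positivity, fun t ht => ?_⟩
  have hat : a < t := haa'.trans_le ht.1
  have hp : (-((((2 : ℕ) : ℝ) + 1) / 4)) = -(3 / 4 : ℝ) := by norm_num
  have hduh := F.hnorm_duh_le hν ha hat.le (b := 2) (by norm_num) m
  rw [hp] at hduh
  have hpt : ∀ s ∈ Set.Ioc a t, ENNReal.ofReal ((ν * (t - s)) ^ (-(3 / 4) : ℝ)) *
      hnorm m (vhat (fluxC (g s))) ≤
      ENNReal.ofReal ((ν * (t - s)) ^ (-(3 / 4) : ℝ)) *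
        ENNReal.ofReal (B * (s - a) ^ (-0 : ℝ)) := by
    intro s hs
    rw [neg_zero, Real.rpow_zero, mul_one]
    exact mul_le_mul_right (hflux s ⟨hs.1, hs.2.trans ht.2⟩) _
  have i1 := lintegral_kernel_le hν hat (p := 3 / 4) (q := 0) (by norm_num) (by norm_num)
    (by norm_num) (by norm_num) (B := B) hB
  -- At time `a` only `m + 1` derivatives are known, so the linear part gains one more at the price
  -- `(t-a)^{-1/4}`. For this reason the bound starts at `a'`.
  have hlin := hnorm_decay_le hν (sub_pos.mpr hat) (m := m + 1) (b := 1) (by norm_num)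
    (fun k => ‖c a k‖) fun k => norm_nonneg _
  have hlin' : hnorm (m + 2) (fun k => decay ν (t - a) k * ‖c a k‖) ≤
      ENNReal.ofReal ((ν * (a' - a)) ^ (-(1 / 4) : ℝ) * B') := by
    refine hlin.trans ?_
    rw [ENNReal.ofReal_mul hdp.le]
    refine mul_le_mul' (ENNReal.ofReal_le_ofReal ?_) h0
    push_cast
    refine Real.rpow_le_rpow_of_nonpos hda ?_ (by norm_num)
    exact mul_le_mul_of_nonneg_left (by linarith [ht.1]) hν.le
  refine (sob_le_add (ν := ν) (m + 2) a t).trans ((add_le_add hlin'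
    (hduh.trans ((setLIntegral_mono' measurableSet_Ioc hpt).trans i1))).trans ?_)
  have h1 : 0 ≤ (t - a) ^ (1 - 3 / 4 - 0 : ℝ) := Real.rpow_nonneg (by linarith) _
  rw [← ENNReal.ofReal_add (by positivity) (by norm_num at h1 ⊢; positivity)]
  refine ENNReal.ofReal_le_ofReal (add_le_add le_rfl ?_)
  have h2 : (2 / (1 - 0) + 2 / (1 - 3 / 4) : ℝ) = 10 := by norm_num
  have h3 : (1 - 3 / 4 - 0 : ℝ) = 1 / 4 := by norm_num
  rw [h2, h3]
  refine mul_le_mul_of_nonneg_left ?_ (by positivity)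
  exact Real.rpow_le_rpow (by linarith) (le_max_of_le_left (by linarith [ht.2])) (by norm_num)

/-- Interior `H³` regularity together with a uniform bound for the gradient. -/
lemma exists_interior_bound (F : MildFlow d ν c g) (hν : 0 < ν) {ε : ℝ} (hε : 0 < ε) (T : ℝ) :
    ∃ K, 0 ≤ K ∧ ∀ t ∈ Set.Icc ε T, ‖g t‖ ≤ K ∧ sob c 3 t ≤ ENNReal.ofReal K := by
  rcases lt_or_ge T ε with hTε | hTε
  · exact ⟨0, le_rfl, fun t ht => absurd (ht.1.trans ht.2) (not_le.mpr hTε)⟩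
  obtain ⟨M, hM, hMb⟩ := F.exists_bound T
  have hvol := vol_pos d
  set K := M * (ε / 4) ^ (-(1 / 4) : ℝ) with hK
  have hK0 : 0 ≤ K := by positivity
  have hg : ∀ s ∈ Set.Icc (ε / 4) T, ‖g s‖ ≤ K := by
    intro s hs
    have hs0 : 0 < s := lt_of_lt_of_le (by linarith) hs.1
    refine (hMb s ⟨hs0, hs.2⟩).trans (mul_le_mul_of_nonneg_left ?_ hM)
    exact Real.rpow_le_rpow_of_nonpos (by linarith) hs.1 (by norm_num)
  have h1 : ∀ s ∈ Set.Icc (ε / 4) T, sob c 1 s ≤ ENNReal.ofReal (vol d * K) := fun s hs =>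
    (F.sob_one_le (lt_of_lt_of_le (by linarith) hs.1)).trans
      (ENNReal.ofReal_le_ofReal (mul_le_mul_of_nonneg_left (hg s hs) hvol.le))
  -- The bootstrap from H¹ to H² to H³ uses the successive times `ε/4`, `ε/2` and `ε`.
  obtain ⟨K₂, hK₂, h2⟩ := F.exists_sob_bound_of_flux hν (m := 0) (a := ε / 4) (a' := ε / 2) (T := T)
    (B := (1 + K ^ 2) * (vol d * K)) (B' := vol d * K) (by linarith) (by linarith) (by positivity)
    (by positivity) (h1 _ ⟨le_rfl, by linarith⟩) (fun s hs => by
      refine (F.hnorm_zero_flux_le (lt_trans (by linarith) hs.1)).trans ?_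
      rw [ENNReal.ofReal_mul (by positivity)]
      refine mul_le_mul' (ENNReal.ofReal_le_ofReal ?_) (h1 s ⟨hs.1.le, hs.2⟩)
      have := pow_le_pow_left₀ (norm_nonneg _) (hg s ⟨hs.1.le, hs.2⟩) 2
      linarith)
  obtain ⟨K₃, hK₃, h3⟩ := F.exists_sob_bound_of_flux hν (m := 1) (a := ε / 2) (a' := ε) (T := T)
    (B := 3 * (1 + K ^ 2) * K₂) (B' := K₂) (by linarith) (by linarith) (by positivity)
    hK₂ (h2 _ ⟨le_rfl, by linarith⟩) (fun s hs => by
      have hs2 := h2 s ⟨hs.1.le, hs.2⟩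
      refine (F.hnorm_one_flux_le (lt_trans (by linarith) hs.1)
        (hs2.trans_lt ENNReal.ofReal_lt_top).ne).trans ?_
      rw [ENNReal.ofReal_mul (p := 3 * (1 + K ^ 2)) (by positivity)]
      refine mul_le_mul' (ENNReal.ofReal_le_ofReal ?_) hs2
      have := pow_le_pow_left₀ (norm_nonneg _) (hg s ⟨by linarith [hs.1], hs.2⟩) 2
      linarith)
  refine ⟨max K K₃, le_max_of_le_left hK0, fun t ht => ⟨?_, ?_⟩⟩
  · exact (hg t ⟨by linarith [ht.1], ht.2⟩).trans (le_max_left _ _)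
  · exact (h3 t ht).trans (ENNReal.ofReal_le_ofReal (le_max_right _ _))

end MildFlow

end ThinFilm

namespace ThinFilm

open scoped ComplexConjugate

/-! ### The double-well energy and its derivative along trigonometric polynomials -/

section Well

variable {d : ℕ}

/-- Integration over the torus as a continuous functional. -/
noncomputable def integralC (d : ℕ) : C(Torus d, ℝ) →L[ℝ] ℝ :=
  LinearMap.mkContinuous
    { toFun := fun f => ∫ x, f x
      map_add' := fun f g => integral_add (ContinuousMap.integrable_torus f)
        (ContinuousMap.integrable_torus g)
      map_smul' := fun a f => integral_const_mul a f } (vol d) fun f => by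
    have h := norm_integral_le_of_norm_le_const (μ := (volume : Measure (Torus d)))
      (ae_of_all _ f.norm_coe_le_norm)
    rw [volume_real_univ] at h
    exact h.trans_eq (mul_comm _ _)

lemma integralC_apply (f : C(Torus d, ℝ)) : integralC d f = ∫ x, f x := rfl

/-- The components of a continuous vector field. -/
noncomputable def component (j : Fin d) : C(Torus d, Vec d) →L[ℝ] C(Torus d, ℝ) :=
  (EuclideanSpace.proj j : Vec d →L[ℝ] ℝ).compLeftContinuous ℝ (Torus d)

lemma component_apply (j : Fin d) (u : C(Torus d, Vec d)) (x : Torus d) :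
    component j u x = u x j := rfl

/-- The double-well energy `1/4 ∫ (|u|² - 1)²`. -/
noncomputable def wellEnergy (u : C(Torus d, Vec d)) : ℝ :=
  integralC d ((1 / 4 : ℝ) • (∑ j, component j u ^ 2 - 1) ^ 2)

lemma wellEnergy_eq (u : C(Torus d, Vec d)) :
    wellEnergy u = ∫ x, 1 / 4 * (‖u x‖ ^ 2 - 1) ^ 2 := by
  rw [wellEnergy, integralC_apply]
  refine integral_congr_ae (ae_of_all _ fun x => ?_)
  simp [EuclideanSpace.norm_sq_eq, component_apply]

lemma continuous_wellEnergy : Continuous (wellEnergy (d := d)) := by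
  unfold wellEnergy
  fun_prop

/-- The real part of a complex function on the torus, divided by the volume. -/
noncomputable def scaledRe (d : ℕ) : C(Torus d, ℂ) →L[ℝ] C(Torus d, ℝ) :=
  (vol d)⁻¹ • Complex.reCLM.compLeftContinuous ℝ (Torus d)

lemma trig_eq_scaledRe {S : Finset (Fin d → ℤ)} {a : (Fin d → ℤ) → ℂ} (h : ∀ k ∉ S, a k = 0) :
    trig a = scaledRe d (∑ k ∈ S, a k • mexp k) := by
  have e : ∑' k, a k • mexp k = ∑ k ∈ S, a k • (mexp k : C(Torus d, ℂ)) :=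
    tsum_eq_sum fun k hk => by rw [h k hk, zero_smul]
  ext x
  change (vol d)⁻¹ * ((∑' k, a k • mexp k : C(Torus d, ℂ)) x).re = _
  rw [e]
  rfl

lemma hasDerivAt_trig {S : Finset (Fin d → ℤ)} {a : ℝ → (Fin d → ℤ) → ℂ} {a' : (Fin d → ℤ) → ℂ}
    {t : ℝ} (h0 : ∀ s, ∀ k ∉ S, a s k = 0) (h0' : ∀ k ∉ S, a' k = 0)
    (ha : ∀ k ∈ S, HasDerivAt (fun s => a s k) (a' k) t) :
    HasDerivAt (fun s => trig (a s)) (trig a') t := by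
  simp only [trig_eq_scaledRe h0']
  have e : (fun s => trig (a s)) = fun s => scaledRe d (∑ k ∈ S, a s k • mexp k) :=
    funext fun s => trig_eq_scaledRe (h0 s)
  rw [e]
  refine (scaledRe d).hasFDerivAt.comp_hasDerivAt t ?_
  exact HasDerivAt.fun_sum fun k hk => (ha k hk).smul_const _

lemma integralC_mul_trig (f : C(Torus d, ℝ)) {S : Finset (Fin d → ℤ)} {a : (Fin d → ℤ) → ℂ}
    (h : ∀ k ∉ S, a k = 0) :
    integralC d (f * trig a) = (vol d)⁻¹ * (∑ k ∈ S, a k * conj (coeff f k)).re := by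
  have e : ∀ x, (f * trig a) x = (vol d)⁻¹ * (∑ k ∈ S, a k * ((f x : ℂ) * mexp k x)).re := by
    intro x
    rw [trig_eq_scaledRe h, ContinuousMap.mul_apply]
    change f x * ((vol d)⁻¹ * ((∑ k ∈ S, a k • mexp k : C(Torus d, ℂ)) x).re) = _
    rw [mul_left_comm, ← Complex.re_ofReal_mul, ContinuousMap.sum_apply, Finset.mul_sum]
    congr 2
    refine Finset.sum_congr rfl fun k _ => ?_
    rw [ContinuousMap.smul_apply, smul_eq_mul]
    ring
  have hi : ∀ k ∈ S, Integrable (fun x => a k * ((f x : ℂ) * mexp k x)) volume := fun k _ =>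
    (integrable_mul_mexp (ContinuousMap.integrable_torus f) k).const_mul _
  rw [integralC_apply]
  simp only [e]
  rw [integral_const_mul]
  congr 1
  rw [show (∫ x, (∑ k ∈ S, a k * ((f x : ℂ) * mexp k x)).re) =
    (∫ x, ∑ k ∈ S, a k * ((f x : ℂ) * mexp k x)).re from integral_re (integrable_finsetSum _ hi),
    integral_finsetSum _ hi]
  congr 1
  refine Finset.sum_congr rfl fun k _ => ?_
  rw [integral_const_mul, integral_mul_mexp]

/-- With finitely many modes the chain rule holds in the algebra of continuous functions and gives
the integral of the flux against the gradient of the variation. Parseval with the symbol `i k_j`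
performs the integration by parts. -/
lemma hasDerivAt_wellEnergy {S : Finset (Fin d → ℤ)} {a : ℝ → (Fin d → ℤ) → ℂ}
    {a' : (Fin d → ℤ) → ℂ} {t : ℝ} (h0 : ∀ s, ∀ k ∉ S, a s k = 0) (h0' : ∀ k ∉ S, a' k = 0)
    (ha : ∀ k ∈ S, HasDerivAt (fun s => a s k) (a' k) t) :
    HasDerivAt (fun s => wellEnergy (gradTrig (a s)))
      (-((vol d)⁻¹ * (∑ k ∈ S, a' k * conj (divFlux (gradTrig (a t)) k)).re)) t := by
  have hw : ∀ j, HasDerivAt (fun s => component j (gradTrig (a s)))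
      (trig fun k => Complex.I * (k j : ℂ) * a' k) t := fun j =>
    hasDerivAt_trig (S := S) (a := fun s k => Complex.I * (k j : ℂ) * a s k)
      (fun s k hk => by rw [h0 s k hk, mul_zero]) (fun k hk => by rw [h0' k hk, mul_zero])
      fun k hk => (ha k hk).const_mul _
  have h1 : HasDerivAt (fun s => (1 / 4 : ℝ) • (∑ j, component j (gradTrig (a s)) ^ 2 - 1) ^ 2) _ t :=
    (((HasDerivAt.fun_sum fun j _ => (hw j).fun_pow 2).sub_const 1).fun_pow 2).const_smul (1 / 4 : ℝ)
  have h2 := (integralC d).hasFDerivAt.comp_hasDerivAt t h1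
  refine h2.congr_deriv ?_
  set u := gradTrig (a t) with hu
  have e : (1 / 4 : ℝ) • (((2 : ℕ) : C(Torus d, ℝ)) * (∑ j, component j u ^ 2 - 1) ^ (2 - 1) *
      ∑ j, ((2 : ℕ) : C(Torus d, ℝ)) * component j u ^ (2 - 1) *
        trig fun k => Complex.I * (k j : ℂ) * a' k) =
      ∑ j, component j (fluxC u) * trig fun k => Complex.I * (k j : ℂ) * a' k := by
    rw [Finset.mul_sum, Finset.smul_sum]
    refine Finset.sum_congr rfl fun j _ => ?_
    ext x
    simp only [ContinuousMap.smul_apply, ContinuousMap.mul_apply, ContinuousMap.sub_apply,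
      ContinuousMap.sum_apply, ContinuousMap.pow_apply, component_apply, fluxC_apply,
      PiLp.smul_apply, smul_eq_mul, EuclideanSpace.norm_sq_eq, Real.norm_eq_abs, sq_abs]
    have h2 : (((2 : ℕ) : C(Torus d, ℝ)) x) = 2 := rfl
    rw [h2, ContinuousMap.one_apply]
    ring
  change integralC d _ = _
  rw [e, map_sum]
  have e2 : ∀ j, integralC d (component j (fluxC u) * trig fun k => Complex.I * (k j : ℂ) * a' k) =
      (vol d)⁻¹ * (∑ k ∈ S, Complex.I * (k j : ℂ) * a' k *
        conj (coeff (component j (fluxC u)) k)).re := fun j =>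
    integralC_mul_trig _ fun k hk => by rw [h0' k hk, mul_zero]
  simp only [e2]
  rw [← Finset.mul_sum, ← mul_neg, ← Complex.re_sum, Finset.sum_comm, ← Complex.neg_re,
    ← Finset.sum_neg_distrib]
  congr 2
  refine Finset.sum_congr rfl fun k _ => ?_
  rw [divFlux, map_sum, Finset.mul_sum, ← Finset.sum_neg_distrib]
  refine Finset.sum_congr rfl fun j _ => ?_
  rw [map_mul, map_mul, Complex.conj_I, map_intCast]
  change _ * conj (coeff (fun x => fluxC u x j) k) = _
  ring

/-- Restriction of a family of coefficients to a finite set of frequencies. -/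
noncomputable def trunc (S : Finset (Fin d → ℤ)) (c : (Fin d → ℤ) → ℂ) (k : Fin d → ℤ) : ℂ :=
  if k ∈ S then c k else 0

lemma trunc_of_mem {S : Finset (Fin d → ℤ)} (c : (Fin d → ℤ) → ℂ) {k : Fin d → ℤ} (hk : k ∈ S) :
    trunc S c k = c k := if_pos hk

lemma trunc_of_notMem {S : Finset (Fin d → ℤ)} (c : (Fin d → ℤ) → ℂ) {k : Fin d → ℤ}
    (hk : k ∉ S) : trunc S c k = 0 := if_neg hk

lemma norm_trunc_le (S : Finset (Fin d → ℤ)) (c : (Fin d → ℤ) → ℂ) (k : Fin d → ℤ) :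
    ‖trunc S c k‖ ≤ ‖c k‖ := by
  by_cases hk : k ∈ S
  · rw [trunc_of_mem c hk]
  · rw [trunc_of_notMem c hk, norm_zero]; exact norm_nonneg _

lemma norm_sub_trunc_le (S : Finset (Fin d → ℤ)) (c : (Fin d → ℤ) → ℂ) (k : Fin d → ℤ) :
    ‖c k - trunc S c k‖ ≤ ‖c k‖ := by
  by_cases hk : k ∈ S
  · rw [trunc_of_mem c hk, sub_self, norm_zero]; exact norm_nonneg _
  · rw [trunc_of_notMem c hk, sub_zero]

lemma trunc_cube_symm {c : (Fin d → ℤ) → ℂ} (h : ∀ k, c (-k) = conj (c k)) (N : ℕ)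
    (k : Fin d → ℤ) : trunc (cube d N) c (-k) = conj (trunc (cube d N) c k) := by
  by_cases hk : k ∈ cube d N
  · rw [trunc_of_mem c hk, trunc_of_mem c (neg_mem_cube.mpr hk), h]
  · rw [trunc_of_notMem c hk, trunc_of_notMem c fun hk' => hk (neg_mem_cube.mp hk'), map_zero]

lemma summable_trunc {c : (Fin d → ℤ) → ℂ} (hc : Summable fun k => freqNorm k * ‖c k‖)
    (S : Finset (Fin d → ℤ)) : Summable fun k => freqNorm k * ‖trunc S c k‖ :=
  hc.of_nonneg_of_le (fun k => mul_nonneg (freqNorm_nonneg k) (norm_nonneg _))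
    fun k => mul_le_mul_of_nonneg_left (norm_trunc_le S c k) (freqNorm_nonneg k)

lemma norm_gradTrig_trunc_le {c : (Fin d → ℤ) → ℂ} (hc : Summable fun k => freqNorm k * ‖c k‖)
    (S : Finset (Fin d → ℤ)) :
    ‖gradTrig (trunc S c)‖ ≤ d * (vol d)⁻¹ * ∑' k, freqNorm k * ‖c k‖ := by
  have hv := vol_pos d
  refine (norm_gradTrig_le (summable_trunc hc S)).trans ?_
  gcongr
  · exact summable_trunc hc S
  · exact freqNorm_nonneg _
  · exact norm_trunc_le S c _

lemma tendsto_gradTrig_trunc {c : (Fin d → ℤ) → ℂ} (hc : Summable fun k => freqNorm k * ‖c k‖) :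
    Tendsto (fun N => gradTrig (trunc (cube d N) c)) atTop (𝓝 (gradTrig c)) := by
  rw [tendsto_iff_norm_sub_tendsto_zero]
  have hs : ∀ N, Summable fun k => freqNorm k * ‖c k - trunc (cube d N) c k‖ := fun N =>
    hc.of_nonneg_of_le (fun k => mul_nonneg (freqNorm_nonneg k) (norm_nonneg _))
      fun k => mul_le_mul_of_nonneg_left (norm_sub_trunc_le _ c k) (freqNorm_nonneg k)
  have h1 : Tendsto (fun N => ∑' k, freqNorm k * ‖c k - trunc (cube d N) c k‖) atTop
      (𝓝 (∑' _k : Fin d → ℤ, (0 : ℝ))) := by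
    refine tendsto_tsum_of_dominated_convergence hc (fun k => ?_)
      (Eventually.of_forall fun N k => ?_)
    · refine tendsto_const_nhds.congr' ?_
      filter_upwards [tendsto_cube.eventually (eventually_ge_atTop {k})] with N hN
      rw [trunc_of_mem c (hN (Finset.mem_singleton_self k)), sub_self, norm_zero, mul_zero]
    · rw [Real.norm_of_nonneg (mul_nonneg (freqNorm_nonneg k) (norm_nonneg _))]
      exact mul_le_mul_of_nonneg_left (norm_sub_trunc_le _ c k) (freqNorm_nonneg k)
  rw [tsum_zero] at h1
  have h2 := h1.const_mul (d * (vol d)⁻¹)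
  rw [mul_zero] at h2
  refine squeeze_zero (fun _ => norm_nonneg _) (fun N => ?_) h2
  rw [norm_sub_rev, ← gradTrig_sub hc (summable_trunc hc _)]
  exact norm_gradTrig_le (hs N)

end Well

/-! ### The differential equation of a single Fourier mode. -/

namespace MildFlow

variable {d : ℕ} {ν : ℝ} {c : ℝ → (Fin d → ℤ) → ℂ} {g : ℝ → C(Torus d, Vec d)}

/-- Duhamel restarted at `t/2` avoids the singularity at time zero. Pulling out `e^{-ν|k|⁴ s}`
leaves an integral with continuous integrand, to which the fundamental theorem of calculus applies.
-/
lemma hasDerivAt_coeff (F : MildFlow d ν c g) {t : ℝ} (ht : 0 < t) (k : Fin d → ℤ) :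
    HasDerivAt (fun s => c s k) (divFlux (g t) k - (ν * freqNorm k ^ 4 : ℝ) * c t k) t := by
  set l : ℝ := ν * freqNorm k ^ 4 with hl
  have ha : 0 < t / 2 := by linarith
  set a := t / 2 with ha'
  have hD := F.continuousOn_divFlux k
  have hE : ∀ r : ℝ, HasDerivAt (fun s : ℝ => Complex.exp ((r * s : ℝ) : ℂ))
      (r * Complex.exp ((r * t : ℝ) : ℂ)) t := fun r => by
    have h1 : HasDerivAt (fun s : ℝ => ((r * s : ℝ) : ℂ)) (r : ℂ) t := by
      have := ((hasDerivAt_id t).const_mul r).ofReal_comp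
      simpa using this
    simpa [mul_comm] using h1.cexp
  have hcont : ContinuousOn (fun s => Complex.exp ((l * s : ℝ) : ℂ) * divFlux (g s) k)
      (Set.Ioi 0) := ContinuousOn.mul (by fun_prop) hD
  have hI : HasDerivAt (fun s => ∫ r in a..s, Complex.exp ((l * r : ℝ) : ℂ) * divFlux (g r) k)
      (Complex.exp ((l * t : ℝ) : ℂ) * divFlux (g t) k) t := by
    refine intervalIntegral.integral_hasDerivAt_right ?_ ?_ ?_
    · refine ContinuousOn.intervalIntegrable (hcont.mono ?_)
      rw [Set.uIcc_of_le (by linarith)]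
      exact fun s hs => ha.trans_le hs.1
    · exact hcont.stronglyMeasurableAtFilter isOpen_Ioi t ht
    · exact hcont.continuousAt (isOpen_Ioi.mem_nhds ht)
  have hev : (fun s => c s k) =ᶠ[𝓝 t] fun s => Complex.exp ((-l * s : ℝ) : ℂ) *
      (Complex.exp ((l * a : ℝ) : ℂ) * c a k +
        ∫ r in a..s, Complex.exp ((l * r : ℝ) : ℂ) * divFlux (g r) k) := by
    filter_upwards [Ioi_mem_nhds (show a < t by linarith)] with s hs
    rw [F.restart ha.le (le_of_lt hs) k, mul_add, ← intervalIntegral.integral_const_mul]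
    have e : ∀ r : ℝ, (decay ν (s - r) k : ℂ) =
        Complex.exp ((-l * s : ℝ) : ℂ) * Complex.exp ((l * r : ℝ) : ℂ) := fun r => by
      rw [← Complex.exp_add, decay, Complex.ofReal_exp]
      congr 1
      push_cast [hl]
      ring
    simp only [e, mul_assoc]
  have h := ((hE (-l)).mul (hI.const_add (Complex.exp ((l * a : ℝ) : ℂ) * c a k)))
  refine (h.congr_of_eventuallyEq hev).congr_deriv ?_
  rw [hev.eq_of_nhds, ← mul_assoc, ← Complex.exp_add]
  have e0 : ((-l * t : ℝ) : ℂ) + ((l * t : ℝ) : ℂ) = 0 := by push_cast; ring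
  rw [e0, Complex.exp_zero]
  push_cast
  ring

end MildFlow

end ThinFilm

namespace ThinFilm

open scoped ComplexConjugate

/-! ### The energy inequality at positive times -/

section Dissipation

variable {d : ℕ}

lemma re_mul_conj_le (z w : ℂ) : (z * conj w).re ≤ ‖z‖ ^ 2 + ‖w‖ ^ 2 / 4 := by
  have h := Complex.re_le_norm (z * conj w)
  rw [norm_mul, Complex.norm_conj] at h
  nlinarith [sq_nonneg (‖z‖ - ‖w‖ / 2)]

/-- On the cube the divergence costs at most a factor `d N²` in the square, and the flux is
Lipschitz on bounded sets. -/
lemma sum_sq_norm_divFlux_sub_le (u v : C(Torus d, Vec d)) {R : ℝ} (hu : ‖u‖ ≤ R) (hv : ‖v‖ ≤ R)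
    (N : ℕ) :
    ∑ k ∈ cube d N, ‖divFlux u k - divFlux v k‖ ^ 2 ≤
      d * (N : ℝ) ^ 2 * ((3 * (1 + R ^ 2)) ^ 2 * ∑' k, vhat (u - v) k ^ 2) := by
  set L := 3 * (1 + R ^ 2)
  set w := fluxC u - fluxC v
  have hw := hasSum_vhat_sq (v := w) fun j => memLp_component w j 2
  have huv := hasSum_vhat_sq (v := u - v) fun j => memLp_component (u - v) j 2
  have hle : ∑' k, vhat w k ^ 2 ≤ L ^ 2 * ∑' k, vhat (u - v) k ^ 2 := by
    rw [hw.tsum_eq, huv.tsum_eq, mul_left_comm]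
    refine mul_le_mul_of_nonneg_left ?_ (vol_pos d).le
    rw [← integral_const_mul]
    refine integral_mono (integrable_norm_sq w) ((integrable_norm_sq (u - v)).const_mul _)
      fun x => ?_
    simp only
    rw [← mul_pow]
    exact pow_le_pow_left₀ (norm_nonneg _) (norm_fluxC_sub_apply_le hu hv x) 2
  have hterm : ∀ k, divFlux u k - divFlux v k =
      ∑ j, Complex.I * (k j : ℂ) * coeff (fun x => w x j) k := fun k => by
    rw [divFlux, divFlux, ← Finset.sum_sub_distrib]
    refine Finset.sum_congr rfl fun j _ => ?_
    rw [← mul_sub, ← coeff_sub (integrable_component _ j) (integrable_component _ j)]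
    rfl
  calc _ ≤ ∑ k ∈ cube d N, d * (N : ℝ) ^ 2 * vhat w k ^ 2 := by
        refine Finset.sum_le_sum fun k hk => ?_
        rw [hterm]
        refine (pow_le_pow_left₀ (norm_nonneg _) (norm_sum_mul_coeff_le w k) 2).trans ?_
        rw [mul_pow]
        exact mul_le_mul_of_nonneg_right (freqNorm_sq_le_of_mem_cube hk) (sq_nonneg _)
    _ = d * (N : ℝ) ^ 2 * ∑ k ∈ cube d N, vhat w k ^ 2 := by rw [Finset.mul_sum]
    _ ≤ _ := by
        refine mul_le_mul_of_nonneg_left ?_ (by positivity)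
        exact (hw.summable.sum_le_tsum _ fun k _ => sq_nonneg _).trans hle

/-- The H³ norm gives a tail of order `N^{-4}`, which more than compensates the loss `N²` of the
divergence on the cube. -/
lemma tsum_sq_tail_le {c : (Fin d → ℤ) → ℂ} {N : ℕ} (hN : 0 < N)
    (hs : Summable fun k => freqNorm k ^ 6 * ‖c k‖ ^ 2) :
    ∑' k, (freqNorm k * ‖c k - trunc (cube d N) c k‖) ^ 2 ≤
      ((N : ℝ) ^ 4)⁻¹ * ∑' k, freqNorm k ^ 6 * ‖c k‖ ^ 2 := by
  have hN' : (0 : ℝ) < N := by exact_mod_cast hN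
  have hle : ∀ k, (freqNorm k * ‖c k - trunc (cube d N) c k‖) ^ 2 ≤
      ((N : ℝ) ^ 4)⁻¹ * (freqNorm k ^ 6 * ‖c k‖ ^ 2) := by
    intro k
    have h0 := freqNorm_nonneg k
    by_cases hk : k ∈ cube d N
    · rw [trunc_of_mem c hk, sub_self, norm_zero, mul_zero, zero_pow two_ne_zero]
      positivity
    · have h1 := lt_freqNorm_of_notMem_cube hk
      rw [trunc_of_notMem c hk, sub_zero, le_inv_mul_iff₀ (by positivity)]
      have h2 : (N : ℝ) ^ 4 ≤ freqNorm k ^ 4 := pow_le_pow_left₀ hN'.le h1.le 4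
      calc (N : ℝ) ^ 4 * (freqNorm k * ‖c k‖) ^ 2
          ≤ freqNorm k ^ 4 * (freqNorm k * ‖c k‖) ^ 2 := by gcongr
        _ = _ := by ring
  rw [← tsum_mul_left]
  exact (Summable.of_nonneg_of_le (fun k => sq_nonneg _) hle (hs.mul_left _)).tsum_le_tsum hle
    (hs.mul_left _)

end Dissipation

/-! ### Decay of the energy through Fourier truncation. -/

namespace MildFlow

variable {d : ℕ} {ν : ℝ} {c : ℝ → (Fin d → ℤ) → ℂ} {g : ℝ → C(Torus d, Vec d)}

lemma summable_of_sob {n : ℕ} {t K : ℝ} (h : sob c n t ≤ ENNReal.ofReal K) :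
    Summable fun k => freqNorm k ^ (2 * n) * ‖c t k‖ ^ 2 :=
  summable_of_hnorm_ne_top (fun _ => norm_nonneg _) (h.trans_lt ENNReal.ofReal_lt_top).ne

lemma summable_of_sob_three (hd : d ≤ 3) {t K : ℝ} (hK : 0 ≤ K)
    (h : sob c 3 t ≤ ENNReal.ofReal K) :
    (Summable fun k => freqNorm k * ‖c t k‖) ∧ ∑' k, freqNorm k * ‖c t k‖ ≤
      Real.sqrt (∑' k : Fin d → ℤ, (freqNorm k ^ 4)⁻¹) * K := by
  have h1 := (anorm_le_hnorm_three hd fun k => ‖c t k‖).trans (mul_le_mul_right h _)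
  rw [← ENNReal.ofReal_mul (Real.sqrt_nonneg _)] at h1
  have hs := summable_of_anorm_ne_top (fun _ => norm_nonneg _) (h1.trans_lt ENNReal.ofReal_lt_top).ne
  rw [anorm_eq_of_summable (fun _ => norm_nonneg _) hs,
    ENNReal.ofReal_le_ofReal_iff (by positivity)] at h1
  exact ⟨hs, h1⟩

lemma eq_gradTrig (F : MildFlow d ν c g) {t : ℝ} (ht : 0 < t)
    (hs : Summable fun k => freqNorm k * ‖c t k‖) : g t = gradTrig (c t) := by
  have h : ∀ j, (fun x => g t x j) =ᵐ[volume] fun x => gradTrig (c t) x j := fun j =>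
    ae_eq_of_coeff_eq (integrable_component _ j) (integrable_component _ j) fun k => by
      rw [F.coeff_grad t ht j k, coeff_gradTrig hs (F.symm t) j k]
  have h2 : (g t : Torus d → Vec d) =ᵐ[volume] gradTrig (c t) := by
    filter_upwards [ae_all_iff.mpr h] with x hx
    ext j
    exact hx j
  have h3 := Continuous.ae_eq_iff_eq volume (g t).continuous (gradTrig (c t)).continuous |>.mp h2
  exact DFunLike.coe_injective h3

/-- The energy of the truncated flow. -/
noncomputable def truncEnergy (ν : ℝ) (c : ℝ → (Fin d → ℤ) → ℂ) (N : ℕ) (t : ℝ) : ℝ :=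
  ν / 2 * ((vol d)⁻¹ * ∑ k ∈ cube d N, freqNorm k ^ 4 * ‖c t k‖ ^ 2) +
    wellEnergy (gradTrig (trunc (cube d N) (c t)))

/-- The energy of the flow at positive times. -/
noncomputable def flowEnergy (ν : ℝ) (c : ℝ → (Fin d → ℤ) → ℂ) (g : ℝ → C(Torus d, Vec d))
    (t : ℝ) : ℝ :=
  ν / 2 * ((vol d)⁻¹ * ∑' k, freqNorm k ^ 4 * ‖c t k‖ ^ 2) + wellEnergy (g t)

/-- Truncation makes the energy a function of finitely many differentiable modes. It is an exact
gradient flow except that the modes are driven by the flux of `g` and not by that of its truncation;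
this commutator is what must be of order `N^{-2}`, uniformly on the time interval. -/
lemma exists_deriv_truncEnergy_le (hd : d ≤ 3) (F : MildFlow d ν c g) (hν : 0 < ν) {ε : ℝ}
    (hε : 0 < ε) (T : ℝ) :
    ∃ C, ∀ N : ℕ, 0 < N → ∀ t ∈ Set.Icc ε T,
      ∃ D, HasDerivAt (truncEnergy ν c N) D t ∧ D ≤ C * ((N : ℝ) ^ 2)⁻¹ := by
  obtain ⟨K, hK, hKb⟩ := F.exists_interior_bound hν hε T
  have hv := vol_pos d
  set Λ := Real.sqrt (∑' k : Fin d → ℤ, (freqNorm k ^ 4)⁻¹)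
  set R := max K (d * (vol d)⁻¹ * (Λ * K)) with hR
  refine ⟨(vol d)⁻¹ / 4 * (d * ((3 * (1 + R ^ 2)) ^ 2 * K ^ 2)), fun N hN t ht => ?_⟩
  have ht0 : 0 < t := hε.trans_le ht.1
  have hN' : (0 : ℝ) < N := by exact_mod_cast hN
  obtain ⟨hg, hs3⟩ := hKb t ht
  obtain ⟨hsum, hsum_le⟩ := summable_of_sob_three hd hK hs3
  set S := cube d N with hS
  set u := gradTrig (trunc S (c t)) with hu
  set c' : (Fin d → ℤ) → ℂ := fun k => divFlux (g t) k - (ν * freqNorm k ^ 4 : ℝ) * c t k with hc'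
  have hder := fun k => F.hasDerivAt_coeff ht0 k
  have hgR : ‖g t‖ ≤ R := hg.trans (le_max_left _ _)
  have huR : ‖u‖ ≤ R := by
    refine (norm_gradTrig_trunc_le hsum S).trans (le_trans ?_ (le_max_right _ _))
    gcongr
  have hW := hasDerivAt_wellEnergy (S := S) (a := fun s => trunc S (c s)) (a' := trunc S c')
    (t := t) (fun s k hk => trunc_of_notMem _ hk) (fun k hk => trunc_of_notMem _ hk)
    fun k hk => by simpa only [trunc_of_mem _ hk] using hder k
  have hQ : HasDerivAt (fun s => ν / 2 * ((vol d)⁻¹ * ∑ k ∈ S, freqNorm k ^ 4 * ‖c s k‖ ^ 2))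
      (ν / 2 * ((vol d)⁻¹ * ∑ k ∈ S, freqNorm k ^ 4 * (2 * inner ℝ (c t k) (c' k)))) t :=
    ((HasDerivAt.fun_sum fun k _ => ((hder k).norm_sq.const_mul _)).const_mul _).const_mul _
  refine ⟨_, hQ.add hW, ?_⟩
  have hsw : ∑ k ∈ S, trunc S c' k * conj (divFlux u k) = ∑ k ∈ S, c' k * conj (divFlux u k) :=
    Finset.sum_congr rfl fun k hk => by rw [trunc_of_mem _ hk]
  rw [hsw, Complex.re_sum]
  have h1 : ν / 2 * ((vol d)⁻¹ * ∑ k ∈ S, freqNorm k ^ 4 * (2 * inner ℝ (c t k) (c' k))) +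
      -((vol d)⁻¹ * ∑ k ∈ S, (c' k * conj (divFlux u k)).re) =
      (vol d)⁻¹ * ∑ k ∈ S, (c' k * conj ((ν * freqNorm k ^ 4 : ℝ) * c t k - divFlux u k)).re := by
    rw [mul_left_comm, ← mul_neg, ← mul_add, Finset.mul_sum, ← Finset.sum_neg_distrib,
      ← Finset.sum_add_distrib]
    congr 1
    refine Finset.sum_congr rfl fun k _ => ?_
    rw [Complex.inner]
    simp only [map_sub, map_mul, Complex.conj_ofReal, Complex.mul_re, Complex.sub_re,
      Complex.sub_im, Complex.mul_im, Complex.conj_re, Complex.conj_im, Complex.ofReal_re,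
      Complex.ofReal_im]
    ring
  -- The conjugated factor is the truncation error minus `c' k`. The resulting `-‖c' k‖²` is the
  -- dissipation, and Young's inequality lets it absorb the error.
  have h2 : ∀ k, (c' k * conj ((ν * freqNorm k ^ 4 : ℝ) * c t k - divFlux u k)).re ≤
      ‖divFlux (g t) k - divFlux u k‖ ^ 2 / 4 := by
    intro k
    have e : (ν * freqNorm k ^ 4 : ℝ) * c t k - divFlux u k =
        (divFlux (g t) k - divFlux u k) - c' k := by
      simp only [hc']; ring
    have h3 := re_mul_conj_le (c' k) (divFlux (g t) k - divFlux u k)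
    rw [e, map_sub, mul_sub, Complex.sub_re, Complex.mul_conj, Complex.normSq_eq_norm_sq,
      Complex.ofReal_re]
    linarith
  have h4 := sum_sq_norm_divFlux_sub_le (g t) u hgR huR N
  have hvh : ∀ k, vhat (g t - u) k = freqNorm k * ‖c t k - trunc S (c t) k‖ := fun k => by
    refine vhat_eq_of_coeff (c := fun k => c t k - trunc S (c t) k) fun j => ?_
    have := coeff_sub (integrable_component (g t) j) (integrable_component u j) k
    rw [F.coeff_grad t ht0 j k, coeff_gradTrig (summable_trunc hsum S)
      (trunc_cube_symm (F.symm t) N) j k, ← mul_sub] at this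
    exact this
  simp only [hvh] at h4
  have hs6 := summable_of_sob hs3
  have h5 := tsum_sq_tail_le hN (c := c t) hs6
  have h6 := tsum_le_of_hnorm_le (fun _ => norm_nonneg _) hK hs3
  have h7 : ∑' k, (freqNorm k * ‖c t k - trunc S (c t) k‖) ^ 2 ≤ ((N : ℝ) ^ 4)⁻¹ * K ^ 2 :=
    h5.trans (mul_le_mul_of_nonneg_left h6 (by positivity))
  rw [h1]
  calc (vol d)⁻¹ * ∑ k ∈ S, (c' k * conj ((ν * freqNorm k ^ 4 : ℝ) * c t k - divFlux u k)).re
      ≤ (vol d)⁻¹ * ∑ k ∈ S, ‖divFlux (g t) k - divFlux u k‖ ^ 2 / 4 := by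
        gcongr with k hk
        exact h2 k
    _ = (vol d)⁻¹ / 4 * ∑ k ∈ S, ‖divFlux (g t) k - divFlux u k‖ ^ 2 := by
        rw [← Finset.sum_div]; ring
    _ ≤ (vol d)⁻¹ / 4 * (d * (N : ℝ) ^ 2 * ((3 * (1 + R ^ 2)) ^ 2 * (((N : ℝ) ^ 4)⁻¹ * K ^ 2))) := by
        gcongr
        exact h4.trans (by gcongr)
    _ = _ := by
        field_simp

lemma tendsto_truncEnergy (hd : d ≤ 3) (F : MildFlow d ν c g) (hν : 0 < ν) {t : ℝ} (ht : 0 < t) :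
    Tendsto (fun N => truncEnergy ν c N t) atTop (𝓝 (flowEnergy ν c g t)) := by
  obtain ⟨K, hK, hKb⟩ := F.exists_interior_bound hν ht t
  obtain ⟨-, hs3⟩ := hKb t ⟨le_rfl, le_rfl⟩
  obtain ⟨hsum, -⟩ := summable_of_sob_three hd hK hs3
  have hs4 : Summable fun k => freqNorm k ^ 4 * ‖c t k‖ ^ 2 :=
    summable_freqNorm_of_le (by norm_num) (by norm_num) (summable_of_sob hs3)
  refine Tendsto.add (((hs4.hasSum.comp tendsto_cube).const_mul _).const_mul _) ?_
  rw [F.eq_gradTrig ht hsum]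
  exact (continuous_wellEnergy.tendsto _).comp (tendsto_gradTrig_trunc hsum)

/-- The energy does not increase at positive times. -/
theorem flowEnergy_le (hd : d ≤ 3) (F : MildFlow d ν c g) (hν : 0 < ν) {a t : ℝ} (ha : 0 < a)
    (hat : a ≤ t) : flowEnergy ν c g t ≤ flowEnergy ν c g a := by
  obtain ⟨C, hC⟩ := F.exists_deriv_truncEnergy_le hd hν ha t
  have hN : ∀ N : ℕ, 0 < N → truncEnergy ν c N t - truncEnergy ν c N a ≤
      C * ((N : ℝ) ^ 2)⁻¹ * (t - a) := by
    intro N hN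
    refine (convex_Icc a t).image_sub_le_mul_sub_of_deriv_le (f := truncEnergy ν c N)
      (fun s hs => ?_) (fun s hs => ?_) (fun s hs => ?_) a ⟨le_rfl, hat⟩ t ⟨hat, le_rfl⟩ hat
    · obtain ⟨D, hD, -⟩ := hC N hN s hs
      exact hD.continuousAt.continuousWithinAt
    · obtain ⟨D, hD, -⟩ := hC N hN s (interior_subset hs)
      exact hD.differentiableAt.differentiableWithinAt
    · obtain ⟨D, hD, hle⟩ := hC N hN s (interior_subset hs)
      rwa [hD.deriv]
  have h1 := (F.tendsto_truncEnergy hd hν (ha.trans_le hat)).sub (F.tendsto_truncEnergy hd hν ha)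
  have h0 : Tendsto (fun N : ℕ => ((N : ℝ) ^ 2)⁻¹) atTop (𝓝 0) :=
    ((tendsto_pow_atTop (by norm_num)).comp tendsto_natCast_atTop_atTop).inv_tendsto_atTop
  have h2 := (h0.const_mul C).mul_const (t - a)
  rw [mul_zero, zero_mul] at h2
  have h3 := le_of_tendsto_of_tendsto h1 h2
    ((eventually_gt_atTop 0).mono fun N h => hN N h)
  linarith

end MildFlow

end ThinFilm

namespace ThinFilm

open scoped ComplexConjugate

/-! ### The energy inequality down to the initial time -/

section QuarticBounds

variable {d : ℕ}

lemma norm_pow_four_le (v : Vec d) : ‖v‖ ^ 4 ≤ d * ∑ j, v j ^ 4 := by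
  have h2 := sq_sum_le_card_mul_sum_sq (s := (Finset.univ : Finset (Fin d))) (f := fun j => v j ^ 2)
  have e : ‖v‖ ^ 4 = (∑ j, v j ^ 2) ^ 2 := by
    rw [← EuclideanSpace.real_norm_sq_eq, ← pow_mul]
  rw [e]
  refine h2.trans (le_of_eq ?_)
  rw [Finset.card_univ, Fintype.card_fin]
  congr 1
  exact Finset.sum_congr rfl fun j _ => by ring

lemma aestronglyMeasurable_of_component {v : Torus d → Vec d} {p : ℝ≥0∞}
    (hv : ∀ j, MemLp (fun x => v x j) p volume) : AEStronglyMeasurable v volume := by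
  have h : AEMeasurable (fun x => (WithLp.ofLp (v x) : Fin d → ℝ)) volume :=
    aemeasurable_pi_lambda _ fun j => (hv j).1.aemeasurable
  exact ((WithLp.measurable_toLp 2 (Fin d → ℝ)).comp_aemeasurable h).aestronglyMeasurable

lemma integrable_pow_four {f : Torus d → ℝ} (hf : MemLp f 4 volume) :
    Integrable (fun x => f x ^ 4) volume := by
  have h := hf.integrable_norm_pow (p := 4) (by norm_num)
  refine h.congr (ae_of_all _ fun x => ?_)
  simp only [Real.norm_eq_abs]
  rw [← abs_pow, abs_of_nonneg (by positivity)]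

lemma integrable_norm_pow_four {v : Torus d → Vec d} (hv : ∀ j, MemLp (fun x => v x j) 4 volume) :
    Integrable (fun x => ‖v x‖ ^ 4) volume := by
  have h1 : Integrable (fun x => d * ∑ j, v x j ^ 4) volume :=
    (integrable_finsetSum _ fun j _ => integrable_pow_four (hv j)).const_mul _
  refine h1.mono' ((aestronglyMeasurable_of_component hv).norm.pow 4) (ae_of_all _ fun x => ?_)
  rw [Real.norm_of_nonneg (by positivity)]
  exact norm_pow_four_le (v x)

lemma integrable_well {v : Torus d → Vec d} (hv : ∀ j, MemLp (fun x => v x j) 4 volume) :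
    Integrable (fun x => (‖v x‖ ^ 2 - 1) ^ 2) volume := by
  have hm := (aestronglyMeasurable_of_component hv).norm
  refine ((integrable_norm_pow_four hv).add (integrable_const (1 : ℝ))).mono'
    (((hm.pow 2).sub aestronglyMeasurable_const).pow 2) (ae_of_all _ fun x => ?_)
  rw [Real.norm_of_nonneg (by positivity), Pi.add_apply]
  nlinarith [sq_nonneg ‖v x‖]

/-- Young's inequality with a parameter: the leading coefficient stays `1 + O(η)` and the price of
the difference is `η^{-3}` times its fourth power. The difference will be of size `η`, so this price
is still `O(η)`. -/
lemma well_sub_le (u v : Vec d) {η : ℝ} (hη : 0 < η) (hη1 : η ≤ 1) :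
    (‖u‖ ^ 2 - 1) ^ 2 ≤ (‖v‖ ^ 2 - 1) ^ 2 + η * ((‖v‖ ^ 2 - 1) ^ 2 + 8 * ‖v‖ ^ 4) +
      12 * (η ^ 3)⁻¹ * ‖u - v‖ ^ 4 := by
  set a := ‖u‖
  set b := ‖v‖
  set w := ‖u - v‖
  have hb : 0 ≤ b := norm_nonneg _
  have ha : 0 ≤ a := norm_nonneg _
  have hw : 0 ≤ w := norm_nonneg _
  have h1 : |a - b| ≤ w := abs_norm_sub_norm_le u v
  have hab : a + b ≤ w + 2 * b := by linarith [(abs_le.mp h1).2]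
  have h2 : (a ^ 2 - b ^ 2) ^ 2 ≤ 2 * w ^ 4 + 8 * (w ^ 2 * b ^ 2) := by
    calc (a ^ 2 - b ^ 2) ^ 2 = |a - b| ^ 2 * (a + b) ^ 2 := by rw [sq_abs]; ring
      _ ≤ w ^ 2 * (w + 2 * b) ^ 2 := by gcongr
      _ ≤ _ := by nlinarith [mul_nonneg (sq_nonneg w) (sq_nonneg (w - 2 * b))]
  have hη3 : η ^ 3 * (η ^ 3)⁻¹ = 1 := mul_inv_cancel₀ (by positivity)
  have h3 : η * (a ^ 2 - 1) ^ 2 ≤ η * ((1 + η) * (b ^ 2 - 1) ^ 2) + (1 + η) * (a ^ 2 - b ^ 2) ^ 2 := by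
    nlinarith [sq_nonneg (η * (b ^ 2 - 1) - (a ^ 2 - b ^ 2))]
  have h4 : η ^ 2 * (8 * (w ^ 2 * b ^ 2)) ≤ 4 * w ^ 4 + 4 * (η ^ 4 * b ^ 4) := by
    nlinarith [sq_nonneg (w ^ 2 - η ^ 2 * b ^ 2)]
  have h5 : η ^ 3 * (a ^ 2 - 1) ^ 2 ≤
      η ^ 3 * ((b ^ 2 - 1) ^ 2 + η * ((b ^ 2 - 1) ^ 2 + 8 * b ^ 4)) + 12 * w ^ 4 := by
    have hη2 : η ^ 2 ≤ 1 := pow_le_one₀ hη.le hη1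
    have h6 : η ^ 2 * (a ^ 2 - b ^ 2) ^ 2 ≤ 6 * w ^ 4 + 4 * (η ^ 4 * b ^ 4) := by
      have := mul_le_mul_of_nonneg_left h2 (sq_nonneg η)
      nlinarith [mul_le_mul_of_nonneg_right hη2 (by positivity : (0:ℝ) ≤ 2 * w ^ 4)]
    have h7 : (1 + η) * (η ^ 2 * (a ^ 2 - b ^ 2) ^ 2) ≤ 2 * (6 * w ^ 4 + 4 * (η ^ 4 * b ^ 4)) :=
      mul_le_mul (by linarith) h6 (by positivity) (by norm_num)
    have h8 := mul_le_mul_of_nonneg_left h3 (sq_nonneg η)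
    nlinarith
  have h9 := mul_le_mul_of_nonneg_left h5 (show 0 ≤ (η ^ 3)⁻¹ by positivity)
  rw [mul_add, ← mul_assoc, ← mul_assoc, mul_comm (η ^ 3)⁻¹, hη3, one_mul, one_mul] at h9
  linarith

lemma integral_well_le {u v : Torus d → Vec d} (hu : ∀ j, MemLp (fun x => u x j) 4 volume)
    (hv : ∀ j, MemLp (fun x => v x j) 4 volume) {η : ℝ} (hη : 0 < η) (hη1 : η ≤ 1) :
    ∫ x, (‖u x‖ ^ 2 - 1) ^ 2 ≤ (∫ x, (‖v x‖ ^ 2 - 1) ^ 2) +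
      η * ((∫ x, (‖v x‖ ^ 2 - 1) ^ 2) + 8 * ∫ x, ‖v x‖ ^ 4) +
      12 * (η ^ 3)⁻¹ * ∫ x, ‖u x - v x‖ ^ 4 := by
  have i1 := integrable_well hv
  have i2 := integrable_norm_pow_four hv
  have i3 : Integrable (fun x => ‖u x - v x‖ ^ 4) volume :=
    integrable_norm_pow_four (v := fun x => u x - v x) fun j => (hu j).sub (hv j)
  have i4 := i1.add (i2.const_mul 8)
  have h := integral_mono (integrable_well hu) ((i1.add (i4.const_mul η)).add
    (i3.const_mul (12 * (η ^ 3)⁻¹))) fun x => well_sub_le (u x) (v x) hη hη1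
  refine h.trans (le_of_eq ?_)
  rw [integral_add' (i1.add (i4.const_mul η)) (i3.const_mul _), integral_add' i1 (i4.const_mul η),
    integral_const_mul, integral_const_mul]
  congr 3
  rw [integral_add' i1 (i2.const_mul 8), integral_const_mul]

/-- The L⁴ embedding is applied to each component. A gradient component has mean zero because its
symbol vanishes at `k = 0`. One factor `d` comes from `norm_pow_four_le`, the other from the number
of components. -/
lemma exists_quartic_bound (hd : d ≤ 3) : ∃ C, 0 ≤ C ∧ ∀ (v : Torus d → Vec d)
    (b : (Fin d → ℤ) → ℂ), (∀ j, MemLp (fun x => v x j) 2 volume) →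
    (∀ j k, coeff (fun x => v x j) k = Complex.I * (k j : ℂ) * b k) →
    (Summable fun k => freqNorm k ^ 4 * ‖b k‖ ^ 2) →
    (∀ j, MemLp (fun x => v x j) 4 volume) ∧
      ∫ x, ‖v x‖ ^ 4 ≤ C * (∑' k, freqNorm k ^ 4 * ‖b k‖ ^ 2) ^ 2 := by
  set Λ := (vol d)⁻¹ ^ 3 * ∑' k : Fin d → ℤ, (freqNorm k ^ 4)⁻¹
  have hv0 := vol_pos d
  have hΛ : 0 ≤ Λ := mul_nonneg (by positivity) (tsum_nonneg fun k => by
    have := freqNorm_nonneg k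
    positivity)
  refine ⟨d * (d * Λ), by positivity, fun v b hv hb hs => ?_⟩
  have hle : ∀ j k, freqNorm k ^ 2 * ‖coeff (fun x => v x j) k‖ ^ 2 ≤
      freqNorm k ^ 4 * ‖b k‖ ^ 2 := fun j k => by
    rw [hb]
    have h1 := norm_component_le b j k
    calc _ ≤ freqNorm k ^ 2 * (freqNorm k * ‖b k‖) ^ 2 := by gcongr
      _ = _ := by ring
  have hsj : ∀ j, Summable fun k => freqNorm k ^ 2 * ‖coeff (fun x => v x j) k‖ ^ 2 := fun j =>
    hs.of_nonneg_of_le (fun k => by positivity) (hle j)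
  have h4 : ∀ j, _ := fun j => memLp_four_of_summable hd (hv j) (by rw [hb]; simp) (hsj j)
  refine ⟨fun j => (h4 j).1, ?_⟩
  have hj : ∀ j, ∫ x, v x j ^ 4 ≤ Λ * (∑' k, freqNorm k ^ 4 * ‖b k‖ ^ 2) ^ 2 := fun j => by
    refine (h4 j).2.trans (mul_le_mul_of_nonneg_left ?_ hΛ)
    refine pow_le_pow_left₀ (tsum_nonneg fun k => by positivity) ?_ 2
    exact (hsj j).tsum_le_tsum (hle j) hs
  calc ∫ x, ‖v x‖ ^ 4 ≤ ∫ x, d * ∑ j, v x j ^ 4 :=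
        integral_mono (integrable_norm_pow_four fun j => (h4 j).1)
          ((integrable_finsetSum _ fun j _ => integrable_pow_four (h4 j).1).const_mul _)
          fun x => norm_pow_four_le (v x)
    _ = d * ∑ j, ∫ x, v x j ^ 4 := by
        rw [integral_const_mul, integral_finsetSum _ fun j _ => integrable_pow_four (h4 j).1]
    _ ≤ d * ∑ _j : Fin d, Λ * (∑' k, freqNorm k ^ 4 * ‖b k‖ ^ 2) ^ 2 := by
        gcongr with j _
        exact hj j
    _ = _ := by
        rw [Finset.sum_const, Finset.card_univ, Fintype.card_fin, nsmul_eq_mul]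
        ring

/-- The L⁴ bound on the gradient makes the well term integrable, so the energy is a genuine integral
and splits into its two parts. -/
lemma energy_eq (hd : d ≤ 3) {h₀ : Torus d → ℝ} (hh₀ : MemSobolev 2 h₀) (ν : ℝ) :
    (∀ j, MemLp (fun x => grad h₀ x j) 4 volume) ∧ energy ν h₀ =
      ν / 2 * ((vol d)⁻¹ * ∑' k, freqNorm k ^ 4 * ‖coeff h₀ k‖ ^ 2) +
        1 / 4 * ∫ x, (‖grad h₀ x‖ ^ 2 - 1) ^ 2 := by
  have hs := summable_of_memSobolev (n := 4) (by norm_num) (by norm_num) hh₀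
  have hs2 := summable_freqNorm_of_le (m := 2) (by norm_num) (by norm_num) hs
  obtain ⟨C, -, hC⟩ := exists_quartic_bound hd
  have h4 := (hC (grad h₀) (coeff h₀) (fun j => (memLp_grad_component hs2 j).1)
    (fun j => (memLp_grad_component hs2 j).2) hs).1
  refine ⟨h4, ?_⟩
  have hl := (memLp_lap hs).1.integrable_sq
  rw [energy, integral_add (hl.const_mul _) ((integrable_well h4).const_mul _), integral_const_mul,
    integral_const_mul, (hasSum_lap hs).tsum_eq, inv_mul_cancel_left₀ (vol_pos d).ne']
  ring

end QuarticBounds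

/-! ### Attainment of the datum in H² and the energy inequality from time zero. -/

namespace MildFlow

variable {d : ℕ} {ν : ℝ} {c : ℝ → (Fin d → ℤ) → ℂ} {g : ℝ → C(Torus d, Vec d)}

/-- The flow attains its initial datum in `H²`. -/
lemma exists_hnorm_sub_le (F : MildFlow d ν c g) (hν : 0 < ν) {ε : ℝ} (hε : 0 < ε) :
    ∃ t, 0 < t ∧ t ≤ ε ∧ hnorm 2 (fun k => ‖c t k - c 0 k‖) ≤ ENNReal.ofReal ε := by
  obtain ⟨T, hT, hduh⟩ := F.exists_hnorm_duh_le hν (half_pos hε)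
  have hs : Summable fun k => freqNorm k ^ 4 * ‖c 0 k‖ ^ 2 :=
    summable_of_hnorm_ne_top (n := 2) (fun _ => norm_nonneg _) F.data
  have hle : ∀ t, 0 < t → ∀ k, freqNorm k ^ 4 * ((1 - decay ν t k) * ‖c 0 k‖) ^ 2 ≤
      freqNorm k ^ 4 * ‖c 0 k‖ ^ 2 := fun t ht k => by
    have h0 := decay_nonneg ν t k
    have h1 := decay_le_one hν.le ht.le k
    have h2 := freqNorm_nonneg k
    refine mul_le_mul_of_nonneg_left (pow_le_pow_left₀
      (mul_nonneg (by linarith) (norm_nonneg _)) ?_ 2) (by positivity)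
    exact mul_le_of_le_one_left (norm_nonneg _) (by linarith)
  have hlim : Tendsto (fun t => ∑' k, freqNorm k ^ 4 * ((1 - decay ν t k) * ‖c 0 k‖) ^ 2)
      (𝓝[>] 0) (𝓝 (∑' _k : Fin d → ℤ, (0 : ℝ))) := by
    refine tendsto_tsum_of_dominated_convergence hs (fun k => ?_) ?_
    · have hc : Continuous fun t => freqNorm k ^ 4 * ((1 - decay ν t k) * ‖c 0 k‖) ^ 2 := by
        unfold decay
        fun_prop
      have h := hc.tendsto 0
      simp only [decay, mul_zero, zero_mul, neg_zero, Real.exp_zero, sub_self] at h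
      simp only [decay]
      norm_num at h
      exact h.mono_left nhdsWithin_le_nhds
    · filter_upwards [self_mem_nhdsWithin] with t ht k
      have h2 := freqNorm_nonneg k
      rw [Real.norm_of_nonneg (by positivity)]
      exact hle t ht k
  rw [tsum_zero] at hlim
  have hev := (hlim.eventually (gt_mem_nhds (show (0 : ℝ) < (ε / 2) ^ 2 by positivity))).and
    (Ioc_mem_nhdsGT (lt_min hT hε))
  obtain ⟨t, hsmall, ht⟩ := hev.exists
  have ht1 : t ∈ Set.Ioc 0 T := ⟨ht.1, ht.2.trans (min_le_left _ _)⟩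
  refine ⟨t, ht.1, ht.2.trans (min_le_right _ _), ?_⟩
  have hd0 : ∀ k, 0 ≤ (1 - decay ν t k) * ‖c 0 k‖ := fun k =>
    mul_nonneg (by linarith [decay_le_one hν.le ht.1.le k]) (norm_nonneg _)
  have h1 : ∀ k, ‖c t k - c 0 k‖ ≤ (1 - decay ν t k) * ‖c 0 k‖ + ‖duh ν c 0 t k‖ := fun k => by
    have e : c t k - c 0 k = duh ν c 0 t k - ((1 - decay ν t k : ℝ) : ℂ) * c 0 k := by
      rw [duh, sub_zero]; push_cast; ring
    rw [e, add_comm]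
    refine (norm_sub_le _ _).trans (le_of_eq ?_)
    rw [norm_mul, Complex.norm_real,
      Real.norm_of_nonneg (by linarith [decay_le_one hν.le ht.1.le k])]
  have h2 : hnorm 2 (fun k => (1 - decay ν t k) * ‖c 0 k‖) ≤ ENNReal.ofReal (ε / 2) := by
    rw [hnorm_eq_of_hasSum (n := 2) hd0 (hs.of_nonneg_of_le (fun k => by
      have := freqNorm_nonneg k; positivity) (hle t ht.1)).hasSum]
    refine ENNReal.ofReal_le_ofReal (Real.sqrt_le_iff.mpr ⟨by positivity, hsmall.le⟩)
  calc _ ≤ ENNReal.ofReal (ε / 2) + ENNReal.ofReal (ε / 2) :=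
        (hnorm_mono h1).trans ((hnorm_add_le 2 hd0 fun _ => norm_nonneg _).trans
          (add_le_add h2 (hduh t ht1)))
    _ = _ := by rw [← ENNReal.ofReal_add (by positivity) (by positivity), add_halves]

/-- The energy inequality. -/
theorem flowEnergy_le_energy (hd : d ≤ 3) {h₀ : Torus d → ℝ} (hh₀ : MemSobolev 2 h₀)
    (F : MildFlow d ν c g) (hν : 0 < ν) (hc : ∀ k, c 0 k = coeff h₀ k) {t : ℝ} (ht : 0 < t) :
    flowEnergy ν c g t ≤ energy ν h₀ := by
  have hv0 := vol_pos d
  obtain ⟨h4, hE⟩ := energy_eq hd hh₀ ν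
  have hs := summable_of_memSobolev (n := 4) (by norm_num) (by norm_num) hh₀
  have hs2 := summable_freqNorm_of_le (m := 2) (by norm_num) (by norm_num) hs
  obtain ⟨C, hC0, hC⟩ := exists_quartic_bound hd
  set X := ∑' k, freqNorm k ^ 4 * ‖coeff h₀ k‖ ^ 2 with hX
  set W := ∫ x, (‖grad h₀ x‖ ^ 2 - 1) ^ 2
  set V := ∫ x, ‖grad h₀ x‖ ^ 4
  have hX0 : 0 ≤ X := tsum_nonneg fun k => by have := freqNorm_nonneg k; positivity
  -- At some time `s ≤ η` the flow is `η`-close to the datum in H². The fourth power of the gradient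
  -- difference is then `O(η⁴)`, which outweighs the factor `η^{-3}`; `η → 0` gives the claim.
  have key : ∀ η ∈ Set.Ioc (0 : ℝ) (min 1 t), flowEnergy ν c g t ≤
      ν / 2 * ((vol d)⁻¹ * (Real.sqrt X + η) ^ 2) +
        1 / 4 * (W + η * (W + 8 * V) + 12 * C * η) := by
    intro η hη
    have hη1 : η ≤ 1 := hη.2.trans (min_le_left _ _)
    obtain ⟨s, hs0, hsη, hdiff⟩ := F.exists_hnorm_sub_le hν hη.1
    refine (F.flowEnergy_le hd hν hs0 (hsη.trans (hη.2.trans (min_le_right _ _)))).trans ?_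
    have hdS := summable_of_hnorm_ne_top (fun _ => norm_nonneg _)
      (hdiff.trans_lt ENNReal.ofReal_lt_top).ne
    have hdle := tsum_le_of_hnorm_le (fun _ => norm_nonneg _) hη.1.le hdiff
    have hX2 : hnorm 2 (fun k => ‖c 0 k‖) = ENNReal.ofReal (Real.sqrt X) := by
      simp only [hc]
      exact hnorm_eq_of_hasSum (n := 2) (fun _ => norm_nonneg _) hs.hasSum
    have hsob : sob c 2 s ≤ ENNReal.ofReal (Real.sqrt X + η) := by
      rw [ENNReal.ofReal_add (Real.sqrt_nonneg _) hη.1.le, ← hX2]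
      refine le_trans (hnorm_mono fun k => ?_) ((hnorm_add_le 2 (fun _ => norm_nonneg _)
        fun _ => norm_nonneg _).trans (add_le_add le_rfl hdiff))
      calc ‖c s k‖ = ‖c 0 k + (c s k - c 0 k)‖ := by rw [add_sub_cancel]
        _ ≤ _ := norm_add_le _ _
    have hquad := tsum_le_of_hnorm_le (n := 2) (fun _ => norm_nonneg _)
      (add_nonneg (Real.sqrt_nonneg _) hη.1.le) hsob
    have hw := (hC (fun x => g s x - grad h₀ x) (fun k => c s k - c 0 k)
      (fun j => (memLp_component (g s) j 2).sub (memLp_grad_component hs2 j).1) (fun j k => by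
        have := coeff_sub (integrable_component (g s) j)
          ((memLp_grad_component hs2 j).1.integrable (by norm_num)) k
        rw [F.coeff_grad s hs0 j k, (memLp_grad_component hs2 j).2, ← hc, ← mul_sub] at this
        exact this) hdS).2
    have hd4 : C * (∑' k, freqNorm k ^ (2 * 2) * ‖c s k - c 0 k‖ ^ 2) ^ 2 ≤ C * (η ^ 2) ^ 2 :=
      mul_le_mul_of_nonneg_left (pow_le_pow_left₀ (tsum_nonneg fun k => by
        have := freqNorm_nonneg k; positivity) hdle 2) hC0
    have hwell := integral_well_le (fun j => memLp_component (g s) j 4) h4 hη.1 hη1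
    have h12 : 12 * (η ^ 3)⁻¹ * ∫ x, ‖g s x - grad h₀ x‖ ^ 4 ≤ 12 * C * η := by
      have hη0 := hη.1
      calc _ ≤ 12 * (η ^ 3)⁻¹ * (C * (η ^ 2) ^ 2) :=
            mul_le_mul_of_nonneg_left (hw.trans hd4) (by positivity)
        _ = _ := by field_simp
    rw [flowEnergy, wellEnergy_eq, integral_const_mul]
    refine add_le_add (mul_le_mul_of_nonneg_left (mul_le_mul_of_nonneg_left hquad
      (by positivity)) (by positivity)) (mul_le_mul_of_nonneg_left ?_ (by norm_num))
    linarith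
  have hcont : Continuous fun η : ℝ => ν / 2 * ((vol d)⁻¹ * (Real.sqrt X + η) ^ 2) +
      1 / 4 * (W + η * (W + 8 * V) + 12 * C * η) := by fun_prop
  have hlim := (hcont.tendsto 0).mono_left (nhdsWithin_le_nhds (s := Set.Ioi 0))
  have h0 := ge_of_tendsto hlim (by
    filter_upwards [Ioc_mem_nhdsGT (lt_min one_pos ht)] with η hη using key η hη)
  refine h0.trans (le_of_eq ?_)
  rw [hE, add_zero, Real.sq_sqrt hX0]
  ring

end MildFlow

end ThinFilm

namespace ThinFilm

namespace MildFlow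

/-! ### Smoothing of the gradient under the energy bounds -/

section Smoothing

variable {d : ℕ} {ν : ℝ} {c : ℝ → (Fin d → ℤ) → ℂ} {g : ℝ → C(Torus d, Vec d)}

lemma ofReal_norm_le_anorm (hd : d ≤ 3) (F : MildFlow d ν c g) (hν : 0 < ν) {t : ℝ} (ht : 0 < t) :
    ENNReal.ofReal ‖g t‖ ≤ ENNReal.ofReal (d * (vol d)⁻¹) * anorm fun k => ‖c t k‖ := by
  have hv := vol_pos d
  obtain ⟨K, hK, hKb⟩ := F.exists_interior_bound hν ht t
  obtain ⟨hs, -⟩ := summable_of_sob_three hd hK (hKb t ⟨le_rfl, le_rfl⟩).2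
  rw [anorm_eq_of_summable (fun _ => norm_nonneg _) hs, ← ENNReal.ofReal_mul (by positivity),
    F.eq_gradTrig ht hs]
  exact ENNReal.ofReal_le_ofReal (norm_gradTrig_le hs)

lemma anorm_le_decay_add_duh (a t : ℝ) :
    (anorm fun k => ‖c t k‖) ≤ anorm (fun k => decay ν (t - a) k * ‖c a k‖) +
      anorm fun k => ‖duh ν c a t k‖ := by
  refine le_trans ?_ (anorm_add_le (fun _ => mul_nonneg (decay_nonneg _ _ _) (norm_nonneg _))
    fun _ => norm_nonneg _)
  exact anorm_mono fun k => norm_le_decay_add_duh a t k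

variable {A B : ℝ}

/-- One pass of the iteration: a gradient bound with a mild singularity `Q` and a strong one `b` is
inserted in Duhamel. Both terms come back improved by the factor `(t-a)^{1/8}` left over from the
kernel of order `7/8`. -/
lemma anorm_duh_le_of_bound (hd : d ≤ 3) (F : MildFlow d ν c g) (hν : 0 < ν) (hB0 : 0 ≤ B)
    (hB : ∀ s, 0 < s → hnorm 0 (vhat (fluxC (g s))) ≤ ENNReal.ofReal (B * ‖g s‖))
    {γ Q b a t : ℝ} (hγ : 0 ≤ γ) (hγ8 : γ ≤ 1 / 8) (hQ : 0 ≤ Q) (hb : 0 ≤ b) (ha : 0 ≤ a)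
    (hat : a < t) (hνt : ν * (t - a) ≤ 1)
    (hg : ∀ s ∈ Set.Ioc a t, ‖g s‖ ≤ Q * (s - a) ^ (-γ) + b * (s - a) ^ (-(1 / 4) : ℝ)) :
    (anorm fun k => ‖duh ν c a t k‖) ≤ ENNReal.ofReal (361 * B * ν ^ (-(7 / 8) : ℝ) *
      (Q * (t - a) ^ (1 / 8 - γ) + b * (t - a) ^ (-(1 / 8) : ℝ))) := by
  have hduh := F.anorm_duh_le hd hν ha hat.le hνt
  have hpt : ∀ s ∈ Set.Ioc a t, ENNReal.ofReal (19 * (ν * (t - s)) ^ (-(7 / 8) : ℝ)) *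
      hnorm 0 (vhat (fluxC (g s))) ≤
      ENNReal.ofReal ((ν * (t - s)) ^ (-(7 / 8) : ℝ)) *
        ENNReal.ofReal (19 * B * Q * (s - a) ^ (-γ)) +
      ENNReal.ofReal ((ν * (t - s)) ^ (-(7 / 8) : ℝ)) *
        ENNReal.ofReal (19 * B * b * (s - a) ^ (-(1 / 4) : ℝ)) := by
    intro s hs
    have hs0 : 0 < s := ha.trans_lt hs.1
    have hsa : 0 < s - a := sub_pos.mpr hs.1
    have h0 : 0 ≤ (ν * (t - s)) ^ (-(7 / 8) : ℝ) :=
      Real.rpow_nonneg (mul_nonneg hν.le (sub_nonneg.mpr hs.2)) _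
    rw [← mul_add]
    refine (mul_le_mul_right (hB s hs0) _).trans ?_
    rw [← ENNReal.ofReal_add (by positivity) (by positivity), ← ENNReal.ofReal_mul (by positivity),
      ← ENNReal.ofReal_mul h0]
    refine ENNReal.ofReal_le_ofReal ?_
    have h1 := mul_le_mul_of_nonneg_left (hg s hs) hB0
    have h2 := mul_le_mul_of_nonneg_left h1 h0
    linarith
  have hint := setLIntegral_mono' (μ := volume) measurableSet_Ioc hpt
  rw [lintegral_add_left (by fun_prop)] at hint
  have i1 := lintegral_kernel_le hν hat (p := 7 / 8) (q := γ) (by norm_num) (by norm_num)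
    hγ (by linarith) (B := 19 * B * Q) (by positivity)
  have i2 := lintegral_kernel_le hν hat (p := 7 / 8) (q := 1 / 4) (by norm_num) (by norm_num)
    (by norm_num) (by norm_num) (B := 19 * B * b) (by positivity)
  refine hduh.trans (hint.trans ((add_le_add i1 i2).trans ?_))
  have hx : 0 < t - a := sub_pos.mpr hat
  have hνp := Real.rpow_pos_of_pos hν (-(7 / 8) : ℝ)
  have e1 : (1 - 7 / 8 - γ : ℝ) = 1 / 8 - γ := by ring
  have e2 : (1 - 7 / 8 - 1 / 4 : ℝ) = -(1 / 8) := by norm_num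
  have hγ1 : 0 < 1 - γ := by linarith
  -- The bound is `3 + 16`; with the `19` of the kernel estimate this gives the constant `361`.
  have hk1 : 2 / (1 - γ) + 2 / (1 - 7 / 8) ≤ (19 : ℝ) := by
    have : 2 / (1 - γ) ≤ 3 := (div_le_iff₀ hγ1).mpr (by linarith)
    linarith
  have hk2 : 2 / (1 - 1 / 4) + 2 / (1 - 7 / 8) ≤ (19 : ℝ) := by norm_num
  have hp1 := Real.rpow_pos_of_pos hx (1 / 8 - γ)
  have hp2 := Real.rpow_pos_of_pos hx (-(1 / 8) : ℝ)
  rw [e1, e2, ← ENNReal.ofReal_add (by norm_num; positivity) (by norm_num; positivity)]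
  refine ENNReal.ofReal_le_ofReal ?_
  have h1 : ν ^ (-(7 / 8) : ℝ) * (19 * B * Q) * (2 / (1 - γ) + 2 / (1 - 7 / 8)) *
      (t - a) ^ (1 / 8 - γ) ≤ ν ^ (-(7 / 8) : ℝ) * (19 * B * Q) * 19 * (t - a) ^ (1 / 8 - γ) := by
    gcongr
  have h2 : ν ^ (-(7 / 8) : ℝ) * (19 * B * b) * (2 / (1 - 1 / 4) + 2 / (1 - 7 / 8)) *
      (t - a) ^ (-(1 / 8) : ℝ) ≤
      ν ^ (-(7 / 8) : ℝ) * (19 * B * b) * 19 * (t - a) ^ (-(1 / 8) : ℝ) := by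
    gcongr
  linarith

/-- Smoothing on a short time interval. -/
theorem norm_le_of_energy (hd : d ≤ 3) (F : MildFlow d ν c g) (hν : 0 < ν) (hA0 : 0 ≤ A)
    (hB0 : 0 ≤ B) (hA : ∀ s, 0 ≤ s → sob c 2 s ≤ ENNReal.ofReal A)
    (hB : ∀ s, 0 < s → hnorm 0 (vhat (fluxC (g s))) ≤ ENNReal.ofReal (B * ‖g s‖))
    {γ L a δ : ℝ} (hγ : 0 ≤ γ) (hγ8 : γ ≤ 1 / 8) (hL : 0 ≤ L)
    (hlat : ∀ b : ℝ, 0 < b → b ≤ 1 → ∑' k : Fin d → ℤ, ENNReal.ofReal ((freqNorm k ^ 2)⁻¹ *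
      Real.exp (-(b * freqNorm k ^ 4))) ≤ ENNReal.ofReal ((L * b ^ (-γ)) ^ 2))
    (ha : 0 ≤ a) (hνδ : ν * δ ≤ 1)
    (hsmall : 722 * (d * (vol d)⁻¹) * B * ν ^ (-(7 / 8) : ℝ) * δ ^ (1 / 8 : ℝ) ≤ 1) :
    ∀ t ∈ Set.Ioc a (a + δ),
      ‖g t‖ ≤ 2 * (d * (vol d)⁻¹ * L * A) * ν ^ (-γ) * (t - a) ^ (-γ) := by
  have hv := vol_pos d
  obtain ⟨M, hM, hMb⟩ := F.exists_bound (a + δ)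
  set D : ℝ := d * (vol d)⁻¹ with hD
  have hD0 : 0 ≤ D := by positivity
  have hνγ := Real.rpow_pos_of_pos hν (-γ)
  have hν7 := Real.rpow_pos_of_pos hν (-(7 / 8) : ℝ)
  set P : ℝ := D * L * A * ν ^ (-γ) with hP
  have hP0 : 0 ≤ P := by positivity
  have hmain : ∀ s ∈ Set.Ioc a (a + δ), ENNReal.ofReal ‖g s‖ ≤
      ENNReal.ofReal (2 * P * (s - a) ^ (-γ)) := by
    -- The target is twice the linear contribution. The rough bound starts from `s^{-1/4} ≤
    -- (s-a)^{-1/4}`, and its constant `M` leaves no trace in the result.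
    refine le_of_halving (u := fun s => 2 * P * (s - a) ^ (-γ))
      (v := fun s => (s - a) ^ (-(1 / 4) : ℝ)) hM (fun s hs => ENNReal.ofReal_le_ofReal ?_) ?_
    · have hsa : 0 < s - a := sub_pos.mpr hs.1
      have h1 : 0 ≤ 2 * P * (s - a) ^ (-γ) := by positivity
      have h2 := hMb s ⟨ha.trans_lt hs.1, hs.2⟩
      have h3 : s ^ (-(1 / 4) : ℝ) ≤ (s - a) ^ (-(1 / 4) : ℝ) :=
        Real.rpow_le_rpow_of_nonpos hsa (by linarith) (by norm_num)
      have := mul_le_mul_of_nonneg_left h3 hM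
      linarith
    · intro b hb ih t ht
      have hx : 0 < t - a := sub_pos.mpr ht.1
      have hxδ : t - a ≤ δ := by linarith [ht.2]
      have hνx : ν * (t - a) ≤ 1 := (mul_le_mul_of_nonneg_left hxδ hν.le).trans hνδ
      have hduh := F.anorm_duh_le_of_bound hd hν hB0 hB hγ hγ8 (Q := 2 * P) (b := b) (by positivity)
        hb ha ht.1 hνx fun s hs => by
          have hsa : 0 < s - a := sub_pos.mpr hs.1
          exact (ENNReal.ofReal_le_ofReal_iff (by positivity)).mp (ih s ⟨hs.1, hs.2.trans ht.2⟩)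
      have hlin := anorm_decay_le (mul_pos hν hx) (fun k => ‖c a k‖)
        (B := L * (ν * (t - a)) ^ (-γ)) (by positivity) (hlat _ (mul_pos hν hx) hνx)
      have hlin2 := hlin.trans (mul_le_mul_right (hA a ha) _)
      rw [← ENNReal.ofReal_mul (by positivity)] at hlin2
      have h1 := (F.ofReal_norm_le_anorm hd hν (ha.trans_lt ht.1)).trans
        (mul_le_mul_right ((anorm_le_decay_add_duh (ν := ν) a t).trans (add_le_add hlin2 hduh)) _)
      rw [← ENNReal.ofReal_add (by positivity) (by positivity), ← ENNReal.ofReal_mul hD0] at h1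
      refine h1.trans (ENNReal.ofReal_le_ofReal ?_)
      set x := t - a
      -- The constant `722 = 2 · 361` in the smallness condition makes the Duhamel part contribute
      -- at most half of any bound inserted.
      have hs : 361 * D * B * ν ^ (-(7 / 8) : ℝ) * x ^ (1 / 8 : ℝ) ≤ 1 / 2 := by
        have h2 : x ^ (1 / 8 : ℝ) ≤ δ ^ (1 / 8 : ℝ) := Real.rpow_le_rpow hx.le hxδ (by norm_num)
        have h3 := mul_le_mul_of_nonneg_left h2 (show 0 ≤ 722 * D * B * ν ^ (-(7 / 8) : ℝ) by
          positivity)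
        linarith
      have e1 : x ^ (1 / 8 - γ) = x ^ (1 / 8 : ℝ) * x ^ (-γ) := by
        rw [← Real.rpow_add hx]; ring_nf
      have e2 : x ^ (-(1 / 8) : ℝ) = x ^ (1 / 8 : ℝ) * x ^ (-(1 / 4) : ℝ) := by
        rw [← Real.rpow_add hx]; norm_num
      have e3 : (ν * x) ^ (-γ) = ν ^ (-γ) * x ^ (-γ) := Real.mul_rpow hν.le hx.le
      have hγx := Real.rpow_pos_of_pos hx (-γ)
      have hqx := Real.rpow_pos_of_pos hx (-(1 / 4) : ℝ)
      calc D * (L * (ν * x) ^ (-γ) * A + 361 * B * ν ^ (-(7 / 8) : ℝ) *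
            (2 * P * x ^ (1 / 8 - γ) + b * x ^ (-(1 / 8) : ℝ)))
          = P * x ^ (-γ) + 361 * D * B * ν ^ (-(7 / 8) : ℝ) * x ^ (1 / 8 : ℝ) *
            (2 * P * x ^ (-γ) + b * x ^ (-(1 / 4) : ℝ)) := by
              rw [e1, e2, e3, hP]; ring
        _ ≤ P * x ^ (-γ) + 1 / 2 * (2 * P * x ^ (-γ) + b * x ^ (-(1 / 4) : ℝ)) := by gcongr
        _ = _ := by ring
  intro t ht
  have hx : 0 < t - a := sub_pos.mpr ht.1
  have h := (ENNReal.ofReal_le_ofReal_iff (by positivity)).mp (hmain t ht)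
  refine h.trans (le_of_eq ?_)
  rw [hP]; ring

/-- The gradient bound just obtained is fed back once more, now without the strong singularity (`b =
0`); the remaining power `δ^{1/8-γ}` is nonnegative. -/
theorem anorm_duh_le_of_energy (hd : d ≤ 3) (F : MildFlow d ν c g) (hν : 0 < ν) (hA0 : 0 ≤ A)
    (hB0 : 0 ≤ B) (hA : ∀ s, 0 ≤ s → sob c 2 s ≤ ENNReal.ofReal A)
    (hB : ∀ s, 0 < s → hnorm 0 (vhat (fluxC (g s))) ≤ ENNReal.ofReal (B * ‖g s‖))
    {γ L a δ : ℝ} (hγ : 0 ≤ γ) (hγ8 : γ ≤ 1 / 8) (hL : 0 ≤ L)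
    (hlat : ∀ b : ℝ, 0 < b → b ≤ 1 → ∑' k : Fin d → ℤ, ENNReal.ofReal ((freqNorm k ^ 2)⁻¹ *
      Real.exp (-(b * freqNorm k ^ 4))) ≤ ENNReal.ofReal ((L * b ^ (-γ)) ^ 2))
    (ha : 0 ≤ a) (hνδ : ν * δ ≤ 1)
    (hsmall : 722 * (d * (vol d)⁻¹) * B * ν ^ (-(7 / 8) : ℝ) * δ ^ (1 / 8 : ℝ) ≤ 1) :
    ∀ t ∈ Set.Ioc a (a + δ), (anorm fun k => ‖duh ν c a t k‖) ≤
      ENNReal.ofReal (722 * (d * (vol d)⁻¹) * L * A * B * ν ^ (-(7 / 8) - γ) *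
        δ ^ (1 / 8 - γ)) := by
  intro t ht
  have hv := vol_pos d
  have hx : 0 < t - a := sub_pos.mpr ht.1
  have hxδ : t - a ≤ δ := by linarith [ht.2]
  have hνγ := Real.rpow_pos_of_pos hν (-γ)
  have hν7 := Real.rpow_pos_of_pos hν (-(7 / 8) : ℝ)
  have hg := F.norm_le_of_energy hd hν hA0 hB0 hA hB hγ hγ8 hL hlat ha hνδ hsmall
  refine (F.anorm_duh_le_of_bound hd hν hB0 hB hγ hγ8 (b := 0)
    (Q := 2 * (d * (vol d)⁻¹ * L * A) * ν ^ (-γ)) (by positivity) le_rfl ha ht.1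
    ((mul_le_mul_of_nonneg_left hxδ hν.le).trans hνδ) fun s hs => ?_).trans ?_
  · rw [zero_mul, add_zero]
    exact hg s ⟨hs.1, hs.2.trans ht.2⟩
  · refine ENNReal.ofReal_le_ofReal ?_
    have h1 : (t - a) ^ (1 / 8 - γ) ≤ δ ^ (1 / 8 - γ) :=
      Real.rpow_le_rpow hx.le hxδ (by linarith)
    rw [zero_mul, add_zero, sub_eq_add_neg (-(7 / 8)) γ, Real.rpow_add hν]
    calc _ = 722 * (d * (vol d)⁻¹) * L * A * B * (ν ^ (-(7 / 8) : ℝ) * ν ^ (-γ)) *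
          (t - a) ^ (1 / 8 - γ) := by ring
      _ ≤ _ := by gcongr

end Smoothing

end MildFlow

end ThinFilm

namespace ThinFilm

open scoped ComplexConjugate

/-! ### A priori bounds from the energy -/

section Energy

variable {d : ℕ}

/-- The energy cannot be small for a flat profile: the well term is at least `vol d - 2 ‖∇h₀‖²`
before its factor `1/4`, and the Laplacian term is at least `ν/2 ‖∇h₀‖²` because nonzero frequencies
have length at least one. With weight `ν ≤ 1` on the well the gradients cancel. It keeps the
logarithm in dimension two away from zero. -/
lemma energy_lower_bound (hd : d ≤ 3) {h₀ : Torus d → ℝ} (hh₀ : MemSobolev 2 h₀) {ν : ℝ}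
    (hν : 0 < ν) (hν1 : ν ≤ 1) : ν * (vol d / 4) ≤ energy ν h₀ := by
  have hv := vol_pos d
  obtain ⟨h4, hE⟩ := energy_eq hd hh₀ ν
  have hs := summable_of_memSobolev (n := 4) (by norm_num) (by norm_num) hh₀
  have hs2 := summable_freqNorm_of_le (m := 2) (by norm_num) (by norm_num) hs
  have hG := hasSum_grad hs2
  have hle : vol d * ∫ x, ‖grad h₀ x‖ ^ 2 ≤ ∑' k, freqNorm k ^ 4 * ‖coeff h₀ k‖ ^ 2 := by
    rw [← hG.tsum_eq]
    exact hs2.tsum_le_tsum (fun k => mul_le_mul_of_nonneg_right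
      (freqNorm_pow_le_pow (by norm_num) (by norm_num) k) (sq_nonneg _)) hs
  have hGi : Integrable (fun x => ‖grad h₀ x‖ ^ 2) volume := by
    have h2 : Integrable (fun x => ∑ j, grad h₀ x j ^ 2) volume :=
      integrable_finsetSum _ fun j _ => (memLp_grad_component hs2 j).1.integrable_sq
    exact h2.congr (ae_of_all _ fun x => (EuclideanSpace.real_norm_sq_eq _).symm)
  have hW : vol d - 2 * ∫ x, ‖grad h₀ x‖ ^ 2 ≤ ∫ x, (‖grad h₀ x‖ ^ 2 - 1) ^ 2 := by
    have h := integral_mono ((integrable_const (1 : ℝ)).sub (hGi.const_mul 2)) (integrable_well h4)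
      fun x => show 1 - 2 * ‖grad h₀ x‖ ^ 2 ≤ (‖grad h₀ x‖ ^ 2 - 1) ^ 2 by
        nlinarith [sq_nonneg (‖grad h₀ x‖ ^ 2)]
    rw [integral_sub' (integrable_const _) (hGi.const_mul 2), integral_const, volume_real_univ,
      integral_const_mul, smul_eq_mul, mul_one] at h
    exact h
  have hW0 : 0 ≤ ∫ x, (‖grad h₀ x‖ ^ 2 - 1) ^ 2 := integral_nonneg fun x => sq_nonneg _
  set G := ∫ x, ‖grad h₀ x‖ ^ 2
  set W := ∫ x, (‖grad h₀ x‖ ^ 2 - 1) ^ 2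
  have h1 : G ≤ (vol d)⁻¹ * ∑' k, freqNorm k ^ 4 * ‖coeff h₀ k‖ ^ 2 := by
    rwa [le_inv_mul_iff₀ hv]
  rw [hE]
  have h2 := mul_le_mul_of_nonneg_left h1 (half_pos hν).le
  have h3 := mul_le_mul_of_nonneg_left hW hν.le
  have h4 := mul_le_mul_of_nonneg_right hν1 hW0
  nlinarith

lemma hnorm_two_le_of_energy {ν E w : ℝ} (hν : 0 < ν) {x : (Fin d → ℤ) → ℝ} (hx : ∀ k, 0 ≤ x k)
    (hs : Summable fun k => freqNorm k ^ (2 * 2) * x k ^ 2) (hw : 0 ≤ w)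
    (h : ν / 2 * ((vol d)⁻¹ * ∑' k, freqNorm k ^ (2 * 2) * x k ^ 2) + w ≤ E) :
    hnorm 2 x ≤ ENNReal.ofReal (Real.sqrt (2 * vol d) * Real.sqrt (E / ν)) := by
  have hv := vol_pos d
  rw [hnorm_eq_of_hasSum hx hs.hasSum, ← Real.sqrt_mul (by positivity)]
  refine ENNReal.ofReal_le_ofReal (Real.sqrt_le_sqrt ?_)
  set X := ∑' k, freqNorm k ^ (2 * 2) * x k ^ 2
  rw [mul_div_assoc', le_div_iff₀ hν]
  have h1 : ν / 2 * ((vol d)⁻¹ * X) ≤ E := by linarith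
  have h2 := mul_le_mul_of_nonneg_left h1 (show 0 ≤ 2 * vol d by positivity)
  calc X * ν = 2 * vol d * (ν / 2 * ((vol d)⁻¹ * X)) := by field_simp
    _ ≤ _ := h2

/-- The a priori bounds that a global solution inherits from the energy inequality. -/
theorem IsGlobalSolution.exists_bounded_mildFlow (hd : d ≤ 3) {ν : ℝ} {h₀ : Torus d → ℝ}
    {h : ℝ → Torus d → ℝ} (hν : 0 < ν) (hh₀ : MemSobolev 2 h₀) (sol : IsGlobalSolution ν h₀ h) :
    ∃ g : ℝ → C(Torus d, Vec d), MildFlow d ν (fun t => coeff (h t)) g ∧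
      (∀ t, 0 < t → MildFlow.flowEnergy ν (fun t => coeff (h t)) g t ≤ energy ν h₀) ∧
      (∀ s, 0 ≤ s → MildFlow.sob (fun t => coeff (h t)) 2 s ≤
        ENNReal.ofReal (Real.sqrt (2 * vol d) * Real.sqrt (energy ν h₀ / ν))) ∧
      ∀ s, 0 < s → hnorm 0 (vhat (fluxC (g s))) ≤
        ENNReal.ofReal (Real.sqrt (4 * vol d) * Real.sqrt (energy ν h₀) * ‖g s‖) := by
  have hv := vol_pos d
  obtain ⟨g, F, -⟩ := sol.exists_mildFlow hh₀
  have hc : ∀ k, coeff (h 0) k = coeff h₀ k := coeff_congr_ae sol.initial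
  have hE : ∀ t, 0 < t → MildFlow.flowEnergy ν (fun t => coeff (h t)) g t ≤ energy ν h₀ :=
    fun t ht => F.flowEnergy_le_energy hd hh₀ hν hc ht
  have hwell : ∀ t, 0 ≤ wellEnergy (g t) := fun t => by
    rw [wellEnergy_eq]
    exact integral_nonneg fun x => by positivity
  have hs := summable_of_memSobolev (n := 4) (by norm_num) (by norm_num) hh₀
  refine ⟨g, F, hE, fun s hs0 => ?_, fun s hs0 => ?_⟩
  · rcases hs0.eq_or_lt with rfl | hs0
    · obtain ⟨-, hE0⟩ := energy_eq hd hh₀ ν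
      simp only [MildFlow.sob, hc]
      refine hnorm_two_le_of_energy hν (fun _ => norm_nonneg _) hs
        (w := 1 / 4 * ∫ x, (‖grad h₀ x‖ ^ 2 - 1) ^ 2) ?_ hE0.ge
      exact mul_nonneg (by norm_num) (integral_nonneg fun x => sq_nonneg _)
    · obtain ⟨K, hK, hKb⟩ := F.exists_interior_bound hν hs0 s
      have hs4 := summable_freqNorm_of_le (m := 4) (by norm_num) (by norm_num)
        (MildFlow.summable_of_sob (hKb s ⟨le_rfl, le_rfl⟩).2)
      exact hnorm_two_le_of_energy hν (fun _ => norm_nonneg _) hs4 (hwell s) (hE s hs0)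
  · refine (hnorm_zero_fluxC_le_energy (g s)).trans (ENNReal.ofReal_le_ofReal ?_)
    rw [← Real.sqrt_mul (by positivity)]
    refine mul_le_mul_of_nonneg_right (Real.sqrt_le_sqrt ?_) (norm_nonneg _)
    have h1 := hE s hs0
    rw [MildFlow.flowEnergy, wellEnergy_eq, integral_const_mul] at h1
    have h2 : 0 ≤ ν / 2 * ((vol d)⁻¹ * ∑' k, freqNorm k ^ 4 * ‖coeff (h s) k‖ ^ 2) :=
      mul_nonneg (by positivity) (mul_nonneg (by positivity) (tsum_nonneg fun k => by
        have := freqNorm_nonneg k; positivity))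
    nlinarith

lemma coeff_propagator {ν t : ℝ} (hν : 0 ≤ ν) (ht : 0 ≤ t) {h₀ : Torus d → ℝ}
    (hh₀ : MemLp h₀ 2 volume) (k : Fin d → ℤ) :
    coeff (propagator ν t h₀) k = (decay ν t k : ℂ) * coeff h₀ k := by
  refine (fourierMul_memLp (fun k => ?_) ?_).2 k
  · rw [freqNorm_neg, Complex.conj_ofReal]
  · refine (hasSum_sq_norm_coeff hh₀).summable.of_nonneg_of_le (fun k => sq_nonneg _) fun k => ?_
    refine pow_le_pow_left₀ (norm_nonneg _) ?_ 2
    rw [norm_mul, Complex.norm_real, Real.norm_of_nonneg (Real.exp_nonneg _)]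
    exact mul_le_of_le_one_left (norm_nonneg _) (decay_le_one hν ht k)

lemma anorm_data {x : (Fin d → ℤ) → ℝ} (hx : ∀ k, 0 ≤ x k) {X : ℝ} (hX : 0 ≤ X)
    (h : anorm x ≤ ENNReal.ofReal X) :
    (Summable fun k => freqNorm k * x k) ∧ ∑' k, freqNorm k * x k ≤ X := by
  have hs := summable_of_anorm_ne_top hx (h.trans_lt ENNReal.ofReal_lt_top).ne
  rw [anorm_eq_of_summable hx hs, ENNReal.ofReal_le_ofReal_iff hX] at h
  exact ⟨hs, h⟩

lemma supNorm_grad_le {f : Torus d → ℝ} {X : ℝ} (hX : 0 ≤ X)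
    (h : (anorm fun k => ‖coeff f k‖) ≤ ENNReal.ofReal X) :
    supNorm (grad f) ≤ ENNReal.ofReal (d * (vol d)⁻¹ * X) := by
  have hv := vol_pos d
  obtain ⟨hs, hle⟩ := anorm_data (fun _ => norm_nonneg _) hX h
  exact (supNorm_le_of_coeff (grad_ae_eq_gradTrig hs) hs).trans
    (ENNReal.ofReal_le_ofReal (mul_le_mul_of_nonneg_left hle (by positivity)))

/-- Only the series of the difference is assumed absolutely convergent: the individual gradients may
be unbounded near time zero. They are identified as L² functions through their coefficients. -/
lemma supNorm_grad_sub_le {f p : Torus d → ℝ} {X : ℝ} (hX : 0 ≤ X)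
    (hf : Summable fun k => freqNorm k ^ 2 * ‖coeff f k‖ ^ 2)
    (hp : Summable fun k => freqNorm k ^ 2 * ‖coeff p k‖ ^ 2)
    (h : (anorm fun k => ‖coeff f k - coeff p k‖) ≤ ENNReal.ofReal X) :
    supNorm (grad f - grad p) ≤ ENNReal.ofReal (d * (vol d)⁻¹ * X) := by
  have hv := vol_pos d
  obtain ⟨hs, hle⟩ := anorm_data (fun _ => norm_nonneg _) hX h
  have hae : grad f - grad p =ᵐ[volume] gradTrig fun k => coeff f k - coeff p k := by
    have hj : ∀ j, (fun x => grad f x j - grad p x j) =ᵐ[volume]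
        fun x => gradTrig (fun k => coeff f k - coeff p k) x j := fun j => by
      have h1 := (memLp_grad_component hf j).1.integrable (by norm_num)
      have h2 := (memLp_grad_component hp j).1.integrable (by norm_num)
      refine ae_eq_of_coeff_eq (h1.sub h2) (integrable_component _ j) fun k => ?_
      rw [coeff_gradTrig hs (fun k => by rw [coeff_neg, coeff_neg, map_sub]) j k,
        coeff_sub h1 h2, (memLp_grad_component hf j).2, (memLp_grad_component hp j).2, mul_sub]
    filter_upwards [ae_all_iff.mpr hj] with x hx
    ext j
    exact hx j
  exact (supNorm_le_of_coeff hae hs).trans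
    (ENNReal.ofReal_le_ofReal (mul_le_mul_of_nonneg_left hle (by positivity)))

end Energy

/-! ### Bounds after the smoothing time and for the Duhamel part. -/

namespace MildFlow

variable {d : ℕ} {ν : ℝ} {c : ℝ → (Fin d → ℤ) → ℂ} {g : ℝ → C(Torus d, Vec d)} {A B : ℝ}

lemma anorm_decay_mono {τ τ' : ℝ} (hν : 0 ≤ ν) (h : τ ≤ τ') {x : (Fin d → ℤ) → ℝ}
    (hx : ∀ k, 0 ≤ x k) :
    anorm (fun k => decay ν τ' k * x k) ≤ anorm fun k => decay ν τ k * x k := by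
  refine anorm_mono fun k => mul_le_mul_of_nonneg_right (Real.exp_le_exp.mpr ?_) (hx k)
  have := freqNorm_nonneg k
  have := mul_le_mul_of_nonneg_right (mul_le_mul_of_nonneg_left h hν)
    (show 0 ≤ freqNorm k ^ 4 by positivity)
  linarith

/-- Bounds for the Fourier series of the gradient, after and before the smoothing time `δ`. -/
theorem anorm_le_of_energy (hd : d ≤ 3) (F : MildFlow d ν c g) (hν : 0 < ν) (hA0 : 0 ≤ A)
    (hB0 : 0 ≤ B) (hA : ∀ s, 0 ≤ s → sob c 2 s ≤ ENNReal.ofReal A)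
    (hB : ∀ s, 0 < s → hnorm 0 (vhat (fluxC (g s))) ≤ ENNReal.ofReal (B * ‖g s‖))
    {γ L Λ δ : ℝ} (hγ : 0 ≤ γ) (hγ8 : γ ≤ 1 / 8) (hL : 0 ≤ L)
    (hlat : ∀ b : ℝ, 0 < b → b ≤ 1 → ∑' k : Fin d → ℤ, ENNReal.ofReal ((freqNorm k ^ 2)⁻¹ *
      Real.exp (-(b * freqNorm k ^ 4))) ≤ ENNReal.ofReal ((L * b ^ (-γ)) ^ 2))
    (hδ : 0 < δ) (hνδ : ν * δ ≤ 1) (hΛ : 0 ≤ Λ)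
    (hlatδ : ∑' k : Fin d → ℤ, ENNReal.ofReal ((freqNorm k ^ 2)⁻¹ *
      Real.exp (-(ν * δ * freqNorm k ^ 4))) ≤ ENNReal.ofReal (Λ ^ 2))
    (hsmall : 722 * (d * (vol d)⁻¹) * B * ν ^ (-(7 / 8) : ℝ) * δ ^ (1 / 8 : ℝ) ≤ 1) :
    (∀ t, δ ≤ t → (anorm fun k => ‖c t k‖) ≤ ENNReal.ofReal (Λ * A +
      722 * (d * (vol d)⁻¹) * L * A * B * ν ^ (-(7 / 8) - γ) * δ ^ (1 / 8 - γ))) ∧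
    ∀ t, 0 ≤ t → (anorm fun k => ‖duh ν c 0 t k‖) ≤ ENNReal.ofReal (2 * (Λ * A) +
      722 * (d * (vol d)⁻¹) * L * A * B * ν ^ (-(7 / 8) - γ) * δ ^ (1 / 8 - γ)) := by
  have hv := vol_pos d
  have hp1 := Real.rpow_pos_of_pos hν (-(7 / 8) - γ)
  have hp2 := Real.rpow_pos_of_pos hδ (1 / 8 - γ)
  set Q := 722 * (d * (vol d)⁻¹) * L * A * B * ν ^ (-(7 / 8) - γ) * δ ^ (1 / 8 - γ) with hQ
  have hQ0 : 0 ≤ Q := by positivity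
  have hduh : ∀ a, 0 ≤ a → ∀ t ∈ Set.Ioc a (a + δ), (anorm fun k => ‖duh ν c a t k‖) ≤
      ENNReal.ofReal Q := fun a ha =>
    F.anorm_duh_le_of_energy hd hν hA0 hB0 hA hB hγ hγ8 hL hlat ha hνδ hsmall
  have hdecay : ∀ a, 0 ≤ a → anorm (fun k => decay ν δ k * ‖c a k‖) ≤
      ENNReal.ofReal (Λ * A) := fun a ha => by
    rw [ENNReal.ofReal_mul hΛ]
    exact (anorm_decay_le (mul_pos hν hδ) _ hΛ hlatδ).trans (mul_le_mul_right (hA a ha) _)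
  -- The window slides: each late time is reached from `t - δ`, where the energy bounds hold with
  -- the same constants.
  have hlong : ∀ t, δ ≤ t → (anorm fun k => ‖c t k‖) ≤ ENNReal.ofReal (Λ * A + Q) := by
    intro t ht
    rw [ENNReal.ofReal_add (by positivity) hQ0]
    have h1 := anorm_le_decay_add_duh (ν := ν) (c := c) (t - δ) t
    rw [sub_sub_cancel] at h1
    exact h1.trans (add_le_add (hdecay _ (by linarith))
      (hduh (t - δ) (by linarith) t ⟨by linarith, by linarith⟩))
  refine ⟨hlong, fun t ht => ?_⟩
  rcases ht.eq_or_lt with rfl | ht0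
  · have : (anorm fun k => ‖duh ν c 0 0 k‖) = 0 := by
      simp [anorm, duh, decay]
    rw [this]
    exact zero_le
  rcases le_or_gt t δ with htδ | htδ
  · refine (hduh 0 le_rfl t ⟨ht0, by linarith⟩).trans (ENNReal.ofReal_le_ofReal ?_)
    have := mul_nonneg hΛ hA0
    linarith
  -- After `δ` the Duhamel part is simply the solution minus the linear evolution, both already
  -- smooth; this accounts for the factor `2` on `Λ A`.
  · have h1 : (anorm fun k => ‖duh ν c 0 t k‖) ≤
        (anorm fun k => ‖c t k‖) + anorm fun k => decay ν t k * ‖c 0 k‖ := by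
      refine le_trans (anorm_mono fun k => ?_) (anorm_add_le (fun _ => norm_nonneg _)
        fun _ => mul_nonneg (decay_nonneg _ _ _) (norm_nonneg _))
      rw [duh, sub_zero]
      refine (norm_sub_le _ _).trans (le_of_eq ?_)
      rw [norm_mul, Complex.norm_real, Real.norm_of_nonneg (decay_nonneg _ _ _)]
    refine h1.trans ((add_le_add (hlong t htδ.le) ((anorm_decay_mono hν.le htδ.le
      fun _ => norm_nonneg _).trans (hdecay 0 le_rfl))).trans ?_)
    rw [← ENNReal.ofReal_add (by positivity) (by positivity)]
    exact ENNReal.ofReal_le_ofReal (by linarith)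

end MildFlow

end ThinFilm

namespace ThinFilm

/-! ### Bounds for the gradient in dimensions two and three -/

section Bounds

variable {d : ℕ}

/-- Two lattice bounds are kept apart: a power law with exponent `γ` for all short times inside the
window, and the value `Λ` at its end `δ`. In dimension two the second can then be logarithmic
although the first is a power. -/
theorem IsGlobalSolution.supNorm_le (hd : d ≤ 3) {ν : ℝ} {h₀ : Torus d → ℝ}
    {h : ℝ → Torus d → ℝ} (hν : 0 < ν) (hh₀ : MemSobolev 2 h₀) (sol : IsGlobalSolution ν h₀ h)
    {γ L Λ δ A B : ℝ} (hAdef : A = Real.sqrt (2 * vol d) * Real.sqrt (energy ν h₀ / ν))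
    (hBdef : B = Real.sqrt (4 * vol d) * Real.sqrt (energy ν h₀))
    (hγ : 0 ≤ γ) (hγ8 : γ ≤ 1 / 8) (hL : 0 ≤ L)
    (hlat : ∀ b : ℝ, 0 < b → b ≤ 1 → ∑' k : Fin d → ℤ, ENNReal.ofReal ((freqNorm k ^ 2)⁻¹ *
      Real.exp (-(b * freqNorm k ^ 4))) ≤ ENNReal.ofReal ((L * b ^ (-γ)) ^ 2))
    (hδ : 0 < δ) (hνδ : ν * δ ≤ 1) (hΛ : 0 ≤ Λ)
    (hlatδ : ∑' k : Fin d → ℤ, ENNReal.ofReal ((freqNorm k ^ 2)⁻¹ *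
      Real.exp (-(ν * δ * freqNorm k ^ 4))) ≤ ENNReal.ofReal (Λ ^ 2))
    (hsmall : 722 * (d * (vol d)⁻¹) * B * ν ^ (-(7 / 8) : ℝ) * δ ^ (1 / 8 : ℝ) ≤ 1) :
    (∀ t, δ ≤ t → supNorm (grad (h t)) ≤ ENNReal.ofReal (d * (vol d)⁻¹ * (2 * (Λ * A) +
      722 * (d * (vol d)⁻¹) * L * A * B * ν ^ (-(7 / 8) - γ) * δ ^ (1 / 8 - γ)))) ∧
    ∀ t, 0 ≤ t → supNorm (grad (h t) - grad (propagator ν t h₀)) ≤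
      ENNReal.ofReal (d * (vol d)⁻¹ * (2 * (Λ * A) +
        722 * (d * (vol d)⁻¹) * L * A * B * ν ^ (-(7 / 8) - γ) * δ ^ (1 / 8 - γ))) := by
  have hv := vol_pos d
  obtain ⟨g, F, -, hA, hB⟩ := sol.exists_bounded_mildFlow hd hν hh₀
  rw [← hAdef] at hA
  rw [← hBdef] at hB
  have hA0 : 0 ≤ A := by rw [hAdef]; positivity
  have hB0 : 0 ≤ B := by rw [hBdef]; positivity
  have hp1 := Real.rpow_pos_of_pos hν (-(7 / 8) - γ)
  have hp2 := Real.rpow_pos_of_pos hδ (1 / 8 - γ)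
  obtain ⟨h1, h2⟩ := F.anorm_le_of_energy hd hν hA0 hB0 hA hB hγ hγ8 hL hlat hδ hνδ hΛ hlatδ hsmall
  refine ⟨fun t ht => supNorm_grad_le (by positivity) ((h1 t ht).trans
    (ENNReal.ofReal_le_ofReal (by linarith [mul_nonneg hΛ hA0]))), fun t ht => ?_⟩
  have hc : ∀ k, coeff (h 0) k = coeff h₀ k := coeff_congr_ae sol.initial
  have hs0 := summable_freqNorm_of_le (m := 2) (by norm_num) (by norm_num)
    (summable_of_memSobolev (n := 4) (by norm_num) (by norm_num) hh₀)
  have hp := coeff_propagator hν.le ht hh₀.1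
  refine supNorm_grad_sub_le (by positivity) ?_ ?_ ((le_of_eq ?_).trans (h2 t ht))
  · have hs4 : Summable fun k => freqNorm k ^ 4 * ‖coeff (h t) k‖ ^ 2 :=
      MildFlow.summable_of_sob (c := fun t => coeff (h t)) (n := 2) (hA t ht)
    exact summable_freqNorm_of_le (m := 2) (by norm_num) (by norm_num) hs4
  · refine hs0.of_nonneg_of_le (fun k => by have := freqNorm_nonneg k; positivity) fun k => ?_
    rw [hp, norm_mul, Complex.norm_real, Real.norm_of_nonneg (decay_nonneg _ _ _)]
    have := freqNorm_nonneg k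
    have h3 := mul_le_of_le_one_left (norm_nonneg (coeff h₀ k)) (decay_le_one hν.le ht k)
    have h4 := decay_nonneg ν t k
    gcongr
  · refine congrArg anorm (funext fun k => ?_)
    rw [MildFlow.duh, hp, sub_zero, hc]

lemma eight_rpow {y : ℝ} (hy : 0 ≤ y) (s : ℝ) : (y ^ 8) ^ s = y ^ (8 * s) := by
  rw [← Real.rpow_natCast, ← Real.rpow_mul hy]; norm_num

/-- The window is parametrised as `δ = y⁸`, so that the eighth root in the smallness condition is
`y`. -/
lemma smallness {D β E ν m y : ℝ} (hD : 0 ≤ D) (hβ : 0 ≤ β) (hν : 0 < ν) (hm : 0 ≤ m)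
    (hmD : m * (1 + 722 * D * β) ≤ 1) (hy : 0 ≤ y)
    (h : Real.sqrt (E + 1) * y ≤ m * ν ^ (7 / 8 : ℝ)) :
    722 * D * (β * Real.sqrt E) * ν ^ (-(7 / 8) : ℝ) * (y ^ 8) ^ (1 / 8 : ℝ) ≤ 1 := by
  have hp := Real.rpow_pos_of_pos hν (-(7 / 8) : ℝ)
  have e1 : ν ^ (-(7 / 8) : ℝ) * ν ^ (7 / 8 : ℝ) = 1 := by
    rw [← Real.rpow_add hν]; norm_num
  have h1 : Real.sqrt E ≤ Real.sqrt (E + 1) := Real.sqrt_le_sqrt (by linarith)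
  rw [eight_rpow hy, mul_one_div_cancel (by norm_num), Real.rpow_one]
  calc _ = 722 * D * β * (ν ^ (-(7 / 8) : ℝ) * (Real.sqrt E * y)) := by ring
    _ ≤ 722 * D * β * (ν ^ (-(7 / 8) : ℝ) * (m * ν ^ (7 / 8 : ℝ))) := by
        refine mul_le_mul_of_nonneg_left (mul_le_mul_of_nonneg_left ?_ hp.le) (by positivity)
        exact (mul_le_mul_of_nonneg_right h1 hy).trans h
    _ = 722 * D * β * m * (ν ^ (-(7 / 8) : ℝ) * ν ^ (7 / 8 : ℝ)) := by ring
    _ ≤ 1 := by rw [e1]; linarith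

lemma latticeSum_le_power (hd : d ≤ 3) {b : ℝ} (hb : 0 < b) (hb1 : b ≤ 1) :
    ∑' k : Fin d → ℤ, ENNReal.ofReal ((freqNorm k ^ 2)⁻¹ * Real.exp (-(b * freqNorm k ^ 4))) ≤
      ENNReal.ofReal ((19 * b ^ (-(1 / 8) : ℝ)) ^ 2) := by
  refine (tsum_inv_sq_mul_exp_le hd hb hb1).trans (ENNReal.ofReal_le_ofReal ?_)
  have e : (b ^ (-(1 / 8) : ℝ)) ^ 2 = b ^ (-(1 / 4) : ℝ) := by
    rw [← Real.rpow_natCast, ← Real.rpow_mul hb.le]; norm_num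
  rw [mul_pow, e]
  have := Real.rpow_pos_of_pos hb (-(1 / 4) : ℝ)
  linarith

/-- The logarithm is weakened to the power `1/16`, with `68 = 4 (1 + 16)`. Since `1/16 < 1/8`, a
positive power of `δ` survives in the Duhamel term. -/
lemma latticeSum_two_le_power {b : ℝ} (hb : 0 < b) (hb1 : b ≤ 1) :
    ∑' k : Fin 2 → ℤ, ENNReal.ofReal ((freqNorm k ^ 2)⁻¹ * Real.exp (-(b * freqNorm k ^ 4))) ≤
      ENNReal.ofReal ((68 * b ^ (-(1 / 16) : ℝ)) ^ 2) := by
  refine (tsum_inv_sq_mul_exp_le_log hb hb1).trans (ENNReal.ofReal_le_ofReal ?_)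
  have h0 : 0 ≤ Real.log b⁻¹ := Real.log_nonneg ((one_le_inv₀ hb).mpr hb1)
  have h1 := Real.log_le_rpow_div (inv_pos.mpr hb).le (show (0 : ℝ) < 1 / 16 by norm_num)
  rw [Real.inv_rpow hb.le, ← Real.rpow_neg hb.le] at h1
  have h2 : 1 ≤ b ^ (-(1 / 16) : ℝ) :=
    Real.one_le_rpow_of_pos_of_le_one_of_nonpos hb hb1 (by norm_num)
  refine pow_le_pow_left₀ (by positivity) ?_ 2
  linarith

/-- In dimension three the gradient obeys a power bound after any given time. -/
theorem exists_supNorm_le_power (hd : d ≤ 3) {τ : ℝ} (hτ : 0 < τ) : ∃ C : ℝ, 0 < C ∧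
    ∀ (ν : ℝ) (h₀ : Torus d → ℝ) (h : ℝ → Torus d → ℝ), 0 < ν → ν ≤ 1 →
      MemSobolev 2 h₀ → IsGlobalSolution ν h₀ h →
      (∀ t : ℝ, τ ≤ t → supNorm (grad (h t)) ≤ ENNReal.ofReal
        (C * ν ^ (-(3 / 2) : ℝ) * (energy ν h₀ + 1) ^ (3 / 2 : ℝ))) ∧
      ∀ t : ℝ, 0 ≤ t → supNorm (grad (h t) - grad (propagator ν t h₀)) ≤ ENNReal.ofReal
        (C * ν ^ (-(3 / 2) : ℝ) * (energy ν h₀ + 1) ^ (3 / 2 : ℝ)) := by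
  have hv := vol_pos d
  set D : ℝ := d * (vol d)⁻¹ with hD
  have hD0 : 0 ≤ D := by positivity
  set α := Real.sqrt (2 * vol d)
  set β := Real.sqrt (4 * vol d)
  have hα0 : 0 ≤ α := Real.sqrt_nonneg _
  have hβ0 : 0 ≤ β := Real.sqrt_nonneg _
  -- The numerator secures `δ ≤ τ` and `δ ≤ 1`, the denominator the smallness condition.
  set m := min τ 1 / (1 + 722 * D * β) with hm
  have hden : 1 ≤ 1 + 722 * D * β := by
    have : 0 ≤ 722 * D * β := by positivity
    linarith
  have hm0 : 0 < m := by positivity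
  have hmmin : m ≤ min τ 1 := div_le_self (by positivity) hden
  have hmD : m * (1 + 722 * D * β) ≤ 1 := by
    rw [hm, div_mul_cancel₀ _ (by positivity)]
    exact min_le_right _ _
  refine ⟨D * (2 * (19 * m⁻¹ * α) + 722 * D * 19 * α * β) + 1, by positivity,
    fun ν h₀ h hν hν1 hh₀ sol => ?_⟩
  have hE0 : 0 ≤ energy ν h₀ :=
    le_trans (by positivity) (energy_lower_bound hd hh₀ hν hν1)
  set E := energy ν h₀ with hE
  set n := Real.sqrt ν with hn
  set r := Real.sqrt (E + 1) with hr
  set e := Real.sqrt E with he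
  have hn0 : 0 < n := Real.sqrt_pos.mpr hν
  have hnn : n ^ 2 = ν := Real.sq_sqrt hν.le
  have hr1 : 1 ≤ r := Real.one_le_sqrt.mpr (by linarith)
  have her : e ≤ r := Real.sqrt_le_sqrt (by linarith)
  have he0 : 0 ≤ e := Real.sqrt_nonneg _
  have hν78 := Real.rpow_pos_of_pos hν (7 / 8 : ℝ)
  have hν78' : ν ^ (7 / 8 : ℝ) ≤ 1 := Real.rpow_le_one hν.le hν1 (by norm_num)
  -- This turns the hypothesis of `smallness` into an equality: here `γ = 1/8`, no power of `δ`
  -- remains in the Duhamel term, and a shorter window would only worsen `Λ`.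
  set y := m * ν ^ (7 / 8 : ℝ) / r with hy
  have hy0 : 0 < y := by positivity
  have hym : y ≤ m := by
    rw [hy, div_le_iff₀ (by linarith)]
    exact mul_le_mul_of_nonneg_left (hν78'.trans hr1) hm0.le
  have hy1 : y ≤ 1 := hym.trans (hmmin.trans (min_le_right _ _))
  have hδτ : y ^ 8 ≤ τ := by
    calc y ^ 8 ≤ y := pow_le_of_le_one hy0.le hy1 (by norm_num)
      _ ≤ τ := hym.trans (hmmin.trans (min_le_left _ _))
  have hνδ : ν * y ^ 8 ≤ 1 := mul_le_one₀ hν1 (by positivity) (pow_le_one₀ hy0.le hy1)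
  have hνδ0 : 0 < ν * y ^ 8 := by positivity
  have hsmall := smallness (E := E) hD0 hβ0 hν hm0.le hmD hy0.le
    (le_of_eq (by rw [hy, ← hr]; field_simp))
  obtain ⟨h1, h2⟩ := sol.supNorm_le hd hν hh₀ (γ := 1 / 8) (L := 19)
    (Λ := 19 * (ν * y ^ 8) ^ (-(1 / 8) : ℝ)) (δ := y ^ 8) rfl rfl (by norm_num) le_rfl
    (by norm_num) (fun b hb hb1 => latticeSum_le_power hd hb hb1) (by positivity) hνδ
    (by positivity) (latticeSum_le_power hd hνδ0 hνδ) hsmall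
  have hΛ : (ν * y ^ 8) ^ (-(1 / 8) : ℝ) = m⁻¹ * (n ^ 2)⁻¹ * r := by
    have e1 : ν ^ (-(1 / 8) : ℝ) * (ν ^ (7 / 8 : ℝ))⁻¹ = ν⁻¹ := by
      rw [← Real.rpow_neg hν.le, ← Real.rpow_add hν]
      norm_num [Real.rpow_neg_one]
    rw [Real.mul_rpow hν.le (by positivity), eight_rpow hy0.le,
      show (8 * (-(1 / 8)) : ℝ) = -1 by norm_num, Real.rpow_neg_one, hy, inv_div, hnn, ← e1]
    field_simp
  have hs : Real.sqrt (E / ν) = e / n := Real.sqrt_div hE0 ν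
  have hX : D * (2 * (19 * (ν * y ^ 8) ^ (-(1 / 8) : ℝ) * (α * Real.sqrt (E / ν))) +
      722 * D * 19 * (α * Real.sqrt (E / ν)) * (β * e) * ν ^ (-(7 / 8) - 1 / 8 : ℝ) *
        (y ^ 8) ^ (1 / 8 - 1 / 8 : ℝ)) ≤
      (D * (2 * (19 * m⁻¹ * α) + 722 * D * 19 * α * β) + 1) * ν ^ (-(3 / 2) : ℝ) *
        (E + 1) ^ (3 / 2 : ℝ) := by
    have e1 : ν ^ (-(7 / 8) - 1 / 8 : ℝ) = (n ^ 2)⁻¹ := by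
      rw [hnn, ← Real.rpow_neg_one]; norm_num
    have e2 : ν ^ (-(3 / 2) : ℝ) = (n ^ 3)⁻¹ := by
      rw [Real.rpow_neg hν.le, hn, Real.sqrt_eq_rpow, ← Real.rpow_natCast, ← Real.rpow_mul hν.le]
      norm_num
    have e3 : (E + 1) ^ (3 / 2 : ℝ) = r ^ 3 := by
      rw [hr, Real.sqrt_eq_rpow, ← Real.rpow_natCast, ← Real.rpow_mul (by linarith)]
      norm_num
    rw [hΛ, hs, e1, e2, e3, sub_self, Real.rpow_zero]
    -- The linear and Duhamel terms are of order `e r / n³` and `e² / n³`, so both are covered by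
    -- `r³ / n³`.
    have hr3 : r ^ 2 ≤ r ^ 3 := pow_le_pow_right₀ hr1 (by norm_num)
    have her2 : e * r ≤ r ^ 3 := le_trans (by nlinarith) hr3
    have hee2 : e * e ≤ r ^ 3 := le_trans (by nlinarith) hr3
    have hn3 : 0 < (n ^ 3)⁻¹ := by positivity
    have hm1 : 0 < m⁻¹ := inv_pos.mpr hm0
    calc _ = D * (2 * (19 * m⁻¹ * α) * (e * r) + 722 * D * 19 * α * β * (e * e)) * (n ^ 3)⁻¹ := by
          field_simp
      _ ≤ D * (2 * (19 * m⁻¹ * α) * r ^ 3 + 722 * D * 19 * α * β * r ^ 3) * (n ^ 3)⁻¹ := by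
          gcongr
      _ ≤ D * (2 * (19 * m⁻¹ * α) * r ^ 3 + 722 * D * 19 * α * β * r ^ 3) * (n ^ 3)⁻¹ +
          (n ^ 3)⁻¹ * r ^ 3 := le_add_of_nonneg_right (by positivity)
      _ = _ := by ring
  exact ⟨fun t ht => (h1 t (hδτ.trans ht)).trans (ENNReal.ofReal_le_ofReal hX),
    fun t ht => (h2 t ht).trans (ENNReal.ofReal_le_ofReal hX)⟩

/-- In dimension two the gradient obeys a logarithmic bound after any given time. -/
theorem exists_supNorm_le_log {τ : ℝ} (hτ : 0 < τ) : ∃ C : ℝ, 0 < C ∧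
    ∀ (ν : ℝ) (h₀ : Torus 2 → ℝ) (h : ℝ → Torus 2 → ℝ), 0 < ν → ν ≤ 1 →
      MemSobolev 2 h₀ → IsGlobalSolution ν h₀ h →
      (∀ t : ℝ, τ ≤ t → supNorm (grad (h t)) ≤ ENNReal.ofReal
        (C * (energy ν h₀ / ν) ^ (1 / 2 : ℝ) * |Real.log ((energy ν h₀ + 1) / ν)|)) ∧
      ∀ t : ℝ, 0 ≤ t → supNorm (grad (h t) - grad (propagator ν t h₀)) ≤ ENNReal.ofReal
        (C * (energy ν h₀ / ν) ^ (1 / 2 : ℝ) * |Real.log ((energy ν h₀ + 1) / ν)|) := by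
  have hd : 2 ≤ 3 := by norm_num
  have hv := vol_pos 2
  set D : ℝ := (2 : ℕ) * (vol 2)⁻¹ with hD
  have hD0 : 0 ≤ D := by positivity
  set α := Real.sqrt (2 * vol 2)
  set β := Real.sqrt (4 * vol 2)
  have hα0 : 0 ≤ α := Real.sqrt_nonneg _
  have hβ0 : 0 ≤ β := Real.sqrt_nonneg _
  set m := min τ 1 / (1 + 722 * D * β) with hm
  have hden : 1 ≤ 1 + 722 * D * β := by
    have : 0 ≤ 722 * D * β := by positivity
    linarith
  have hm0 : 0 < m := by positivity
  have hmmin : m ≤ min τ 1 := div_le_self (by positivity) hden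
  have hm1 : m ≤ 1 := hmmin.trans (min_le_right _ _)
  have hmD : m * (1 + 722 * D * β) ≤ 1 := by
    rw [hm, div_mul_cancel₀ _ (by positivity)]
    exact min_le_right _ _
  have hlm : 0 ≤ Real.log m⁻¹ := Real.log_nonneg ((one_le_inv₀ hm0).mpr hm1)
  -- By the lower bound on the energy and `ν ≤ 1`, `(E + 1)/ν ≥ 1 + vol 2 / 4`. The logarithm is
  -- thus bounded below and can absorb constants.
  set c₀ := Real.log (1 + vol 2 / 4) with hc₀
  have hc0 : 0 < c₀ := Real.log_pos (by linarith)
  set K := 2 * ((4 * (1 + 8 * Real.log m⁻¹)) * c₀⁻¹ + 64) * α + 722 * D * 68 * α * β * c₀⁻¹ with hK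
  have hK0 : 0 ≤ K := by positivity
  refine ⟨D * K + 1, by positivity, fun ν h₀ h hν hν1 hh₀ sol => ?_⟩
  have hElow := energy_lower_bound hd hh₀ hν hν1
  have hE0 : 0 ≤ energy ν h₀ := le_trans (by positivity) hElow
  set E := energy ν h₀ with hE
  have hR : 1 ≤ E + 1 := by linarith
  set l := Real.log ((E + 1) / ν) with hl
  have hlc : c₀ ≤ l := by
    refine Real.log_le_log (by positivity) ?_
    rw [le_div_iff₀ hν]
    nlinarith
  have hl0 : 0 < l := hc0.trans_le hlc
  have hl1 : 1 ≤ c₀⁻¹ * l := by rwa [le_inv_mul_iff₀ hc0, mul_one]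
  set r := Real.sqrt (E + 1) with hr
  have hr1 : 1 ≤ r := Real.one_le_sqrt.mpr (by linarith)
  have hrr : r ^ 2 = E + 1 := Real.sq_sqrt (by linarith)
  have her : Real.sqrt E ≤ r := Real.sqrt_le_sqrt (by linarith)
  have hνp := Real.rpow_pos_of_pos hν (15 / 8 : ℝ)
  have hνp' : ν ^ (15 / 8 : ℝ) ≤ ν ^ (7 / 8 : ℝ) :=
    Real.rpow_le_rpow_of_exponent_ge hν hν1 (by norm_num)
  -- The window is shorter than smallness requires. This costs only a logarithm in `Λ`, and the
  -- surviving power `δ^{1/16} = y^{1/2}` then cancels `E^{1/2} ν^{-15/16}` in the Duhamel term.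
  set y := m * ν ^ (15 / 8 : ℝ) / (E + 1) with hy
  have hy0 : 0 < y := by positivity
  have hry : r * y ≤ m * ν ^ (7 / 8 : ℝ) := by
    have h1 : r * y = m * ν ^ (15 / 8 : ℝ) / r := by
      rw [hy, ← hrr]; field_simp
    rw [h1, div_le_iff₀ (by linarith)]
    calc m * ν ^ (15 / 8 : ℝ) ≤ m * ν ^ (7 / 8 : ℝ) := by gcongr
      _ ≤ _ := le_mul_of_one_le_right (by positivity) hr1
  have hym : y ≤ m := by
    have h1 : m * ν ^ (7 / 8 : ℝ) ≤ m :=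
      mul_le_of_le_one_right hm0.le (Real.rpow_le_one hν.le hν1 (by norm_num))
    exact (le_mul_of_one_le_left hy0.le hr1).trans (hry.trans h1)
  have hy1 : y ≤ 1 := hym.trans hm1
  have hδτ : y ^ 8 ≤ τ := by
    calc y ^ 8 ≤ y := pow_le_of_le_one hy0.le hy1 (by norm_num)
      _ ≤ τ := hym.trans (hmmin.trans (min_le_left _ _))
  have hνδ : ν * y ^ 8 ≤ 1 := mul_le_one₀ hν1 (by positivity) (pow_le_one₀ hy0.le hy1)
  have hνδ0 : 0 < ν * y ^ 8 := by positivity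
  have hsmall := smallness (E := E) hD0 hβ0 hν hm0.le hmD hy0.le hry
  have hlog0 : 0 ≤ Real.log (ν * y ^ 8)⁻¹ := Real.log_nonneg ((one_le_inv₀ hνδ0).mpr hνδ)
  obtain ⟨h1, h2⟩ := sol.supNorm_le hd hν hh₀ (γ := 1 / 16) (L := 68)
    (Λ := 4 * (1 + Real.log (ν * y ^ 8)⁻¹)) (δ := y ^ 8) rfl rfl (by norm_num) (by norm_num)
    (by norm_num) (fun b hb hb1 => latticeSum_two_le_power hb hb1) (by positivity) hνδ
    (by positivity) (tsum_inv_sq_mul_exp_le_log hνδ0 hνδ) hsmall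
  have hΛ : 4 * (1 + Real.log (ν * y ^ 8)⁻¹) ≤ ((4 * (1 + 8 * Real.log m⁻¹)) * c₀⁻¹ + 64) * l := by
    have hlogR : 0 ≤ Real.log (E + 1) := Real.log_nonneg hR
    have e1 : Real.log (ν * y ^ 8)⁻¹ = 8 * Real.log m⁻¹ - 16 * Real.log ν + 8 * Real.log (E + 1) := by
      rw [Real.log_inv, Real.log_mul hν.ne' (by positivity), Real.log_pow, hy,
        Real.log_div (by positivity) (by positivity), Real.log_mul hm0.ne' hνp.ne',
        Real.log_rpow hν, Real.log_inv]
      push_cast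
      ring
    have e2 : l = Real.log (E + 1) - Real.log ν := Real.log_div (by positivity) hν.ne'
    -- The coefficient `16 = 1 + 8 · 15/8` is that of `log(1/ν)`; multiplied by `4` it gives the
    -- `64` of `K`.
    have h3 : Real.log (ν * y ^ 8)⁻¹ ≤ 8 * Real.log m⁻¹ + 16 * l := by
      rw [e1, e2]; linarith
    have h4 := mul_le_mul_of_nonneg_left hl1 (show 0 ≤ 4 * (1 + 8 * Real.log m⁻¹) by positivity)
    linarith
  have hQ : Real.sqrt E * ν ^ (-(7 / 8) - 1 / 16 : ℝ) * (y ^ 8) ^ (1 / 8 - 1 / 16 : ℝ) ≤ 1 := by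
    have e0 : ν ^ (15 / 8 : ℝ) = (ν ^ (15 / 16 : ℝ)) ^ 2 := by
      rw [← Real.rpow_natCast, ← Real.rpow_mul hν.le]; norm_num
    have hq := Real.rpow_pos_of_pos hν (15 / 16 : ℝ)
    have e1 : (y ^ 8) ^ (1 / 8 - 1 / 16 : ℝ) = Real.sqrt m * ν ^ (15 / 16 : ℝ) / r := by
      rw [eight_rpow hy0.le, show (8 * (1 / 8 - 1 / 16) : ℝ) = 1 / 2 by norm_num,
        ← Real.sqrt_eq_rpow, hy, Real.sqrt_div (by positivity), Real.sqrt_mul hm0.le, e0,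
        Real.sqrt_sq hq.le]
    have e2 : ν ^ (-(7 / 8) - 1 / 16 : ℝ) = (ν ^ (15 / 16 : ℝ))⁻¹ := by
      rw [← Real.rpow_neg hν.le]; norm_num
    have h3 : Real.sqrt m ≤ 1 := Real.sqrt_le_one.mpr hm1
    rw [e1, e2]
    calc _ = Real.sqrt E / r * Real.sqrt m := by field_simp
      _ ≤ 1 * 1 := by
        refine mul_le_mul ((div_le_one (by linarith)).mpr her) h3 (Real.sqrt_nonneg _) zero_le_one
      _ = 1 := one_mul 1
  have hQl := hQ.trans hl1
  set s := Real.sqrt (E / ν) with hs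
  have hs0 : 0 ≤ s := Real.sqrt_nonneg _
  have hX : D * (2 * (4 * (1 + Real.log (ν * y ^ 8)⁻¹) * (α * s)) +
      722 * D * 68 * (α * s) * (β * Real.sqrt E) * ν ^ (-(7 / 8) - 1 / 16 : ℝ) *
        (y ^ 8) ^ (1 / 8 - 1 / 16 : ℝ)) ≤
      (D * K + 1) * (E / ν) ^ (1 / 2 : ℝ) * |l| := by
    rw [abs_of_pos hl0, ← Real.sqrt_eq_rpow, ← hs]
    calc _ = D * (2 * (4 * (1 + Real.log (ν * y ^ 8)⁻¹)) * (α * s) +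
          722 * D * 68 * (α * s) * β * (Real.sqrt E * ν ^ (-(7 / 8) - 1 / 16 : ℝ) *
            (y ^ 8) ^ (1 / 8 - 1 / 16 : ℝ))) := by ring
      _ ≤ D * (2 * (((4 * (1 + 8 * Real.log m⁻¹)) * c₀⁻¹ + 64) * l) * (α * s) +
          722 * D * 68 * (α * s) * β * (c₀⁻¹ * l)) := by
          refine mul_le_mul_of_nonneg_left (add_le_add ?_ ?_) hD0
          · gcongr
          · exact mul_le_mul_of_nonneg_left hQl (by positivity)
      _ = D * K * s * l := by rw [hK]; ring
      _ ≤ D * K * s * l + s * l := le_add_of_nonneg_right (by positivity)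
      _ = _ := by ring
  exact ⟨fun t ht => (h1 t (hδτ.trans ht)).trans (ENNReal.ofReal_le_ofReal hX),
    fun t ht => (h2 t ht).trans (ENNReal.ofReal_le_ofReal hX)⟩

end Bounds

end ThinFilm

namespace ThinFilm

open scoped ComplexConjugate

/-! ### An interpolation inequality on the circle -/

section Circle

/-- The covering of the one-dimensional torus by the line. -/
noncomputable def wind (x : ℝ) : Torus 1 := fun _ => (x : AddCircle (2 * Real.pi))

lemma continuous_wind : Continuous wind :=
  continuous_pi fun _ => AddCircle.continuous_mk' _

lemma integral_wind (f : Torus 1 → ℝ) (a : ℝ) :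
    ∫ x in a..a + 2 * Real.pi, f (wind x) = ∫ x, f x := by
  have h1 := AddCircle.intervalIntegral_preimage (2 * Real.pi) a
    fun z : AddCircle (2 * Real.pi) => f fun _ => z
  have h2 := (volume_preserving_funUnique (Fin 1) (AddCircle (2 * Real.pi))).integral_comp'
    fun z : AddCircle (2 * Real.pi) => f fun _ => z
  refine h1.trans (h2.symm.trans (integral_congr_ae (ae_of_all _ fun x => congrArg f ?_)))
  funext j
  rw [Subsingleton.elim j 0]
  rfl

lemma exists_wind_eq (a : ℝ) (y : Torus 1) : ∃ x ∈ Set.Icc a (a + 2 * Real.pi), wind x = y := by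
  have h : y 0 ∈ QuotientAddGroup.mk '' Set.Icc a (a + 2 * Real.pi) := by
    rw [AddCircle.coe_image_Icc_eq]
    exact Set.mem_univ _
  obtain ⟨x, hx, hxy⟩ := h
  refine ⟨x, hx, funext fun j => ?_⟩
  rw [Subsingleton.elim j 0]
  exact hxy

/-- The Fourier coefficients of the derivative on the circle. -/
noncomputable def dcoeff (b : (Fin 1 → ℤ) → ℂ) (k : Fin 1 → ℤ) : ℂ := Complex.I * (k 0 : ℂ) * b k

lemma freqNorm_one (k : Fin 1 → ℤ) : freqNorm k = |(k 0 : ℝ)| := by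
  rw [freqNorm, Fin.sum_univ_one, Real.sqrt_sq_eq_abs]

lemma norm_dcoeff (b : (Fin 1 → ℤ) → ℂ) (k : Fin 1 → ℤ) :
    ‖dcoeff b k‖ = freqNorm k * ‖b k‖ := by
  rw [dcoeff, norm_mul, norm_mul, Complex.norm_I, one_mul, Complex.norm_intCast, freqNorm_one]

lemma dcoeff_symm {b : (Fin 1 → ℤ) → ℂ} (h : ∀ k, b (-k) = conj (b k)) (k : Fin 1 → ℤ) :
    dcoeff b (-k) = conj (dcoeff b k) := by
  rw [dcoeff, dcoeff, h, map_mul, map_mul, Complex.conj_I, map_intCast, Pi.neg_apply]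
  push_cast
  ring

lemma dcoeff_eq_zero {S : Finset (Fin 1 → ℤ)} {b : (Fin 1 → ℤ) → ℂ} (hb : ∀ k ∉ S, b k = 0) :
    ∀ k ∉ S, dcoeff b k = 0 := fun k hk => by rw [dcoeff, hb k hk, mul_zero]

lemma hasDerivAt_trig_wind {S : Finset (Fin 1 → ℤ)} {b : (Fin 1 → ℤ) → ℂ}
    (hb : ∀ k ∉ S, b k = 0) (x : ℝ) :
    HasDerivAt (fun x => trig b (wind x)) (trig (dcoeff b) (wind x)) x := by
  have e : ∀ {a : (Fin 1 → ℤ) → ℂ}, (∀ k ∉ S, a k = 0) → ∀ x, trig a (wind x) =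
      (vol 1)⁻¹ * (∑ k ∈ S, a k * fourier (k 0) (x : AddCircle (2 * Real.pi))).re := by
    intro a ha x
    rw [trig_eq_scaledRe ha]
    change (vol 1)⁻¹ * ((∑ k ∈ S, a k • mexp k : C(Torus 1, ℂ)) (wind x)).re = _
    rw [ContinuousMap.sum_apply]
    congr 2
    refine Finset.sum_congr rfl fun k _ => ?_
    rw [ContinuousMap.smul_apply, smul_eq_mul, mexp_apply, Fin.prod_univ_one]
    rfl
  rw [e (dcoeff_eq_zero hb)]
  simp only [e hb]
  refine HasDerivAt.const_mul _ ?_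
  refine Complex.reCLM.hasFDerivAt.comp_hasDerivAt x (f := fun x : ℝ =>
    ∑ k ∈ S, b k * fourier (k 0) (x : AddCircle (2 * Real.pi))) ?_
  refine HasDerivAt.fun_sum fun k _ => ?_
  refine ((hasDerivAt_fourier (2 * Real.pi) (k 0) x).const_mul (b k)).congr_deriv ?_
  have hpi : (Real.pi : ℂ) ≠ 0 := by exact_mod_cast Real.pi_ne_zero
  rw [dcoeff]
  push_cast
  field_simp

lemma memLp_of_continuous {d : ℕ} {f : Torus d → ℝ} (hf : Continuous f) (p : ℝ≥0∞) :
    MemLp f p volume := by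
  obtain ⟨C, hC⟩ := isCompact_univ.exists_bound_of_continuousOn hf.continuousOn
  exact MemLp.of_bound hf.aestronglyMeasurable C (ae_of_all _ fun x => hC x (Set.mem_univ x))

lemma integral_sq_mul_abs_le (f g : C(Torus 1, ℝ)) :
    ∫ x, f x ^ 2 * |g x| ≤ Real.sqrt (∫ x, f x ^ 4) * Real.sqrt (∫ x, g x ^ 2) := by
  have hf : MemLp (fun x => f x ^ 2) (ENNReal.ofReal 2) volume :=
    memLp_of_continuous (by fun_prop) _
  have hg : MemLp (fun x => |g x|) (ENNReal.ofReal 2) volume :=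
    memLp_of_continuous (by fun_prop) _
  have h := integral_mul_le_Lp_mul_Lq_of_nonneg Real.HolderConjugate.two_two
    (ae_of_all _ fun x => sq_nonneg (f x)) (ae_of_all _ fun x => abs_nonneg (g x)) hf hg
  rw [← Real.sqrt_eq_rpow, ← Real.sqrt_eq_rpow] at h
  refine h.trans (le_of_eq ?_)
  congr 2
  · exact integral_congr_ae (ae_of_all _ fun x => by
      simp only [Real.rpow_two]; ring)
  · exact integral_congr_ae (ae_of_all _ fun x => by
      simp only [Real.rpow_two, sq_abs])

/-- By Rolle, the derivative `φ` of a periodic function vanishes somewhere. Integrating `(φ³)' = 3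
φ² ψ` from that point over at most one period and applying Cauchy–Schwarz gives the bound. -/
lemma abs_trig_pow_three_le {S : Finset (Fin 1 → ℤ)} {b : (Fin 1 → ℤ) → ℂ}
    (hb : ∀ k ∉ S, b k = 0) (y : Torus 1) :
    |trig (dcoeff b) y| ^ 3 ≤ 3 * (Real.sqrt (∫ x, trig (dcoeff b) x ^ 4) *
      Real.sqrt (∫ x, trig (dcoeff (dcoeff b)) x ^ 2)) := by
  set φ := trig (dcoeff b)
  set ψ := trig (dcoeff (dcoeff b))
  have hH := hasDerivAt_trig_wind hb
  have hφ := hasDerivAt_trig_wind (dcoeff_eq_zero hb)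
  have hper : wind 0 = wind (2 * Real.pi) := by
    funext j
    exact (AddCircle.coe_period (2 * Real.pi)).symm
  obtain ⟨z, -, hz⟩ := exists_hasDerivAt_eq_zero Real.two_pi_pos
    (fun x _ => (hH x).continuousAt.continuousWithinAt) (by simp only [hper]) fun x _ => hH x
  obtain ⟨x, hx, rfl⟩ := exists_wind_eq z y
  have hcont : Continuous fun s => 3 * φ (wind s) ^ 2 * ψ (wind s) := by
    have := continuous_wind
    fun_prop
  have hFTC : ∫ s in z..x, 3 * φ (wind s) ^ 2 * ψ (wind s) = φ (wind x) ^ 3 := by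
    have h := intervalIntegral.integral_eq_sub_of_hasDerivAt (a := z) (b := x)
      (fun s _ => (hφ s).fun_pow 3) ((by simpa using hcont :
        Continuous fun s => ((3 : ℕ) : ℝ) * φ (wind s) ^ (3 - 1) * ψ (wind s)).intervalIntegrable
          z x)
    have hz' : φ (wind z) = 0 := hz
    rw [hz', zero_pow three_ne_zero, sub_zero] at h
    rw [← h]
    refine intervalIntegral.integral_congr fun s _ => ?_
    norm_num [φ, ψ]
  have habs : Continuous fun s => |3 * φ (wind s) ^ 2 * ψ (wind s)| := hcont.abs
  calc |φ (wind x)| ^ 3 = |∫ s in z..x, 3 * φ (wind s) ^ 2 * ψ (wind s)| := by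
        rw [hFTC, abs_pow]
    _ ≤ ∫ s in z..x, |3 * φ (wind s) ^ 2 * ψ (wind s)| :=
        intervalIntegral.abs_integral_le_integral_abs hx.1
    _ ≤ ∫ s in z..z + 2 * Real.pi, |3 * φ (wind s) ^ 2 * ψ (wind s)| :=
        intervalIntegral.integral_mono_interval le_rfl hx.1 hx.2
          (ae_of_all _ fun s => abs_nonneg _) (habs.intervalIntegrable _ _)
    _ = ∫ s in z..z + 2 * Real.pi, 3 * (φ (wind s) ^ 2 * |ψ (wind s)|) := by
        refine intervalIntegral.integral_congr fun s _ => ?_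
        rw [abs_mul, abs_mul, abs_of_pos (by norm_num : (0 : ℝ) < 3), abs_of_nonneg (sq_nonneg _),
          mul_assoc]
    _ = 3 * ∫ x, φ x ^ 2 * |ψ x| := by
        rw [intervalIntegral.integral_const_mul, integral_wind fun x => φ x ^ 2 * |ψ x|]
    _ ≤ _ := mul_le_mul_of_nonneg_left (integral_sq_mul_abs_le φ ψ) (by norm_num)

lemma integral_trig_sq_le {S : Finset (Fin 1 → ℤ)} {b : (Fin 1 → ℤ) → ℂ}
    (hb : ∀ k ∉ S, b k = 0) (hsymm : ∀ k, b (-k) = conj (b k)) {X : (Fin 1 → ℤ) → ℝ}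
    (hX : Summable X) (hle : ∀ k, freqNorm k ^ 4 * ‖b k‖ ^ 2 ≤ X k) :
    ∫ x, trig (dcoeff (dcoeff b)) x ^ 2 ≤ (vol 1)⁻¹ * ∑' k, X k := by
  have hz := dcoeff_eq_zero (dcoeff_eq_zero hb)
  have hsum : Summable fun k => ‖dcoeff (dcoeff b) k‖ :=
    summable_of_ne_finset_zero (s := S) fun k hk => by rw [hz k hk, norm_zero]
  have h := hasSum_sq_norm_coeff (memLp_of_continuous (trig (dcoeff (dcoeff b))).continuous 2)
  rw [le_inv_mul_iff₀ (vol_pos 1), ← h.tsum_eq]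
  refine h.summable.tsum_le_tsum (fun k => ?_) hX
  rw [coeff_trig hsum (dcoeff_symm (dcoeff_symm hsymm)), norm_dcoeff, norm_dcoeff]
  refine le_trans (le_of_eq ?_) (hle k)
  ring

lemma norm_eq_abs_component (v : Vec 1) : ‖v‖ = |v 0| := by
  rw [EuclideanSpace.norm_eq, Fin.sum_univ_one, Real.sqrt_sq_eq_abs, Real.norm_eq_abs, abs_abs]

/-- The interpolation inequality `‖u‖_∞³ ≤ 3 ‖u²‖₂ ‖u'‖₂` for derivatives `u` on the circle. -/
theorem norm_gradTrig_pow_three_le {c : (Fin 1 → ℤ) → ℂ} (hsymm : ∀ k, c (-k) = conj (c k))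
    (hc : Summable fun k => freqNorm k * ‖c k‖) (hs : Summable fun k => freqNorm k ^ 4 * ‖c k‖ ^ 2)
    (y : Torus 1) :
    ‖gradTrig c y‖ ^ 3 ≤ 3 * (Real.sqrt (∫ x, ‖gradTrig c x‖ ^ 4) *
      Real.sqrt ((vol 1)⁻¹ * ∑' k, freqNorm k ^ 4 * ‖c k‖ ^ 2)) := by
  set X := (vol 1)⁻¹ * ∑' k, freqNorm k ^ 4 * ‖c k‖ ^ 2
  have hlim : Tendsto (fun N => component 0 (gradTrig (trunc (cube 1 N) c))) atTop
      (𝓝 (component 0 (gradTrig c))) :=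
    ((component 0).continuous.tendsto _).comp (tendsto_gradTrig_trunc hc)
  -- The inequality is proved for trigonometric polynomials, which are differentiable, and passes to
  -- the limit by uniform convergence of the gradients.
  have hN : ∀ N, |component 0 (gradTrig (trunc (cube 1 N) c)) y| ^ 3 ≤
      3 * (Real.sqrt (integralC 1 (component 0 (gradTrig (trunc (cube 1 N) c)) ^ 4)) *
        Real.sqrt X) := by
    intro N
    have hb : ∀ k ∉ cube 1 N, trunc (cube 1 N) c k = 0 := fun k hk => trunc_of_notMem c hk
    refine (abs_trig_pow_three_le hb y).trans (mul_le_mul_of_nonneg_left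
      (mul_le_mul_of_nonneg_left (Real.sqrt_le_sqrt ?_) (Real.sqrt_nonneg _)) (by norm_num))
    refine integral_trig_sq_le hb (trunc_cube_symm hsymm N) hs fun k => ?_
    have := freqNorm_nonneg k
    have := norm_trunc_le (cube 1 N) c k
    gcongr
  have hl : Continuous fun f : C(Torus 1, ℝ) => |f y| ^ 3 := by fun_prop
  have hr : Continuous fun f : C(Torus 1, ℝ) => 3 * (Real.sqrt (integralC 1 (f ^ 4)) *
      Real.sqrt X) := by fun_prop
  have h := le_of_tendsto_of_tendsto' ((hl.tendsto _).comp hlim) ((hr.tendsto _).comp hlim) hN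
  rw [norm_eq_abs_component]
  refine h.trans (le_of_eq ?_)
  rw [integralC_apply]
  congr 3
  refine integral_congr_ae (ae_of_all _ fun x => ?_)
  simp only [norm_eq_abs_component]
  rw [← abs_pow, abs_of_nonneg (by positivity)]
  rfl

lemma summable_inv_sq_one : Summable fun k : Fin 1 → ℤ => (freqNorm k ^ 2)⁻¹ := by
  have h : Summable fun n : ℤ => 1 / (n : ℝ) ^ 2 := Real.summable_one_div_int_pow.mpr one_lt_two
  refine ((Equiv.funUnique (Fin 1) ℤ).summable_iff.mpr h).congr fun k => ?_
  rw [freqNorm_one, sq_abs, ← one_div]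
  rfl

/-- On the circle the lattice sum of `|k|^{-2}` converges, so H² alone makes the gradient series
absolutely convergent. Hence the bound in dimension one holds down to time zero. -/
lemma summable_freqNorm_mul_one {c : (Fin 1 → ℤ) → ℂ}
    (hs : Summable fun k => freqNorm k ^ 4 * ‖c k‖ ^ 2) :
    Summable fun k => freqNorm k * ‖c k‖ := by
  refine (summable_inv_sq_one.add hs).of_nonneg_of_le
    (fun k => mul_nonneg (freqNorm_nonneg k) (norm_nonneg _)) fun k => ?_
  rcases (freqNorm_nonneg k).eq_or_lt with h0 | h0
  · rw [← h0]; norm_num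
  · have h1 : freqNorm k * ‖c k‖ = (freqNorm k)⁻¹ * (freqNorm k ^ 2 * ‖c k‖) := by field_simp
    have h2 : (freqNorm k ^ 2)⁻¹ = (freqNorm k)⁻¹ ^ 2 := by rw [inv_pow]
    rw [h1, h2]
    nlinarith [sq_nonneg ((freqNorm k)⁻¹ - freqNorm k ^ 2 * ‖c k‖),
      sq_nonneg ((freqNorm k)⁻¹), sq_nonneg (freqNorm k ^ 2 * ‖c k‖)]

end Circle

end ThinFilm

namespace ThinFilm

/-! ### The gradient bound in dimension one -/

section DimensionOne

/-- The energy of a global solution, in terms of its Fourier coefficients, never exceeds the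
initial energy in dimension one. -/
lemma IsGlobalSolution.energy_bound_one {ν : ℝ} {h₀ : Torus 1 → ℝ} {h : ℝ → Torus 1 → ℝ}
    (hν : 0 < ν) (hh₀ : MemSobolev 2 h₀) (sol : IsGlobalSolution ν h₀ h) {t : ℝ} (ht : 0 ≤ t) :
    (Summable fun k => freqNorm k ^ 4 * ‖coeff (h t) k‖ ^ 2) ∧
      ν / 2 * ((vol 1)⁻¹ * ∑' k, freqNorm k ^ 4 * ‖coeff (h t) k‖ ^ 2) +
        1 / 4 * ∫ x, (‖gradTrig (coeff (h t)) x‖ ^ 2 - 1) ^ 2 ≤ energy ν h₀ := by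
  have hd : 1 ≤ 3 := by norm_num
  have hs := summable_of_memSobolev (n := 4) (by norm_num) (by norm_num) hh₀
  rcases ht.eq_or_lt with rfl | ht0
  · have hc : coeff (h 0) = coeff h₀ := funext (coeff_congr_ae sol.initial)
    rw [hc]
    obtain ⟨-, hE⟩ := energy_eq hd hh₀ ν
    refine ⟨hs, le_of_eq ?_⟩
    rw [hE]
    congr 2
    refine integral_congr_ae ?_
    filter_upwards [grad_ae_eq_gradTrig (summable_freqNorm_mul_one hs)] with x hx
    rw [hx]
  · obtain ⟨g, F, hE, hA, -⟩ := sol.exists_bounded_mildFlow hd hν hh₀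
    have hs4 : Summable fun k => freqNorm k ^ 4 * ‖coeff (h t) k‖ ^ 2 :=
      MildFlow.summable_of_sob (c := fun t => coeff (h t)) (n := 2) (hA t ht)
    refine ⟨hs4, ?_⟩
    have h1 := hE t ht0
    rw [MildFlow.flowEnergy, F.eq_gradTrig ht0 (summable_freqNorm_mul_one hs4), wellEnergy_eq,
      integral_const_mul] at h1
    exact h1

lemma integral_norm_pow_four_le (u : C(Torus 1, Vec 1)) :
    ∫ x, ‖u x‖ ^ 4 ≤ 2 * (∫ x, (‖u x‖ ^ 2 - 1) ^ 2) + 2 * vol 1 := by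
  have i1 := integrable_norm_pow_four (v := u) fun j => memLp_component u j 4
  have i2 := integrable_well (v := u) fun j => memLp_component u j 4
  have h := integral_mono i1 ((i2.const_mul 2).add (integrable_const (2 : ℝ)))
    fun x => show ‖u x‖ ^ 4 ≤ 2 * (‖u x‖ ^ 2 - 1) ^ 2 + 2 by nlinarith [sq_nonneg (‖u x‖ ^ 2 - 2)]
  rw [integral_add' (i2.const_mul 2) (integrable_const _), integral_const_mul, integral_const,
    volume_real_univ, smul_eq_mul, mul_comm (vol 1)] at h
  exact h

/-- No smoothing is used: the interpolation inequality is applied at each fixed time, with both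
factors controlled by the energy. -/
theorem exists_supNorm_le_one : ∃ C : ℝ, 0 < C ∧
    ∀ (ν : ℝ) (h₀ : Torus 1 → ℝ) (h : ℝ → Torus 1 → ℝ), 0 < ν → ν ≤ 1 →
      MemSobolev 2 h₀ → IsGlobalSolution ν h₀ h →
      ∀ t : ℝ, 0 ≤ t → supNorm (grad (h t)) ≤ ENNReal.ofReal
        (C * ν ^ (-(1 / 6) : ℝ) * energy ν h₀ ^ (1 / 6 : ℝ) * (energy ν h₀ ^ (1 / 6 : ℝ) + 1)) := by
  have hv := vol_pos 1
  set C₀ := 3 * (Real.sqrt 8 + Real.sqrt (2 * vol 1)) * Real.sqrt 2 with hC₀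
  have hC0 : 0 ≤ C₀ := by positivity
  refine ⟨C₀ + 1, by positivity, fun ν h₀ h hν hν1 hh₀ sol t ht => ?_⟩
  obtain ⟨hs, hE⟩ := sol.energy_bound_one hν hh₀ ht
  have hE0 : 0 ≤ energy ν h₀ :=
    le_trans (by positivity) (energy_lower_bound (by norm_num) hh₀ hν hν1)
  set E := energy ν h₀
  set u := gradTrig (coeff (h t))
  have hc := summable_freqNorm_mul_one hs
  set X := (vol 1)⁻¹ * ∑' k, freqNorm k ^ 4 * ‖coeff (h t) k‖ ^ 2 with hX
  set W := ∫ x, (‖u x‖ ^ 2 - 1) ^ 2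
  have hX0 : 0 ≤ X := mul_nonneg (by positivity) (tsum_nonneg fun k => by
    have := freqNorm_nonneg k; positivity)
  have hW0 : 0 ≤ W := integral_nonneg fun x => sq_nonneg _
  have hXE : X ≤ 2 * (E / ν) := by
    rw [mul_div_assoc', le_div_iff₀ hν]
    linarith
  have hWE : W ≤ 4 * E := by
    have := mul_nonneg (half_pos hν).le hX0
    linarith
  -- Sixth roots are named because `E^{1/2} = p³` and `ν^{1/2} = q³`: the interpolation bound then
  -- compares directly with a cube.
  set p := E ^ (1 / 6 : ℝ) with hp
  set q := ν ^ (1 / 6 : ℝ) with hq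
  have hp0 : 0 ≤ p := Real.rpow_nonneg hE0 _
  have hq0 : 0 < q := Real.rpow_pos_of_pos hν _
  have hpe : Real.sqrt E = p ^ 3 := by
    rw [hp, Real.sqrt_eq_rpow, ← Real.rpow_natCast, ← Real.rpow_mul hE0]; norm_num
  have hqe : Real.sqrt ν = q ^ 3 := by
    rw [hq, Real.sqrt_eq_rpow, ← Real.rpow_natCast, ← Real.rpow_mul hν.le]; norm_num
  have hX' : Real.sqrt X ≤ Real.sqrt 2 * (p ^ 3 / q ^ 3) := by
    rw [← hpe, ← hqe, ← Real.sqrt_div hE0, ← Real.sqrt_mul zero_le_two]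
    exact Real.sqrt_le_sqrt hXE
  have hU : Real.sqrt (∫ x, ‖u x‖ ^ 4) ≤ Real.sqrt 8 * p ^ 3 + Real.sqrt (2 * vol 1) := by
    rw [← hpe, ← Real.sqrt_mul (by norm_num)]
    refine Real.sqrt_le_iff.mpr ⟨by positivity, ?_⟩
    rw [add_sq, Real.sq_sqrt (by positivity), Real.sq_sqrt (by positivity)]
    have h1 := integral_norm_pow_four_le u
    have h2 := mul_nonneg (Real.sqrt_nonneg (8 * E)) (Real.sqrt_nonneg (2 * vol 1))
    linarith
  have hU' : Real.sqrt (∫ x, ‖u x‖ ^ 4) ≤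
      (Real.sqrt 8 + Real.sqrt (2 * vol 1)) * (p ^ 3 + 1) := by
    have h1 := Real.sqrt_nonneg 8
    have h2 := mul_nonneg (Real.sqrt_nonneg (2 * vol 1)) (pow_nonneg hp0 3)
    nlinarith
  have hbound : ∀ y, ‖u y‖ ≤ (C₀ + 1) * (p * (p + 1) / q) := by
    intro y
    refine le_of_pow_le_pow_left₀ three_ne_zero (by positivity) ?_
    calc ‖u y‖ ^ 3 ≤ 3 * (Real.sqrt (∫ x, ‖u x‖ ^ 4) * Real.sqrt X) :=
          norm_gradTrig_pow_three_le (coeff_neg (h t)) hc hs y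
      _ ≤ 3 * ((Real.sqrt 8 + Real.sqrt (2 * vol 1)) * (p ^ 3 + 1) *
          (Real.sqrt 2 * (p ^ 3 / q ^ 3))) := by gcongr
      _ = C₀ * (p ^ 3 * (p ^ 3 + 1) / q ^ 3) := by rw [hC₀]; ring
      _ ≤ (C₀ + 1) ^ 3 * (p ^ 3 * (p + 1) ^ 3 / q ^ 3) := by
          have h1 : C₀ ≤ (C₀ + 1) ^ 3 := by nlinarith [mul_nonneg hC0 hC0, pow_nonneg hC0 3]
          have h2 : p ^ 3 + 1 ≤ (p + 1) ^ 3 := by nlinarith [mul_nonneg hp0 hp0]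
          gcongr
      _ = _ := by ring
  have hν6 : ν ^ (-(1 / 6) : ℝ) = q⁻¹ := Real.rpow_neg hν.le _
  rw [supNorm, eLpNorm_exponent_top]
  refine eLpNormEssSup_le_of_ae_bound ?_
  filter_upwards [grad_ae_eq_gradTrig hc] with x hx
  rw [hx, hν6]
  refine (hbound x).trans (le_of_eq ?_)
  field_simp

end DimensionOne

end ThinFilm

/-! ### Assembly of the five statements. -/

theorem corollary1p4 :
    -- dimension 1, all times
    (∃ C₁ : ℝ, 0 < C₁ ∧
      ∀ (ν : ℝ) (h₀ : Torus 1 → ℝ) (h : ℝ → Torus 1 → ℝ), 0 < ν → ν ≤ 1 →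
        MemSobolev 2 h₀ → ∫ x, h₀ x = 0 → IsGlobalSolution ν h₀ h →
        ∀ t : ℝ, 0 ≤ t → supNorm (grad (h t)) ≤ ENNReal.ofReal
          (C₁ * ν ^ (-(1 / 6) : ℝ) * energy ν h₀ ^ (1 / 6 : ℝ) *
            (energy ν h₀ ^ (1 / 6 : ℝ) + 1))) ∧
    -- dimension 2, times bounded below
    (∀ τ : ℝ, 0 < τ → ∃ C₂ : ℝ, 0 < C₂ ∧
      ∀ (ν : ℝ) (h₀ : Torus 2 → ℝ) (h : ℝ → Torus 2 → ℝ), 0 < ν → ν ≤ 1 →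
        MemSobolev 2 h₀ → ∫ x, h₀ x = 0 → IsGlobalSolution ν h₀ h →
        ∀ t : ℝ, τ ≤ t → supNorm (grad (h t)) ≤ ENNReal.ofReal
          (C₂ * (energy ν h₀ / ν) ^ (1 / 2 : ℝ) * |Real.log ((energy ν h₀ + 1) / ν)|)) ∧
    -- dimension 3, times bounded below
    (∀ τ : ℝ, 0 < τ → ∃ C₃ : ℝ, 0 < C₃ ∧
      ∀ (ν : ℝ) (h₀ : Torus 3 → ℝ) (h : ℝ → Torus 3 → ℝ), 0 < ν → ν ≤ 1 →
        MemSobolev 2 h₀ → ∫ x, h₀ x = 0 → IsGlobalSolution ν h₀ h →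
        ∀ t : ℝ, τ ≤ t → supNorm (grad (h t)) ≤ ENNReal.ofReal
          (C₃ * ν ^ (-(3 / 2) : ℝ) * (energy ν h₀ + 1) ^ (3 / 2 : ℝ))) ∧
    -- dimension 2, times bounded above
    (∀ T : ℝ, 0 < T → ∃ C₂' : ℝ, 0 < C₂' ∧
      ∀ (ν : ℝ) (h₀ : Torus 2 → ℝ) (h : ℝ → Torus 2 → ℝ), 0 < ν → ν ≤ 1 →
        MemSobolev 2 h₀ → ∫ x, h₀ x = 0 → IsGlobalSolution ν h₀ h →
        ∀ t : ℝ, 0 ≤ t → t ≤ T →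
          supNorm (grad (h t) - grad (propagator ν t h₀)) ≤ ENNReal.ofReal
            (C₂' * (energy ν h₀ / ν) ^ (1 / 2 : ℝ) * |Real.log ((energy ν h₀ + 1) / ν)|)) ∧
    -- dimension 3, times bounded above
    (∀ T : ℝ, 0 < T → ∃ C₃' : ℝ, 0 < C₃' ∧
      ∀ (ν : ℝ) (h₀ : Torus 3 → ℝ) (h : ℝ → Torus 3 → ℝ), 0 < ν → ν ≤ 1 →
        MemSobolev 2 h₀ → ∫ x, h₀ x = 0 → IsGlobalSolution ν h₀ h →
        ∀ t : ℝ, 0 ≤ t → t ≤ T →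
          supNorm (grad (h t) - grad (propagator ν t h₀)) ≤ ENNReal.ofReal
            (C₃' * ν ^ (-(3 / 2) : ℝ) * (energy ν h₀ + 1) ^ (3 / 2 : ℝ))) := by
  refine ⟨?_, fun τ hτ => ?_, fun τ hτ => ?_, fun T _ => ?_, fun T _ => ?_⟩
  · obtain ⟨C, hC, H⟩ := exists_supNorm_le_one
    exact ⟨C, hC, fun ν h₀ h hν hν1 hh₀ _ sol => H ν h₀ h hν hν1 hh₀ sol⟩
  · obtain ⟨C, hC, H⟩ := exists_supNorm_le_log hτ
    exact ⟨C, hC, fun ν h₀ h hν hν1 hh₀ _ sol => (H ν h₀ h hν hν1 hh₀ sol).1⟩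
  · obtain ⟨C, hC, H⟩ := exists_supNorm_le_power (d := 3) le_rfl hτ
    exact ⟨C, hC, fun ν h₀ h hν hν1 hh₀ _ sol => (H ν h₀ h hν hν1 hh₀ sol).1⟩
  -- The bound for the difference with the linear evolution holds at all times, so the constant does
  -- not even depend on `T`; the parameter `τ` only limits the smoothing window, and `1` will do.
  · obtain ⟨C, hC, H⟩ := exists_supNorm_le_log one_pos
    exact ⟨C, hC, fun ν h₀ h hν hν1 hh₀ _ sol t ht _ => (H ν h₀ h hν hν1 hh₀ sol).2 t ht⟩
  · obtain ⟨C, hC, H⟩ := exists_supNorm_le_power (d := 3) le_rfl one_pos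
    exact ⟨C, hC, fun ν h₀ h hν hν1 hh₀ _ sol t ht _ => (H ν h₀ h hν hν1 hh₀ sol).2 t ht⟩
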